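/- Let $a_0<a_1<\dots<a_n$ be nonnegative integers with $\gcd(a_0,\dots,a_n)=1$, let $S=\{a_0,\dots,a_n\}$, and let $t\ge 0$ be an integer. Call an integer $s \ge 0$ feasible if $a_0x_0+\dots+a_nx_n=s$ for some $x\in\mathbb Z_{\ge 0}^{n+1}$. Unbounded SubsetSum is the problem to decide, given $a_0,\dots,a_n$ and $t$, whether $t$ is feasible. Let $F$ be the largest infeasible integer ($F:=0$ if there is none). For $j\ge 1$ let $I^{(j)}=((j-1)a_n,\,j a_n]\cap\mathbb Z$ and let $A^{(j)}$ be the set of feasible integers in $I^{(j)}$. Let $R\ge 0$ be the smallest integer with $|A^{(2^R)}|=a_n$ or $t\le 2^R a_n$. **Theorem.** 1. There are a program for the word RAM (unit cost for addition, truncated subtraction, multiplication, division with remainder dropped, indirect memory access and branching on zero; the $n+3$ numbers $n, t, a_0,\dots,a_n$ are given in memory, one per word) and constants $c$ and $C$, such that on every instance the program, with all its words below $(a_n+t+2)^c$ (i.e. words of $O(\log(a_n+t))$ bits), decides Unbounded SubsetSum in at most $$C\cdot a_n\,\log(1+a_n)\cdot\log\Big(2+\min\Big\{\frac{t}{a_n},\frac{F}{a_n}\Big\}\Big)$$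 steps. In its run it also computes the sets $A^{(2^0)},A^{(2^1)},\dots,A^{(2^R)}$: at the end their characteristic vectors, each of length $a_n$, stand one after the other in memory. 2. There is a constant $C'$ such that on every instance $$a_n\log(1+a_n)\cdot\log\Big(2+\min\Big\{\frac{t}{a_n},\frac{F}{a_n}\Big\}\Big)\le C'\cdot a_n\log(1+a_n)\cdot\log\Big(2+\frac{a_n}{n+1}\Big).$$ Hence Unbounded SubsetSum is solved in time $O(a_n\log a_n\cdot\log(\min\{t/a_n,F/a_n\}))=O(a_n\log a_n\cdot\log(a_n/n))$, where logarithms that are smaller than a positive constant are replaced by such a constant. 3. For all $i,j\ge 1$, $$A^{(i+j)}=\big(A^{(i)}+A^{(j)}+(S\cup\{0\})\big)\cap I^{(i+j)}.$$ -/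

import Mathlib

open scoped Pointwise

noncomputable section

namespace UnboundedSubsetSum

/-! ### The integer program, the Frobenius number and the feasibility sets -/

/-- The target `t` is feasible for the item sizes `a 0, …, a n`: some nonnegative integral
solution of `a 0 * x 0 + … + a n * x n = t` exists. -/
def Feasible {n : ℕ} (a : Fin (n + 1) → ℕ) (t : ℕ) : Prop :=
  ∃ x : Fin (n + 1) → ℕ, ∑ i, a i * x i = t

/-- The admissible item sizes: listed in strictly increasing order, with no common divisor. -/
def IsItemList {n : ℕ} (a : Fin (n + 1) → ℕ) : Prop :=
  StrictMono a ∧ Finset.univ.gcd a = 1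

/-- The largest item size `a_n` of a sorted list of items. -/
def maxItem {n : ℕ} (a : Fin (n + 1) → ℕ) : ℕ := a (Fin.last n)

/-- The Frobenius number: the largest infeasible target, and `0` if every target is feasible
(see `isGreatest_frobenius`). -/
def frobenius {n : ℕ} (a : Fin (n + 1) → ℕ) : ℕ := sSup {t | ¬ Feasible a t}

/-- The interval `I^(j) = ((j - 1) a_n, j a_n]`, for `j ≥ 1`. -/
def interval {n : ℕ} (a : Fin (n + 1) → ℕ) (j : ℕ) : Set ℕ :=
  Set.Ioc ((j - 1) * maxItem a) (j * maxItem a)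

/-- The set `A^(j)` of all feasible targets in the interval `I^(j)`, for `j ≥ 1`. -/
def feasibleSet {n : ℕ} (a : Fin (n + 1) → ℕ) (j : ℕ) : Set ℕ :=
  {s ∈ interval a j | Feasible a s}

/-- The number `R` of doublings: the smallest `R` such that all `a_n` integers of `I^(2^R)` are
feasible, or such that `2^R ≥ k`, where `t ∈ I^(k)` (that is, `t ≤ 2^R a_n`). -/
def doublingDepth {n : ℕ} (a : Fin (n + 1) → ℕ) (t : ℕ) : ℕ :=
  sInf {R | (feasibleSet a (2 ^ R)).ncard = maxItem a ∨ t ≤ 2 ^ R * maxItem a}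

theorem feasible_iff_mem_closure {n : ℕ} (a : Fin (n + 1) → ℕ) (t : ℕ) :
    Feasible a t ↔ t ∈ AddSubmonoid.closure (Set.range a) := by
  constructor
  · rintro ⟨x, rfl⟩
    refine AddSubmonoid.sum_mem _ fun i _ => ?_
    rw [mul_comm, ← smul_eq_mul]
    exact AddSubmonoid.nsmul_mem _ (AddSubmonoid.subset_closure (Set.mem_range_self i)) _
  · intro h
    induction h using AddSubmonoid.closure_induction with
    | mem y hy =>
      obtain ⟨i, rfl⟩ := hy
      exact ⟨fun j => if j = i then 1 else 0, by simp⟩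
    | zero => exact ⟨fun _ => 0, by simp⟩
    | add y z _ _ hy hz =>
      obtain ⟨u, rfl⟩ := hy
      obtain ⟨v, rfl⟩ := hz
      exact ⟨u + v, by simp [mul_add, Finset.sum_add_distrib]⟩

/-- If some target is infeasible, then `frobenius a` is indeed the largest infeasible target. -/
theorem isGreatest_frobenius {n : ℕ} (a : Fin (n + 1) → ℕ) (ha : IsItemList a)
    (h : ∃ t, ¬ Feasible a t) : IsGreatest {t | ¬ Feasible a t} (frobenius a) := by
  have hg : Nat.setGcd (Set.range a) = 1 := by
    have hd : Nat.setGcd (Set.range a) ∣ Finset.univ.gcd a :=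
      Finset.dvd_gcd fun i _ => Nat.setGcd_dvd_of_mem ⟨i, rfl⟩
    rwa [ha.2, Nat.dvd_one] at hd
  have h1 : 1 ∉ Set.range a := by
    rintro ⟨i, hi⟩
    obtain ⟨t, ht⟩ := h
    exact ht ⟨fun j => if j = i then t else 0, by simp [hi]⟩
  obtain ⟨F, hF⟩ := exists_frobeniusNumber_iff.2 ⟨hg, h1⟩
  have hs : {t | ¬ Feasible a t} = {k | k ∉ AddSubmonoid.closure (Set.range a)} := by
    ext t; simp [feasible_iff_mem_closure]
  have hF' : IsGreatest {t | ¬ Feasible a t} F := hs ▸ hF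
  rw [frobenius, hF'.csSup_eq]
  exact hF'

/-! ### The word RAM

A program has registers and a random access memory, both indexed by `ℕ` and holding natural
numbers. It is a fixed finite text, so it mentions finitely many registers; the memory is addressed
through registers. All values are machine words, i.e. natural numbers below a bound `W`; an
operation whose result is not below `W` has no execution. Each elementary operation and each
evaluation of a branching or loop condition takes one step. -/

structure State where
  reg : ℕ → ℕ
  mem : ℕ → ℕ

/-- Arithmetic operations; subtraction is truncated at `0`, division is rounded down. -/
inductive Op where
  | add
  | sub
  | mul
  | div

def Op.eval : Op → ℕ → ℕ → ℕ
  | .add, x, y => x + y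
  | .sub, x, y => x - y
  | .mul, x, y => x * y
  | .div, x, y => x / y

inductive Program where
  /-- do nothing -/
  | skip
  /-- `reg d := k` -/
  | const (d k : ℕ)
  /-- `reg d := reg x ∘ reg y` -/
  | op (o : Op) (d x y : ℕ)
  /-- `reg d := mem (reg x)` -/
  | load (d x : ℕ)
  /-- `mem (reg x) := reg y` -/
  | store (x y : ℕ)
  /-- first `p`, then `q` -/
  | seq (p q : Program)
  /-- `p` if `reg x ≠ 0`, otherwise `q` -/
  | cond (x : ℕ) (p q : Program)
  /-- repeat `p` as long as `reg x ≠ 0` -/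
  | loop (x : ℕ) (p : Program)

/-- `Exec W p s T s'`: with machine words below `W`, the program `p` started in the state `s` halts
in the state `s'` after exactly `T` steps. -/
inductive Exec (W : ℕ) : Program → State → ℕ → State → Prop
  | skip (s : State) : Exec W .skip s 1 s
  | const (d k : ℕ) (s : State) (h : k < W) :
      Exec W (.const d k) s 1 ⟨Function.update s.reg d k, s.mem⟩
  | op (o : Op) (d x y : ℕ) (s : State) (h : o.eval (s.reg x) (s.reg y) < W) :
      Exec W (.op o d x y) s 1 ⟨Function.update s.reg d (o.eval (s.reg x) (s.reg y)), s.mem⟩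
  | load (d x : ℕ) (s : State) (h : s.mem (s.reg x) < W) :
      Exec W (.load d x) s 1 ⟨Function.update s.reg d (s.mem (s.reg x)), s.mem⟩
  | store (x y : ℕ) (s : State) :
      Exec W (.store x y) s 1 ⟨s.reg, Function.update s.mem (s.reg x) (s.reg y)⟩
  | seq {p q : Program} {s₁ s₂ s₃ : State} {T₁ T₂ : ℕ} (h₁ : Exec W p s₁ T₁ s₂)
      (h₂ : Exec W q s₂ T₂ s₃) : Exec W (.seq p q) s₁ (T₁ + T₂) s₃
  | condTrue {x : ℕ} {p q : Program} {s s' : State} {T : ℕ} (hx : s.reg x ≠ 0)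
      (h : Exec W p s T s') : Exec W (.cond x p q) s (T + 1) s'
  | condFalse {x : ℕ} {p q : Program} {s s' : State} {T : ℕ} (hx : s.reg x = 0)
      (h : Exec W q s T s') : Exec W (.cond x p q) s (T + 1) s'
  | loopDone {x : ℕ} {p : Program} {s : State} (hx : s.reg x = 0) :
      Exec W (.loop x p) s 1 s
  | loopStep {x : ℕ} {p : Program} {s₁ s₂ s₃ : State} {T₁ T₂ : ℕ} (hx : s₁.reg x ≠ 0)
      (h₁ : Exec W p s₁ T₁ s₂) (h₂ : Exec W (.loop x p) s₂ T₂ s₃) :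
      Exec W (.loop x p) s₁ (T₁ + T₂ + 1) s₃

/-- The machine is deterministic: step count and final state are determined. -/
theorem Exec.unique {W : ℕ} {p : Program} {s s₁ s₂ : State} {T₁ T₂ : ℕ}
    (h₁ : Exec W p s T₁ s₁) (h₂ : Exec W p s T₂ s₂) : T₁ = T₂ ∧ s₁ = s₂ := by
  induction h₁ generalizing T₂ s₂ with
  | skip | const | op | load | store => cases h₂; exact ⟨rfl, rfl⟩
  | seq _ _ ih₁ ih₂ =>
    cases h₂ with
    | seq g₁ g₂ =>
      obtain ⟨rfl, rfl⟩ := ih₁ g₁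
      obtain ⟨rfl, rfl⟩ := ih₂ g₂
      exact ⟨rfl, rfl⟩
  | condTrue hx _ ih =>
    cases h₂ with
    | condTrue _ g => obtain ⟨rfl, rfl⟩ := ih g; exact ⟨rfl, rfl⟩
    | condFalse hx' _ => exact absurd hx' hx
  | condFalse hx _ ih =>
    cases h₂ with
    | condTrue hx' _ => exact absurd hx hx'
    | condFalse _ g => obtain ⟨rfl, rfl⟩ := ih g; exact ⟨rfl, rfl⟩
  | loopDone hx =>
    cases h₂ with
    | loopDone _ => exact ⟨rfl, rfl⟩
    | loopStep hx' _ _ => exact absurd hx hx'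
  | loopStep hx _ _ ih₁ ih₂ =>
    cases h₂ with
    | loopDone hx' => exact absurd hx' hx
    | loopStep _ g₁ g₂ =>
      obtain ⟨rfl, rfl⟩ := ih₁ g₁
      obtain ⟨rfl, rfl⟩ := ih₂ g₂
      exact ⟨rfl, rfl⟩

/-- The initial memory for items `a 0, …, a n` and target `t`: the numbers
`n, t, a 0, …, a n`, followed by zeros. -/
def inputMem {n : ℕ} (a : Fin (n + 1) → ℕ) (t : ℕ) : ℕ → ℕ
  | 0 => n
  | 1 => t
  | k + 2 => if h : k < n + 1 then a ⟨k, h⟩ else 0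

/-- The initial state: all registers are zero and the memory holds the input. -/
def initState {n : ℕ} (a : Fin (n + 1) → ℕ) (t : ℕ) : State := ⟨fun _ => 0, inputMem a t⟩

/-- The final state `s` holds the decision for the target `t` (1 for feasible, 0 for infeasible)
in register `0`. -/
def Decides {n : ℕ} (a : Fin (n + 1) → ℕ) (t : ℕ) (s : State) : Prop :=
  (Feasible a t → s.reg 0 = 1) ∧ (¬ Feasible a t → s.reg 0 = 0)

/-- The final memory of `s` holds the characteristic vectors of the sets `A^(2^i)` for
`i = 0, …, R`, one after the other: cell `i * a_n + r` with `r < a_n` tells whether the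
`r`-th integer of `I^(2^i)` (counted from `0`) belongs to `A^(2^i)`. -/
def StoresFeasibleSets {n : ℕ} (a : Fin (n + 1) → ℕ) (t : ℕ) (s : State) : Prop :=
  ∀ i ≤ doublingDepth a t, ∀ r < maxItem a,
    ((2 ^ i - 1) * maxItem a + 1 + r ∈ feasibleSet a (2 ^ i) → s.mem (i * maxItem a + r) = 1) ∧
    ((2 ^ i - 1) * maxItem a + 1 + r ∉ feasibleSet a (2 ^ i) → s.mem (i * maxItem a + r) = 0)

/-! ### The time bounds

The summands `1` and `2` inside the logarithms keep them away from zero when `a_n = 1`, or when the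
argument of the last logarithm is not above `1`; up to constant factors they change nothing
else. -/

/-- `a_n log a_n · log (min {t / a_n, F / a_n})` -/
def targetTime {n : ℕ} (a : Fin (n + 1) → ℕ) (t : ℕ) : ℝ :=
  maxItem a * Real.log (1 + maxItem a) *
    Real.log (2 + min ((t : ℝ) / maxItem a) ((frobenius a : ℝ) / maxItem a))

/-- `a_n log a_n · log (a_n / n)`, with the number `n + 1` of items in place of `n` so that no
division by zero occurs for a single item. -/
def itemTime {n : ℕ} (a : Fin (n + 1) → ℕ) : ℝ :=
  maxItem a * Real.log (1 + maxItem a) * Real.log (2 + (maxItem a : ℝ) / (n + 1))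

end UnboundedSubsetSum

end

namespace UnboundedSubsetSum

/-! Everything rests on one splitting argument, `Feasible.split`. Build up a feasible `s` item by
item and stop at the last partial sum `x ≤ b`; the next item crosses `b`, so `s = x + a_i + y` with
`x` and `y` feasible. Cutting at `b = i * a_n` puts `x` into `I^(i)`, because items are at most
`a_n`. What remains lies in `I^(j)` either without the crossing item or together with it. This is
the recursion `feasIdx_add_iff`, and `feasibleSet_add` is its form for sets.

One use of the recursion is therefore a Boolean convolution of three 0/1 vectors of length about
`a_n`. It is obtained by counting representations with a fast Fourier transform of length `N =
O(a_n)`, in `O(N log N)` steps (`runs_conv`). Complex numbers are fixed-point with scale `N ^ 16`.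
An error bound growing by a factor 4 per stage (`Cell.butterfly`) stays polynomial in `N`, so the
final counts are known up to 1/4 and can be compared with zero. The targets up to `a_n`, hence
`A^(1)`, come from the same splitting with a bound that doubles each round
(`feasible_lt_two_mul_iff`); its cost is a geometric series.

Starting from `A^(1)`, the program doubles until it reaches `R`. If `A^(2^R)` is full, its elements
cover all residues modulo `a_n`, and adding copies of `a_n` makes every larger target feasible
(`feasible_of_full`). Otherwise, and in any case for `t ≤ 2^R * a_n`, the index of the interval of
`t` is at most `2^R`, and its feasible set is assembled from the `A^(2^i)` by binary digits
(`runs_combine`). One round before the end, `t` is still beyond the interval and the interval still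
has an infeasible member, so `2^(R-1) - 1` is at most `min {t / a_n, F / a_n}`
(`pow_doublingDepth_le`). Hence there are `R + 1 = O(log (2 + min))` convolutions of full length in
each of the two phases (`runs_decideSubsetSum`).

For the second bound, let `B` consist of 0 and the residues of the items modulo `a_n`, and replace
it repeatedly by `B + B`. Either the size grows by a factor 3/2, or `B` lies in a coset of a
subgroup `H` with `|H| < 3/2 |B|`. As `B` contains 0 and generates the group, `H` is everything, and
one more step covers the group (`mem_of_doubling`). Since `|B| ≥ (n + 1) / 2` at the start, `O(log
(a_n / n))` steps suffice, and `F ≤ 2^k * a_n` after `k` of them (`frobenius_le_of_pow`). -/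

/-! ### Feasible targets and their splitting. -/

theorem feasible_zero {n : ℕ} (a : Fin (n + 1) → ℕ) : Feasible a 0 := ⟨fun _ => 0, by simp⟩

theorem Feasible.add {n : ℕ} {a : Fin (n + 1) → ℕ} {s t : ℕ} (hs : Feasible a s)
    (ht : Feasible a t) : Feasible a (s + t) := by
  rw [feasible_iff_mem_closure] at *
  exact add_mem hs ht

theorem feasible_item {n : ℕ} (a : Fin (n + 1) → ℕ) (i : Fin (n + 1)) : Feasible a (a i) := by
  rw [feasible_iff_mem_closure]
  exact AddSubmonoid.subset_closure ⟨i, rfl⟩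

theorem feasible_of_mem_insert {n : ℕ} {a : Fin (n + 1) → ℕ} {z : ℕ}
    (hz : z ∈ insert 0 (Set.range a)) : Feasible a z := by
  rcases hz with rfl | ⟨i, rfl⟩
  · exact feasible_zero a
  · exact feasible_item a i

theorem Feasible.nsmul {n : ℕ} {a : Fin (n + 1) → ℕ} {s : ℕ} (hs : Feasible a s) (k : ℕ) :
    Feasible a (k * s) := by
  induction k with
  | zero => simpa using feasible_zero a
  | succ k ih => rw [add_mul, one_mul]; exact ih.add hs

/-- A positive feasible target stays feasible after removing a suitable positive item. -/
theorem Feasible.exists_item {n : ℕ} {a : Fin (n + 1) → ℕ} {s : ℕ} (hs : Feasible a s)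
    (h0 : 0 < s) : ∃ i, 0 < a i ∧ a i ≤ s ∧ Feasible a (s - a i) := by
  rw [feasible_iff_mem_closure] at hs
  induction hs using AddSubmonoid.closure_induction with
  | mem y hy =>
    obtain ⟨i, rfl⟩ := hy
    exact ⟨i, h0, le_rfl, by simpa using feasible_zero a⟩
  | zero => omega
  | add y z hy hz ihy ihz =>
    rw [← feasible_iff_mem_closure] at hy hz
    rcases Nat.eq_zero_or_pos y with rfl | hy0
    · obtain ⟨i, h1, h2, h3⟩ := ihz (by omega)
      exact ⟨i, h1, by omega, by rwa [zero_add]⟩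
    · obtain ⟨i, h1, h2, h3⟩ := ihy hy0
      refine ⟨i, h1, by omega, ?_⟩
      rw [show y + z - a i = (y - a i) + z by omega]
      exact h3.add hz

/-- Greedy splitting of a feasible target above `b`. -/
theorem Feasible.split {n : ℕ} {a : Fin (n + 1) → ℕ} {s b : ℕ} (hs : Feasible a s) (hb : b < s) :
    ∃ x i y, Feasible a x ∧ Feasible a y ∧ x + a i + y = s ∧ x ≤ b ∧ b < x + a i := by
  classical
  -- Candidates are feasible numbers whose complement in `s` is feasible as well; the largest
  -- candidate up to `b` is the cut.
  let P : ℕ → Prop := fun x => Feasible a x ∧ Feasible a (s - x)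
  have hP : P (Nat.findGreatest P b) :=
    Nat.findGreatest_spec (P := P) (Nat.zero_le b) ⟨feasible_zero a, by simpa using hs⟩
  have hle : Nat.findGreatest P b ≤ b := Nat.findGreatest_le b
  obtain ⟨i, h1, h2, h3⟩ := hP.2.exists_item (by omega)
  refine ⟨Nat.findGreatest P b, i, s - Nat.findGreatest P b - a i, hP.1, h3, by omega, hle, ?_⟩
  -- If adding the item stayed within `b`, the result would be a larger candidate.
  by_contra hcon
  refine Nat.findGreatest_is_greatest (P := P) (n := b) (k := Nat.findGreatest P b + a i)
    (by omega) (by omega) ⟨hP.1.add (feasible_item a i), ?_⟩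
  rwa [← Nat.sub_sub]

theorem IsItemList.maxItem_pos {n : ℕ} {a : Fin (n + 1) → ℕ} (ha : IsItemList a) :
    0 < maxItem a := by
  by_contra h
  have h0 : maxItem a = 0 := by omega
  have : ∀ i, a i = 0 := fun i => by
    have := ha.1.monotone (Fin.le_last i)
    unfold maxItem at h0; omega
  have h2 := ha.2
  rw [Finset.gcd_eq_zero_iff.2 (fun i _ => this i)] at h2
  omega

theorem IsItemList.le_maxItem {n : ℕ} {a : Fin (n + 1) → ℕ} (ha : IsItemList a) (i) :
    a i ≤ maxItem a := ha.1.monotone (Fin.le_last i)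

theorem IsItemList.length_le {n : ℕ} {a : Fin (n + 1) → ℕ} (ha : IsItemList a) :
    n ≤ maxItem a := by
  have h2 : ∀ i : Fin (n + 1), (i : ℕ) ≤ a i := by
    intro i
    induction i using Fin.induction with
    | zero => simp
    | succ i ih =>
      have := ha.1 (Fin.castSucc_lt_succ (i := i))
      simp at ih ⊢; omega
  exact h2 (Fin.last n)

/-! ### Intervals of length `a_n` and the recursion for their feasible members. -/

/-- The `r`-th integer of `I^(j)` is feasible; here `j = 0` is allowed, for `I^(0) = (-a_n, 0]`. -/
def FeasIdx {n : ℕ} (a : Fin (n + 1) → ℕ) (j r : ℕ) : Prop :=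
  ∃ s, s + maxItem a = j * maxItem a + 1 + r ∧ Feasible a s

/-- The cut is made at `i * a_n`. Indices count from 0 while `I^(j)` starts just above a multiple of
`a_n`, which causes the shift in `x + y + z + 1 = r + a_n`. The index 0 is included because `I^(0)`,
whose only feasible member is 0, serves as the neutral element when binary digits are combined. -/
theorem feasIdx_add_iff {n : ℕ} {a : Fin (n + 1) → ℕ} (ha : IsItemList a) (i j r : ℕ)
    (hr : r < maxItem a) :
    FeasIdx a (i + j) r ↔ ∃ x < maxItem a, ∃ y < maxItem a, ∃ z ∈ insert 0 (Set.range a),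
      x + y + z + 1 = r + maxItem a ∧ FeasIdx a i x ∧ FeasIdx a j y := by
  have hm := ha.maxItem_pos
  constructor
  · rintro ⟨s, hs, hf⟩
    rw [add_mul] at hs
    by_cases hb : i * maxItem a < s
    · obtain ⟨x, k, y, hx, hy, hxy, h1, h2⟩ := hf.split hb
      have hk := ha.le_maxItem k
      by_cases hy2 : j * maxItem a < y + maxItem a
      · refine ⟨x + maxItem a - i * maxItem a - 1, by omega, y + maxItem a - j * maxItem a - 1, by omega, a k,
          Or.inr ⟨k, rfl⟩, by omega, ⟨x, by omega, hx⟩, ⟨y, by omega, hy⟩⟩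
      · refine ⟨x + maxItem a - i * maxItem a - 1, by omega, y + a k + maxItem a - j * maxItem a - 1, by omega, 0,
          Or.inl rfl, by omega, ⟨x, by omega, hx⟩,
          ⟨y + a k, by omega, hy.add (feasible_item a k)⟩⟩
    -- Without a crossing of `i * a_n`, only `j = 0` is possible; the second summand is then the
    -- target 0, at index `a_n - 1` of `I^(0)`.
    · have : j * maxItem a = 0 := by
        rcases Nat.eq_zero_or_pos j with rfl | hj
        · simp
        · have : maxItem a ≤ j * maxItem a := Nat.le_mul_of_pos_left (maxItem a) hj
          omega
      refine ⟨r, hr, maxItem a - 1, by omega, 0, Or.inl rfl, by omega, ⟨s, by omega, hf⟩,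
        ⟨0, by omega, feasible_zero a⟩⟩
  · rintro ⟨x, hx, y, hy, z, hz, h, ⟨s, hs, hsf⟩, ⟨t, ht, htf⟩⟩
    exact ⟨s + t + z, by rw [add_mul]; omega, (hsf.add htf).add (feasible_of_mem_insert hz)⟩

theorem mem_feasibleSet_iff {n : ℕ} {a : Fin (n + 1) → ℕ} {j r : ℕ} (hj : 1 ≤ j)
    (hr : r < maxItem a) :
    (j - 1) * maxItem a + 1 + r ∈ feasibleSet a j ↔ FeasIdx a j r := by
  obtain ⟨k, rfl⟩ : ∃ k, j = k + 1 := ⟨j - 1, by omega⟩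
  simp only [feasibleSet, interval, Set.mem_ofPred_eq, Set.mem_Ioc, FeasIdx, add_tsub_cancel_right,
    add_mul, one_mul]
  constructor
  · rintro ⟨_, h⟩
    exact ⟨_, by ring, h⟩
  · rintro ⟨s, hs, h⟩
    obtain rfl : s = k * maxItem a + 1 + r := by omega
    exact ⟨⟨by omega, by omega⟩, h⟩

theorem mem_feasibleSet_iff' {n : ℕ} {a : Fin (n + 1) → ℕ} {j s : ℕ} (hj : 1 ≤ j) :
    s ∈ feasibleSet a j ↔ ∃ r < maxItem a, s = (j - 1) * maxItem a + 1 + r ∧ FeasIdx a j r := by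
  constructor
  · intro h
    have hi := h.1
    obtain ⟨k, rfl⟩ : ∃ k, j = k + 1 := ⟨j - 1, by omega⟩
    simp only [interval, Set.mem_Ioc, add_tsub_cancel_right, add_mul, one_mul] at hi
    have hr : s - k * maxItem a - 1 < maxItem a := by omega
    have hs : s = (k + 1 - 1) * maxItem a + 1 + (s - k * maxItem a - 1) := by
      rw [add_tsub_cancel_right]; omega
    exact ⟨_, hr, hs, (mem_feasibleSet_iff hj hr).1 (hs ▸ h)⟩
  · rintro ⟨r, hr, rfl, h⟩
    exact (mem_feasibleSet_iff hj hr).2 h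

theorem feasibleSet_add {n : ℕ} {a : Fin (n + 1) → ℕ} (ha : IsItemList a) {i j : ℕ}
    (hi : 1 ≤ i) (hj : 1 ≤ j) :
    feasibleSet a (i + j) = (feasibleSet a i + feasibleSet a j + insert 0 (Set.range a)) ∩
      interval a (i + j) := by
  obtain ⟨k, rfl⟩ : ∃ k, i = k + 1 := ⟨i - 1, by omega⟩
  obtain ⟨l, rfl⟩ : ∃ l, j = l + 1 := ⟨j - 1, by omega⟩
  ext s
  constructor
  · intro h
    refine ⟨?_, h.1⟩
    obtain ⟨r, hr, rfl, hf⟩ := (mem_feasibleSet_iff' (by omega)).1 h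
    obtain ⟨x, hx, y, hy, z, hz, e, h1, h2⟩ := (feasIdx_add_iff ha _ _ _ hr).1 hf
    refine Set.mem_add.2 ⟨_, Set.add_mem_add ((mem_feasibleSet_iff hi hx).2 h1)
      ((mem_feasibleSet_iff hj hy).2 h2), z, hz, ?_⟩
    rw [show k + 1 + (l + 1) - 1 = k + 1 + l by omega]
    simp only [add_tsub_cancel_right, add_mul, one_mul]
    omega
  · rintro ⟨h, hI⟩
    obtain ⟨_, ⟨x, hx, y, hy, rfl⟩, z, hz, rfl⟩ := h
    exact ⟨hI, (hx.2.add hy.2).add (feasible_of_mem_insert hz)⟩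

/-- Cutting at `u - 1` leaves less than `u` on both sides of the crossing item. This doubles the
range of known targets and produces `A^(1)`, where the interval recursion cannot start. -/
theorem feasible_lt_two_mul_iff {n : ℕ} {a : Fin (n + 1) → ℕ} {u s : ℕ} (hu : 0 < u)
    (hs : s < 2 * u) :
    Feasible a s ↔ ∃ x < u, ∃ y < u, ∃ z < 2 * u, z ∈ insert 0 (Set.range a) ∧ x + y + z = s ∧
      Feasible a x ∧ Feasible a y := by
  constructor
  · intro h
    by_cases hb : u - 1 < s
    · obtain ⟨x, i, y, hx, hy, e, h1, h2⟩ := h.split hb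
      exact ⟨x, by omega, y, by omega, a i, by omega, Or.inr ⟨i, rfl⟩, by omega, hx, hy⟩
    · exact ⟨s, by omega, 0, hu, 0, by omega, Or.inl rfl, by omega, h, feasible_zero a⟩
  · rintro ⟨x, _, y, _, z, _, hz, rfl, hx, hy⟩
    exact (hx.add hy).add (feasible_of_mem_insert hz)

/-! ### The number of doublings -/

theorem ncard_feasibleSet_eq_iff {n : ℕ} {a : Fin (n + 1) → ℕ} {j : ℕ} (hj : 1 ≤ j) :
    (feasibleSet a j).ncard = maxItem a ↔ ∀ r < maxItem a, FeasIdx a j r := by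
  have hI : (interval a j).ncard = maxItem a := by
    obtain ⟨k, rfl⟩ : ∃ k, j = k + 1 := ⟨j - 1, by omega⟩
    rw [interval, ← Finset.coe_Ioc, Set.ncard_coe_finset, Nat.card_Ioc]
    simp [add_mul]
  have hfin : (interval a j).Finite := Set.finite_Ioc _ _
  have hsub : feasibleSet a j ⊆ interval a j := fun s h => h.1
  constructor
  · intro h r hr
    have := Set.eq_of_subset_of_ncard_le hsub (by omega) hfin
    rw [← mem_feasibleSet_iff hj hr, this]
    obtain ⟨k, rfl⟩ : ∃ k, j = k + 1 := ⟨j - 1, by omega⟩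
    simp only [interval, Set.mem_Ioc, add_tsub_cancel_right, add_mul, one_mul]
    omega
  · intro h
    rw [← hI]
    congr 1
    refine hsub.antisymm fun s hs => (mem_feasibleSet_iff' hj).2 ?_
    obtain ⟨k, rfl⟩ : ∃ k, j = k + 1 := ⟨j - 1, by omega⟩
    simp only [interval, Set.mem_Ioc, add_tsub_cancel_right, add_mul, one_mul] at hs
    refine ⟨s - k * maxItem a - 1, by omega, ?_, h _ (by omega)⟩
    rw [add_tsub_cancel_right]; omega

theorem doublingDepth_spec {n : ℕ} {a : Fin (n + 1) → ℕ} (ha : IsItemList a) (t : ℕ) :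
    (feasibleSet a (2 ^ doublingDepth a t)).ncard = maxItem a ∨
      t ≤ 2 ^ doublingDepth a t * maxItem a := by
  refine Nat.sInf_mem (s := {R | (feasibleSet a (2 ^ R)).ncard = maxItem a ∨
    t ≤ 2 ^ R * maxItem a}) ⟨t, Or.inr ?_⟩
  exact Nat.lt_two_pow_self.le.trans (Nat.le_mul_of_pos_right _ ha.maxItem_pos)

theorem not_of_lt_doublingDepth {n : ℕ} {a : Fin (n + 1) → ℕ} {t R : ℕ}
    (h : R < doublingDepth a t) :
    ¬ ((feasibleSet a (2 ^ R)).ncard = maxItem a) ∧ 2 ^ R * maxItem a < t := by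
  have := Nat.notMem_of_lt_sInf h
  simpa [not_or] using this

/-- A full interval contains a representative of every residue modulo `a_n`; copies of the largest
item do the rest. -/
theorem feasible_of_full {n : ℕ} {a : Fin (n + 1) → ℕ} (ha : IsItemList a) {j t : ℕ}
    (h : ∀ r < maxItem a, FeasIdx a j r) (ht : j * maxItem a < t + maxItem a) : Feasible a t := by
  obtain ⟨s, hs, hf⟩ := h ((t + maxItem a - j * maxItem a - 1) % maxItem a)
    (Nat.mod_lt _ ha.maxItem_pos)
  have hd := Nat.div_add_mod (t + maxItem a - j * maxItem a - 1) (maxItem a)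
  have : t = s + (t + maxItem a - j * maxItem a - 1) / maxItem a * maxItem a := by
    rw [mul_comm] at hd; omega
  rw [this]
  exact hf.add ((feasible_item a (Fin.last n)).nsmul _)

theorem le_frobenius {n : ℕ} {a : Fin (n + 1) → ℕ} (ha : IsItemList a) {s : ℕ}
    (h : ¬ Feasible a s) : s ≤ frobenius a :=
  (isGreatest_frobenius a ha ⟨s, h⟩).2 h

/-- Before the last round, `I^(2^R)` still contains an infeasible number, which bounds the Frobenius
number from below, and `t` still exceeds the interval. -/
theorem pow_doublingDepth_le {n : ℕ} {a : Fin (n + 1) → ℕ} (ha : IsItemList a) {t R : ℕ}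
    (h : R < doublingDepth a t) :
    (2 ^ R - 1) * maxItem a ≤ t ∧ (2 ^ R - 1) * maxItem a ≤ frobenius a := by
  obtain ⟨h1, h2⟩ := not_of_lt_doublingDepth h
  constructor
  · rw [Nat.sub_mul]; omega
  · rw [ncard_feasibleSet_eq_iff Nat.one_le_two_pow] at h1
    push Not at h1
    obtain ⟨r, hr, hn⟩ := h1
    rw [← mem_feasibleSet_iff Nat.one_le_two_pow hr] at hn
    have hnf : ¬ Feasible a ((2 ^ R - 1) * maxItem a + 1 + r) := by
      intro hf
      refine hn ⟨?_, hf⟩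
      have := Nat.one_le_two_pow (n := R)
      obtain ⟨k, hk⟩ : ∃ k, 2 ^ R = k + 1 := ⟨2 ^ R - 1, by omega⟩
      simp only [hk, interval, Set.mem_Ioc, add_tsub_cancel_right, add_mul, one_mul]
      omega
    have := le_frobenius ha hnf
    omega

theorem doublingDepth_le {n : ℕ} {a : Fin (n + 1) → ℕ} (ha : IsItemList a) (t : ℕ) :
    doublingDepth a t ≤ t := by
  refine Nat.sInf_le (Or.inr ?_)
  exact Nat.lt_two_pow_self.le.trans (Nat.le_mul_of_pos_right _ ha.maxItem_pos)

theorem doublingDepth_succ_le_log {n : ℕ} {a : Fin (n + 1) → ℕ} (ha : IsItemList a) (t : ℕ) :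
    (doublingDepth a t : ℝ) + 1 ≤ 3 / Real.log 2 *
      Real.log (2 + min ((t : ℝ) / maxItem a) ((frobenius a : ℝ) / maxItem a)) := by
  have hl := Real.log_pos (by norm_num : (1 : ℝ) < 2)
  have hm : (0 : ℝ) < maxItem a := by exact_mod_cast ha.maxItem_pos
  set μ := min ((t : ℝ) / maxItem a) ((frobenius a : ℝ) / maxItem a) with hμ
  have hμ0 : 0 ≤ μ := le_min (by positivity) (by positivity)
  have h1 : Real.log 2 ≤ Real.log (2 + μ) := Real.log_le_log (by norm_num) (by linarith)
  have key : ((doublingDepth a t : ℝ) - 1) * Real.log 2 ≤ Real.log (2 + μ) := by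
    rcases Nat.eq_zero_or_pos (doublingDepth a t) with h0 | h0
    · rw [h0]; push_cast; linarith
    · obtain ⟨R, hR⟩ : ∃ R, doublingDepth a t = R + 1 := ⟨doublingDepth a t - 1, by omega⟩
      obtain ⟨ht, hF⟩ := pow_doublingDepth_le ha (t := t) (R := R) (by omega)
      have hcast : ((2 ^ R - 1 : ℕ) : ℝ) = 2 ^ R - 1 := by
        rw [Nat.cast_sub Nat.one_le_two_pow]; push_cast; ring
      have ht' : ((2 : ℝ) ^ R - 1) * maxItem a ≤ t := by rw [← hcast]; exact_mod_cast ht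
      have hF' : ((2 : ℝ) ^ R - 1) * maxItem a ≤ frobenius a := by
        rw [← hcast]; exact_mod_cast hF
      have : (2 : ℝ) ^ R - 1 ≤ μ :=
        le_min ((le_div_iff₀ hm).2 ht') ((le_div_iff₀ hm).2 hF')
      rw [hR]; push_cast
      rw [add_sub_cancel_right, ← Real.log_pow]
      exact Real.log_le_log (by positivity) (by linarith)
  -- The constant 3 arises from `R + 1 = (R - 1) + 2`, where `log 2 ≤ log (2 + μ)` is used twice.
  rw [div_mul_eq_mul_div, le_div_iff₀ hl]
  nlinarith

/-! ### The Frobenius number -/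

/-- Iterated doubling of a generating set containing `1` exhausts a finite commutative group. -/
theorem mem_of_doubling {G : Type*} [CommGroup G] [Finite G] [DecidableEq G]
    (B : ℕ → Finset G) (h0 : 1 ∈ B 0) (hgen : ∀ H : Subgroup G, (∀ x ∈ B 0, x ∈ H) → H = ⊤)
    (hB : ∀ i, B (i + 1) = B i * B i) (k : ℕ)
    (hk : (Nat.card G : ℚ) < (3 / 2 : ℚ) ^ k * (B 0).card) : ∀ g, g ∈ B k := by
  classical
  have := Fintype.ofFinite G
  have hz : ∀ i, 1 ∈ B i := fun i => by
    induction i with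
    | zero => exact h0
    | succ i ih => rw [hB]; exact Finset.mem_mul.2 ⟨1, ih, 1, ih, by simp⟩
  have hmono : ∀ i, B i ⊆ B (i + 1) := fun i x hx => by
    rw [hB]; exact Finset.mem_mul.2 ⟨x, hx, 1, hz i, by simp⟩
  have hmono' : Monotone B := monotone_nat_of_le_succ hmono
  rw [Nat.card_eq_fintype_card] at hk
  have hcard : ∀ i, (B i).card ≤ Fintype.card G := fun i => Finset.card_le_univ _
  -- Growth by 3/2 in each of the `k` steps would exceed the order of the group.
  have hex : ∃ i < k, ((B i * B i).card : ℚ) < (3 / 2 : ℚ) * (B i).card := by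
    by_contra hcon
    push Not at hcon
    have : ∀ j ≤ k, (3 / 2 : ℚ) ^ j * (B 0).card ≤ (B j).card := by
      intro j hj
      induction j with
      | zero => simp
      | succ j ih =>
        have h1 := hcon j (by omega)
        rw [← hB] at h1
        have h2 := ih (by omega)
        rw [pow_succ]
        linarith
    have h1 := this k le_rfl
    have h3 : ((B k).card : ℚ) ≤ Fintype.card G := by exact_mod_cast hcard k
    linarith
  obtain ⟨i, hi, hlt⟩ := hex
  obtain ⟨H, hHf, hH, hH2⟩ := Finset.doubling_lt_three_halves hlt
  -- The coset through `1 ∈ B i` is `H` itself, so `H` contains the generating set `B 0`.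
  have hHtop : H = ⊤ := by
    refine hgen H fun x hx => ?_
    have := (hH2 1 (hz i)).1 (Finset.mem_coe.2 (hmono' (Nat.zero_le i) hx))
    simpa using this
  have hc : (Fintype.card G : ℚ) < 3 / 2 * (B i).card := by
    rw [← Nat.card_eq_fintype_card] at hH
    rw [hHtop, Nat.card_congr Subgroup.topEquiv.toEquiv, Nat.card_eq_fintype_card] at hH
    exact hH
  have hpos : (0 : ℚ) ≤ (B i).card := by positivity
  have hc2 : (Fintype.card G : ℚ) < ((B i).card + (B i).card : ℕ) := by push_cast; linarith
  have hc3 : Fintype.card G < (B i).card + (B i).card := by exact_mod_cast hc2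
  intro g
  refine hmono' (show i + 1 ≤ k by omega) ?_
  rw [hB]
  -- Pigeonhole: `B i` has more than half of the elements, so it meets `g * (B i)⁻¹`, which writes
  -- `g` as a product of two members.
  have hinj : Function.Injective fun b : G => g * b⁻¹ := fun x y h => by simpa using h
  have hne := Finset.inter_nonempty_of_card_lt_card_add_card (s := Finset.univ)
    (Finset.subset_univ (B i)) (Finset.subset_univ ((B i).image fun b => g * b⁻¹))
    (by rw [Finset.card_image_of_injective _ hinj, Finset.card_univ]; exact hc3)
  obtain ⟨x, hx⟩ := hne
  obtain ⟨hx1, hx2⟩ := Finset.mem_inter.1 hx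
  obtain ⟨y, hy, rfl⟩ := Finset.mem_image.1 hx2
  exact Finset.mem_mul.2 ⟨_, hx1, y, hy, by simp⟩

/-- Residues modulo `a_n` are doubled along with witnesses: each element after `i` doublings comes
from a feasible number at most `2^i * a_n`. The factor 2 in the hypothesis pays for the estimate `n
+ 1 ≤ 2 * |B 0|`. -/
theorem frobenius_le_of_pow {n : ℕ} {a : Fin (n + 1) → ℕ} (ha : IsItemList a) (k : ℕ)
    (hk : 2 * (maxItem a : ℚ) < (3 / 2 : ℚ) ^ k * (n + 1)) :
    frobenius a ≤ 2 ^ k * maxItem a := by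
  classical
  have hm := ha.maxItem_pos
  have : NeZero (maxItem a) := ⟨hm.ne'⟩
  let φ : ℕ → Multiplicative (ZMod (maxItem a)) := fun s => Multiplicative.ofAdd (s : ZMod _)
  have hφ : ∀ s t, φ (s + t) = φ s * φ t := fun s t => by simp [φ]
  let B : ℕ → Finset (Multiplicative (ZMod (maxItem a))) := fun i =>
    Nat.rec (insert 1 (Finset.univ.image fun i => φ (a i))) (fun _ X => X * X) i
  have hB : ∀ i, B (i + 1) = B i * B i := fun i => rfl
  have hB0 : B 0 = insert 1 (Finset.univ.image fun i => φ (a i)) := rfl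
  have hrep : ∀ i, ∀ g ∈ B i, ∃ s ≤ 2 ^ i * maxItem a, Feasible a s ∧ φ s = g := by
    intro i
    induction i with
    | zero =>
      intro g hg
      rw [hB0, Finset.mem_insert, Finset.mem_image] at hg
      rcases hg with rfl | ⟨j, _, rfl⟩
      · exact ⟨0, Nat.zero_le _, feasible_zero a, by simp [φ]⟩
      · exact ⟨a j, by simpa using ha.le_maxItem j, feasible_item a j, rfl⟩
    | succ i ih =>
      intro g hg
      rw [hB, Finset.mem_mul] at hg
      obtain ⟨x, hx, y, hy, rfl⟩ := hg
      obtain ⟨s, hs, hsf, rfl⟩ := ih x hx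
      obtain ⟨t, ht, htf, rfl⟩ := ih y hy
      exact ⟨s + t, by rw [pow_succ]; linarith, hsf.add htf, hφ s t⟩
  have hgen : ∀ H : Subgroup (Multiplicative (ZMod (maxItem a))),
      (∀ x ∈ B 0, x ∈ H) → H = ⊤ := by
    intro H hH
    have hai : ∀ i, φ (a i) ∈ H := fun i => hH _ (by
      rw [hB0]; exact Finset.mem_insert_of_mem (Finset.mem_image_of_mem _ (Finset.mem_univ i)))
    -- By Bézout, 1 is an integral combination of the items, so their residues generate the whole
    -- group.
    obtain ⟨c, hc⟩ := Finset.gcd_eq_sum_mul Finset.univ (fun i => (a i : ℤ))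
    have hg1 : Finset.univ.gcd (fun i => (a i : ℤ)) = 1 := by
      have h1 : (Finset.univ.gcd fun i => (a i : ℤ)).natAbs ∣ Finset.univ.gcd a :=
        Finset.dvd_gcd fun i hi => by
          have := Int.natAbs_dvd_natAbs.2 (Finset.gcd_dvd (f := fun i => (a i : ℤ)) hi)
          simpa using this
      rw [ha.2, Nat.dvd_one] at h1
      have h2 : 0 ≤ Finset.univ.gcd fun i => (a i : ℤ) :=
        Int.nonneg_of_normalize_eq_self Finset.normalize_gcd
      omega
    have h1 : (Multiplicative.ofAdd (1 : ZMod (maxItem a))) ∈ H := by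
      have hc' : (1 : ZMod (maxItem a)) = ∑ i, (c i) • (a i : ZMod (maxItem a)) := by
        have := congrArg (Int.cast : ℤ → ZMod (maxItem a)) hc
        rw [hg1] at this
        push_cast at this
        rw [this]
        exact Finset.sum_congr rfl fun i _ => by rw [zsmul_eq_mul, mul_comm]
      rw [hc', ofAdd_sum]
      exact Subgroup.prod_mem _ fun i _ => by
        rw [ofAdd_zsmul]; exact Subgroup.zpow_mem _ (hai i) _
    rw [eq_top_iff]
    intro g _
    have := Subgroup.pow_mem _ h1 (Multiplicative.toAdd g).val
    rw [← ofAdd_nsmul, nsmul_eq_mul, mul_one, ZMod.natCast_zmod_val] at this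
    exact this
  have hcard : (n + 1 : ℚ) ≤ 2 * (B 0).card := by
    have h1 : 1 ≤ (B 0).card := Finset.card_pos.2 ⟨1, by rw [hB0]; exact Finset.mem_insert_self _ _⟩
    -- The items below `a_n` have distinct residues. The largest one is congruent to 0 and may
    -- coincide with `a_0 = 0`, so it is not counted.
    have h2 : n ≤ (B 0).card := by
      have hinj : Function.Injective fun i : Fin n => φ (a i.castSucc) := by
        intro i j hij
        have hlt : ∀ i : Fin n, a i.castSucc < maxItem a := fun i =>
          ha.1 (Fin.castSucc_lt_last i)
        have : ((a i.castSucc : ℕ) : ZMod (maxItem a)) = (a j.castSucc : ℕ) := by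
          simpa [φ] using hij
        rw [ZMod.natCast_eq_natCast_iff, Nat.ModEq, Nat.mod_eq_of_lt (hlt i),
          Nat.mod_eq_of_lt (hlt j)] at this
        simpa using ha.1.injective this
      have := Finset.card_le_card (s := Finset.univ.image fun i : Fin n => φ (a i.castSucc))
        (t := B 0) (by
          intro x hx
          obtain ⟨i, _, rfl⟩ := Finset.mem_image.1 hx
          rw [hB0]
          exact Finset.mem_insert_of_mem
            (Finset.mem_image_of_mem (fun i => φ (a i)) (Finset.mem_univ i.castSucc)))
      rwa [Finset.card_image_of_injective _ hinj, Finset.card_univ, Fintype.card_fin] at this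
    have : n + 1 ≤ 2 * (B 0).card := by omega
    exact_mod_cast this
  have hall := mem_of_doubling B (by rw [hB0]; exact Finset.mem_insert_self _ _) hgen hB k (by
    have hp : (0 : ℚ) < (3 / 2 : ℚ) ^ k := by positivity
    rw [show Nat.card (Multiplicative (ZMod (maxItem a))) = maxItem a from Nat.card_zmod _]
    nlinarith)
  have hbig : ∀ t, 2 ^ k * maxItem a ≤ t → Feasible a t := by
    intro t ht
    obtain ⟨s, hs, hf, hφs⟩ := hrep k _ (hall (φ t))
    have hst : (s : ZMod (maxItem a)) = t := by simpa [φ] using hφs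
    rw [ZMod.natCast_eq_natCast_iff] at hst
    obtain ⟨d, hd⟩ := (Nat.modEq_iff_dvd' (by omega)).1 hst
    have : t = s + d * maxItem a := by rw [mul_comm]; omega
    rw [this]
    exact hf.add ((feasible_item a (Fin.last n)).nsmul d)
  by_cases hex : ∃ t, ¬ Feasible a t
  · by_contra hcon
    exact (isGreatest_frobenius a ha hex).1 (hbig _ (by omega))
  · push Not at hex
    have : {t | ¬ Feasible a t} = ∅ := by ext t; simp [hex t]
    rw [frobenius, this]; simp

/-- The minimum is replaced by `F / a_n ≤ 2^k`, with `k` proportional to `log (a_n / (n + 1))`. -/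
theorem exists_targetTime_le : ∃ C : ℝ, ∀ (n : ℕ) (a : Fin (n + 1) → ℕ) (t : ℕ), IsItemList a →
    targetTime a t ≤ C * itemTime a := by
  refine ⟨2 * Real.log 2 / Real.log (3 / 2) + 4, fun n a t ha => ?_⟩
  have hm : (0 : ℝ) < maxItem a := by exact_mod_cast ha.maxItem_pos
  have hn : (0 : ℝ) < n + 1 := by positivity
  have hnm : (n : ℝ) ≤ maxItem a := by exact_mod_cast ha.length_le
  have hm1 : (1 : ℝ) ≤ maxItem a := by exact_mod_cast ha.maxItem_pos
  have hl2 := Real.log_pos (by norm_num : (1 : ℝ) < 2)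
  have hl3 := Real.log_pos (by norm_num : (1 : ℝ) < 3 / 2)
  set x : ℝ := maxItem a / (n + 1) with hx
  have hx0 : 0 < x := by positivity
  have hx1 : 1 ≤ 2 * x := by
    rw [hx, mul_div_assoc', le_div_iff₀ hn]; linarith
  set l := Real.log (2 + x)
  have hl : Real.log 2 ≤ l := Real.log_le_log (by norm_num) (by linarith)
  -- The least convenient number of doublings with `(3/2)^k > 2 * x`. The floor behaves because `2 *
  -- x ≥ 1`, that is, `n + 1 ≤ 2 * a_n`.
  set k := ⌊Real.log (2 * x) / Real.log (3 / 2)⌋₊ + 1 with hk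
  have hk1 : Real.log (2 * x) < k * Real.log (3 / 2) := by
    rw [← div_lt_iff₀ hl3, hk]; push_cast; exact Nat.lt_floor_add_one _
  have hk2 : (k : ℝ) ≤ Real.log (2 * x) / Real.log (3 / 2) + 1 := by
    rw [hk]; push_cast
    have := Nat.floor_le (div_nonneg (Real.log_nonneg hx1) hl3.le)
    linarith
  have hpow : 2 * x < (3 / 2 : ℝ) ^ k := by
    rw [← Real.log_pow] at hk1
    exact (Real.log_lt_log_iff (by linarith) (by positivity)).1 hk1
  have hF := frobenius_le_of_pow ha k (by
    rw [hx, mul_div_assoc', div_lt_iff₀ hn] at hpow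
    have : ((2 * (maxItem a : ℚ) : ℚ) : ℝ) < ((3 / 2 : ℚ) ^ k * (n + 1) : ℚ) := by
      push_cast; exact hpow
    exact_mod_cast this)
  have hF' : (frobenius a : ℝ) / maxItem a ≤ 2 ^ k := by
    rw [div_le_iff₀ hm]; exact_mod_cast hF
  set μ := min ((t : ℝ) / maxItem a) ((frobenius a : ℝ) / maxItem a)
  have hμ0 : 0 ≤ μ := le_min (by positivity) (by positivity)
  have hμ : μ ≤ 2 ^ k := (min_le_right _ _).trans hF'
  have hlog : Real.log (2 + μ) ≤ (k + 2) * Real.log 2 := by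
    have : ((k : ℝ) + 2) * Real.log 2 = Real.log (2 ^ (k + 2)) := by
      rw [Real.log_pow]; push_cast; ring
    rw [this]
    refine Real.log_le_log (by linarith) ?_
    have : (1 : ℝ) ≤ 2 ^ k := one_le_pow₀ (by norm_num)
    rw [pow_add]; linarith
  have hlx : Real.log (2 * x) ≤ 2 * l := by
    rw [Real.log_mul (by norm_num) hx0.ne']
    have : Real.log x ≤ l := Real.log_le_log hx0 (by linarith)
    linarith
  have hfin : Real.log (2 + μ) ≤ (2 * Real.log 2 / Real.log (3 / 2) + 4) * l := by
    have h1 : Real.log (2 * x) / Real.log (3 / 2) ≤ 2 * l / Real.log (3 / 2) := by gcongr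
    calc _ ≤ (k + 2) * Real.log 2 := hlog
      _ ≤ (2 * l / Real.log (3 / 2) + 1 + 2) * Real.log 2 := by gcongr; linarith
      _ = 2 * Real.log 2 / Real.log (3 / 2) * l + 3 * Real.log 2 := by ring
      _ ≤ _ := by linarith
  have hA : 0 ≤ (maxItem a : ℝ) * Real.log (1 + maxItem a) :=
    mul_nonneg hm.le (Real.log_nonneg (by linarith))
  calc targetTime a t = maxItem a * Real.log (1 + maxItem a) * Real.log (2 + μ) := rfl
    _ ≤ maxItem a * Real.log (1 + maxItem a) *
      ((2 * Real.log 2 / Real.log (3 / 2) + 4) * l) := by gcongr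
    _ = _ := by simp only [itemTime]; ring

/-! ### Expressions and blocks, compiled to the word RAM

Registers below `64` serve as program variables, the others as temporaries. -/

inductive Expr where
  | var (k : ℕ)
  | lit (k : ℕ)
  | bin (o : Op) (e f : Expr)
  | read (e : Expr)

namespace Expr

instance : Add Expr := ⟨bin .add⟩
instance : Sub Expr := ⟨bin .sub⟩
instance : Mul Expr := ⟨bin .mul⟩
instance : Div Expr := ⟨bin .div⟩
instance : Mod Expr := ⟨fun e f => e - e / f * f⟩
instance (k : ℕ) : OfNat Expr k := ⟨lit k⟩

def eval (σ : State) : Expr → ℕ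
  | var k => σ.reg k
  | lit k => k
  | bin o e f => o.eval (e.eval σ) (f.eval σ)
  | read e => σ.mem (e.eval σ)

@[simp] theorem eval_var (σ : State) (k : ℕ) : (var k).eval σ = σ.reg k := rfl
@[simp] theorem eval_ofNat (σ : State) (k : ℕ) :
    (no_index (OfNat.ofNat k) : Expr).eval σ = OfNat.ofNat k := rfl
@[simp] theorem eval_add (σ : State) (e f : Expr) : (e + f).eval σ = e.eval σ + f.eval σ := rfl
@[simp] theorem eval_sub (σ : State) (e f : Expr) : (e - f).eval σ = e.eval σ - f.eval σ := rfl
@[simp] theorem eval_mul (σ : State) (e f : Expr) : (e * f).eval σ = e.eval σ * f.eval σ := rfl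
@[simp] theorem eval_div (σ : State) (e f : Expr) : (e / f).eval σ = e.eval σ / f.eval σ := rfl
@[simp] theorem eval_mod (σ : State) (e f : Expr) : (e % f).eval σ = e.eval σ % f.eval σ := by
  change e.eval σ - e.eval σ / f.eval σ * f.eval σ = _
  have := Nat.div_add_mod' (e.eval σ) (f.eval σ)
  omega
@[simp] theorem eval_read (σ : State) (e : Expr) : (read e).eval σ = σ.mem (e.eval σ) := rfl

/-- `reg d` becomes the value of the expression; only registers from `d` on are changed. -/
def compile : Expr → ℕ → Program
  | var k, d => .seq (.const d 0) (.op .add d k d)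
  | lit k, d => .const d k
  | bin o e f, d => .seq (.seq (e.compile d) (f.compile (d + 1))) (.op o d d (d + 1))
  | read e, d => .seq (e.compile d) (.load d d)

def cost : Expr → ℕ
  | var _ => 2
  | lit _ => 1
  | bin _ e f => e.cost + f.cost + 1
  | read e => e.cost + 1

/-- In a state with all values below `V`, the value of the expression is below `V ^ deg`. -/
def deg : Expr → ℕ
  | var _ => 1
  | lit _ => 1
  | bin .add e f => e.deg + f.deg
  | bin .sub e _ => e.deg
  | bin .mul e f => e.deg + f.deg
  | bin .div e _ => e.deg
  | read _ => 1

/-- Only program variables, small constants and intermediate results of small degree occur. -/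
def wf : Expr → Bool
  | var k => decide (k < 64)
  | lit k => decide (k < 1000)
  | bin o e f => e.wf && f.wf && decide ((bin o e f).deg ≤ 40)
  | read e => e.wf

end Expr

/-! ### Correctness of compiled expressions. -/

/-- Two bounds are kept apart: stored values stay below `V`, while machine words may reach `V ^ 40`.
Intermediate results of an expression then need no bound of their own beyond the syntactic degree.
-/
def Bdd (V : ℕ) (σ : State) : Prop := (∀ k, σ.reg k < V) ∧ ∀ i, σ.mem i < V

theorem Expr.one_le_deg (e : Expr) : 1 ≤ e.deg := by
  induction e with
  | var | lit | read => exact le_rfl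
  | bin o e f he hf => cases o <;> simp only [Expr.deg] <;> omega

theorem Expr.deg_le {e : Expr} (h : e.wf = true) : e.deg ≤ 40 := by
  cases e with
  | var | lit | read => simp [Expr.deg]
  | bin => simp [Expr.wf] at h; exact h.2

theorem Expr.eval_lt {V : ℕ} (hV : 1000 ≤ V) {σ : State} (hσ : Bdd V σ) {e : Expr}
    (he : e.wf = true) : e.eval σ < V ^ e.deg := by
  induction e with
  | var k => simpa [Expr.deg] using hσ.1 k
  | lit k => simp [Expr.wf] at he; simp [Expr.deg, Expr.eval]; omega
  | read e => simpa [Expr.deg] using hσ.2 _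
  | bin o e f ihe ihf =>
    simp only [Expr.wf, Bool.and_eq_true] at he
    have h1 := ihe he.1.1
    have h2 := ihf he.1.2
    have d1 := Nat.pow_le_pow_right (show 0 < V by omega) e.one_le_deg
    have d2 := Nat.pow_le_pow_right (show 0 < V by omega) f.one_le_deg
    cases o with
    | add =>
      simp only [Expr.deg, Expr.eval, Op.eval, pow_add]
      -- A sum of two numbers that are at least 2 is at most their product, so degrees may simply be
      -- added.
      have h3 : V ^ e.deg + V ^ f.deg ≤ V ^ e.deg * V ^ f.deg :=
        Nat.add_le_mul (by rw [pow_one] at d1; omega) (by rw [pow_one] at d2; omega)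
      omega
    | sub => simp only [Expr.deg, Expr.eval, Op.eval]; omega
    | mul =>
      simp only [Expr.deg, Expr.eval, Op.eval, pow_add]
      exact Nat.mul_lt_mul'' h1 h2
    | div =>
      simp only [Expr.deg, Expr.eval, Op.eval]
      exact (Nat.div_le_self _ _).trans_lt h1

/-- The state `σ` is an idealised copy in which temporaries are never touched; programs are analysed
on it. -/
def Agree (s σ : State) : Prop := (∀ k < 64, s.reg k = σ.reg k) ∧ s.mem = σ.mem

/-- The second operand is evaluated from register `d + 1` on, so the value of the first one in
register `d` survives. The frame clause `k < d` carries this through the induction. -/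
theorem Expr.exec_compile {V : ℕ} (hV : 1000 ≤ V) {σ : State} (hσ : Bdd V σ) {e : Expr}
    (he : e.wf = true) {s : State} (hs : Agree s σ) {d : ℕ} (hd : 64 ≤ d) :
    ∃ s', Exec (V ^ 40) (e.compile d) s e.cost s' ∧ s'.mem = s.mem ∧ s'.reg d = e.eval σ ∧
      ∀ k < d, s'.reg k = s.reg k := by
  have hpos : ∀ k, 0 < V ^ k := fun k => Nat.pow_pos (by omega)
  have hmono : ∀ {e : Expr}, e.wf = true → e.eval σ < V ^ 40 := fun h =>
    (Expr.eval_lt hV hσ h).trans_le (Nat.pow_le_pow_right (by omega) (Expr.deg_le h))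
  have upd : ∀ (f : ℕ → ℕ) (d v : ℕ), ∀ k < d, Function.update f d v k = f k := fun f d v k hk =>
    Function.update_of_ne hk.ne _ _
  induction e generalizing s d with
  | var k =>
    have hk : k < 64 := by simpa [Expr.wf] using he
    refine ⟨_, .seq (.const _ _ _ (hpos _)) (.op _ _ _ _ _ ?_), rfl, ?_, ?_⟩
    · have h := upd s.reg d 0 k (by omega)
      rw [hs.1 k hk] at h
      simp only [Op.eval, Function.update_self, add_zero, h]
      exact hmono he
    · simp [Op.eval, upd _ d _ k (by omega), hs.1 k hk]
    · intro j hj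
      simp only [upd _ _ _ j hj]
  | lit k =>
    exact ⟨_, .const _ _ _ (hmono he), rfl, by simp [Expr.eval], upd _ _ _⟩
  | read e ih =>
    obtain ⟨s', h1, h2, h3, h4⟩ := ih he hs hd
    refine ⟨_, .seq h1 (.load _ _ _ ?_), h2, ?_, ?_⟩
    · rw [h3, h2, hs.2]; exact hmono he
    · simp [h3, h2, hs.2]
    · intro j hj
      simp only [upd _ _ _ j hj, h4 j hj]
  | bin o e f ihe ihf =>
    have he' := he
    simp only [Expr.wf, Bool.and_eq_true] at he'
    obtain ⟨s₁, h1, h2, h3, h4⟩ := ihe he'.1.1 hs hd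
    have hs₁ : Agree s₁ σ := ⟨fun k hk => (h4 k (by omega)).trans (hs.1 k hk), h2.trans hs.2⟩
    obtain ⟨s₂, g1, g2, g3, g4⟩ := ihf he'.1.2 hs₁ (d := d + 1) (by omega)
    have hd2 : s₂.reg d = e.eval σ := by rw [g4 d (by omega), h3]
    refine ⟨_, .seq (.seq h1 g1) (.op _ _ _ _ _ ?_), g2.trans h2, ?_, ?_⟩
    · rw [hd2, g3]; exact hmono he
    · simp [hd2, g3, Expr.eval]
    · intro j hj
      simp only [upd _ _ _ j hj, g4 j (by omega), h4 j hj]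

/-! ### Total correctness with time bounds, for assignments and blocks. -/

/-- With all values below `V` (and machine words below `V ^ 40`), the program started in `σ`
terminates within `T` steps in a state with values below `V` that satisfies `Q`; temporaries are
disregarded. -/
def Runs (V : ℕ) (p : Program) (σ : State) (T : ℕ) (Q : State → Prop) : Prop :=
  1000 ≤ V → Bdd V σ → ∀ s, Agree s σ → ∃ T' ≤ T, ∃ s' σ', Exec (V ^ 40) p s T' s' ∧ Agree s' σ' ∧
    Bdd V σ' ∧ Q σ'

theorem Runs.mono {V : ℕ} {p : Program} {σ : State} {T T' : ℕ} {Q Q' : State → Prop}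
    (h : Runs V p σ T Q) (hT : T ≤ T') (hQ : ∀ σ', Bdd V σ' → Q σ' → Q' σ') :
    Runs V p σ T' Q' := by
  intro hV hσ s hs
  obtain ⟨T₁, h1, s', σ', h2, h3, h4, h5⟩ := h hV hσ s hs
  exact ⟨T₁, h1.trans hT, s', σ', h2, h3, h4, hQ _ h4 h5⟩

theorem Runs.of_bdd {V : ℕ} {p : Program} {σ : State} {T : ℕ} {Q : State → Prop}
    (h : 1000 ≤ V → Bdd V σ → Runs V p σ T Q) : Runs V p σ T Q := fun hV hσ => h hV hσ hV hσ

theorem Runs.seq {V : ℕ} {p q : Program} {σ : State} {T₁ T₂ : ℕ} {Q Q' : State → Prop}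
    (h : Runs V p σ T₁ Q) (h' : ∀ σ', Bdd V σ' → Q σ' → Runs V q σ' T₂ Q') :
    Runs V (.seq p q) σ (T₁ + T₂) Q' := by
  intro hV hσ s hs
  obtain ⟨T₁, h1, s₁, σ₁, h2, h3, h4, h5⟩ := h hV hσ s hs
  obtain ⟨T₂, g1, s₂, σ₂, g2, g3, g4, g5⟩ := h' σ₁ h4 h5 hV h4 s₁ h3
  exact ⟨T₁ + T₂, by omega, s₂, σ₂, .seq h2 g2, g3, g4, g5⟩

/-- Assignments `reg k := e` and `mem e := f`. -/
inductive Cmd where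
  | set (k : ℕ) (e : Expr)
  | put (e f : Expr)

namespace Cmd

def compile : Cmd → Program
  | set k e => .seq (e.compile 64) (.seq (.const 65 0) (.op .add k 64 65))
  | put e f => .seq (.seq (e.compile 64) (f.compile 65)) (.store 64 65)

def cost : Cmd → ℕ
  | set _ e => e.cost + 2
  | put e f => e.cost + f.cost + 1

def wf : Cmd → Bool
  | set k e => e.wf && decide (k < 64)
  | put e f => e.wf && f.wf

def run : Cmd → State → State
  | set k e, σ => ⟨Function.update σ.reg k (e.eval σ), σ.mem⟩
  | put e f, σ => ⟨σ.reg, Function.update σ.mem (e.eval σ) (f.eval σ)⟩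

def value : Cmd → State → ℕ
  | set _ e, σ => e.eval σ
  | put _ f, σ => f.eval σ

end Cmd

/-- Only the assigned value has to be bounded by `V`; intermediate results are covered by `Cmd.wf`.
-/
theorem Cmd.runs {V : ℕ} {σ : State} {c : Cmd} (hc : c.wf = true) (hv : c.value σ < V) :
    Runs V c.compile σ c.cost (fun σ' => σ' = c.run σ) := by
  intro hV hσ s hs
  have hpos : 0 < V ^ 40 := Nat.pow_pos (by omega)
  have hVV : V ≤ V ^ 40 := Nat.le_self_pow (by norm_num) V
  have upd : ∀ (f : ℕ → ℕ) (d v : ℕ), v < V → (∀ k, f k < V) → ∀ k, Function.update f d v k < V :=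
    fun f d v h1 h2 k => by rw [Function.update_apply]; split_ifs; exacts [h1, h2 k]
  cases c with
  | set k e =>
    simp only [Cmd.wf, Bool.and_eq_true, decide_eq_true_eq] at hc
    obtain ⟨s', h1, h2, h3, h4⟩ := Expr.exec_compile hV hσ hc.1 hs le_rfl
    refine ⟨_, le_rfl, _, _, .seq h1 (.seq (.const _ _ _ hpos) (.op _ _ _ _ _ ?_)), ⟨?_, ?_⟩, ?_, rfl⟩
    · simp only [Op.eval, Function.update_self, add_zero]
      rw [Function.update_of_ne (by norm_num), h3]
      exact lt_of_lt_of_le hv hVV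
    · intro j hj
      simp only [Op.eval, Function.update_self, add_zero, Cmd.run, Function.update_apply]
      simp only [show (64 : ℕ) ≠ 65 by norm_num, show j ≠ 65 by omega, if_false, h3]
      split_ifs
      · rfl
      · rw [h4 j hj, hs.1 j hj]
    · simp only [Cmd.run, h2, hs.2]
    · exact ⟨upd _ _ _ hv hσ.1, hσ.2⟩
  | put e f =>
    simp only [Cmd.wf, Bool.and_eq_true] at hc
    obtain ⟨s₁, h1, h2, h3, h4⟩ := Expr.exec_compile hV hσ hc.1 hs le_rfl
    have hs₁ : Agree s₁ σ := ⟨fun k hk => (h4 k hk).trans (hs.1 k hk), h2.trans hs.2⟩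
    obtain ⟨s₂, g1, g2, g3, g4⟩ := Expr.exec_compile hV hσ hc.2 hs₁ (d := 65) (by norm_num)
    refine ⟨_, le_rfl, _, _, .seq (.seq h1 g1) (.store _ _ _), ⟨?_, ?_⟩, ?_, rfl⟩
    · intro j hj
      simp only [Cmd.run, g4 j (by omega), h4 j hj, hs.1 j hj]
    · simp only [Cmd.run, g3, g4 64 (by norm_num), h3, g2, h2, hs.2]
    · exact ⟨hσ.1, upd _ _ _ hv hσ.2⟩

def block : List Cmd → Program
  | [] => .skip
  | c :: l => .seq c.compile (block l)

def blockCost : List Cmd → ℕ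
  | [] => 1
  | c :: l => c.cost + blockCost l

def blockWf : List Cmd → Bool
  | [] => true
  | c :: l => c.wf && blockWf l

def runBlock : List Cmd → State → State
  | [], σ => σ
  | c :: l, σ => runBlock l (c.run σ)

/-- The block assigns no register below `K`. -/
def setsFrom (K : ℕ) : List Cmd → Bool
  | [] => true
  | .set k _ :: l => decide (K ≤ k) && setsFrom K l
  | .put _ _ :: l => setsFrom K l

/-- A frame rule with a decidable syntactic premise. -/
theorem reg_runBlock {K : ℕ} {l : List Cmd} (h : setsFrom K l = true) (σ : State) {k : ℕ}
    (hk : k < K) : (runBlock l σ).reg k = σ.reg k := by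
  induction l generalizing σ with
  | nil => rfl
  | cons c l ih =>
    cases c with
    | set j e =>
      simp only [setsFrom, Bool.and_eq_true, decide_eq_true_eq] at h
      rw [runBlock, ih h.2]
      exact Function.update_of_ne (by omega) _ _
    | put e f => rw [runBlock, ih h]; rfl

/-- All values computed by the block are below `V`. -/
def blockOk (V : ℕ) : List Cmd → State → Prop
  | [], _ => True
  | c :: l, σ => c.value σ < V ∧ blockOk V l (c.run σ)

theorem runs_block {V : ℕ} {σ : State} {l : List Cmd} {T : ℕ} {Q : State → Prop}
    (hT : blockCost l ≤ T) (hl : blockWf l = true) (ho : blockOk V l σ) (hQ : Q (runBlock l σ)) :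
    Runs V (block l) σ T Q := by
  have key : Runs V (block l) σ (blockCost l) (fun σ' => σ' = runBlock l σ) := by
    clear hQ hT
    induction l generalizing σ with
    | nil => exact fun hV hσ s hs => ⟨1, le_rfl, s, σ, .skip _, hs, hσ, rfl⟩
    | cons c l ih =>
      simp only [blockWf, Bool.and_eq_true] at hl
      refine (Cmd.runs hl.1 ho.1).seq fun σ' _ h => ?_
      subst h
      exact ih hl.2 ho.2
  exact key.mono hT fun σ' _ h => h ▸ hQ

/-! ### Loops. -/

/-- The machine tests a register, so the condition is recomputed into the temporary 64 at the end of
every round. -/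
def whileLoop (e : Expr) (p : Program) : Program :=
  .seq (e.compile 64) (.loop 64 (.seq p (e.compile 64)))

/-- A loop that runs exactly `N` times, with the invariant `Inv j` after `j` rounds. -/
theorem runs_whileLoop {V : ℕ} {e : Expr} {p : Program} {σ : State} (he : e.wf = true)
    (Inv : ℕ → State → Prop) (N : ℕ) (T : ℕ → ℕ) (h0 : Inv 0 σ)
    (hstep : ∀ j < N, ∀ σ, Bdd V σ → Inv j σ →
      e.eval σ ≠ 0 ∧ Runs V p σ (T j) (Inv (j + 1)))
    (hend : ∀ σ, Bdd V σ → Inv N σ → e.eval σ = 0) :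
    Runs V (whileLoop e p) σ (∑ j ∈ Finset.range N, (T j + e.cost + 1) + e.cost + 1) (Inv N) := by
  intro hV hσ s hs
  -- Induction on the number `k` of rounds that remain, with the costs of these rounds summed over
  -- the interval from `j` to `N`.
  have key : ∀ k j, j + k = N → ∀ σ s, Bdd V σ → Agree s σ → Inv j σ → s.reg 64 = e.eval σ →
      ∃ T' ≤ ∑ i ∈ Finset.Ico j N, (T i + e.cost + 1) + 1, ∃ s' σ',
        Exec (V ^ 40) (.loop 64 (.seq p (e.compile 64))) s T' s' ∧ Agree s' σ' ∧ Bdd V σ' ∧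
          Inv N σ' := by
    intro k
    induction k with
    | zero =>
      rintro j rfl σ s hσ hs hi h64
      exact ⟨1, by simp, s, σ, .loopDone (h64.trans (hend _ hσ hi)), hs, hσ, hi⟩
    | succ k ih =>
      intro j hj σ s hσ hs hi h64
      obtain ⟨hne, hrun⟩ := hstep j (by omega) σ hσ hi
      obtain ⟨T₁, h1, s₁, σ₁, h2, h3, h4, h5⟩ := hrun hV hσ s hs
      obtain ⟨s₂, g1, g2, g3, g4⟩ := Expr.exec_compile hV h4 he h3 le_rfl
      have hs₂ : Agree s₂ σ₁ := ⟨fun k hk => (g4 k hk).trans (h3.1 k hk), g2.trans h3.2⟩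
      obtain ⟨T₃, t1, s₃, σ₃, t2, t3, t4, t5⟩ := ih (j + 1) (by omega) σ₁ s₂ h4 hs₂ h5 g3
      refine ⟨_, ?_, s₃, σ₃, .loopStep (by rwa [h64]) (.seq h2 g1) t2, t3, t4, t5⟩
      rw [Finset.sum_eq_sum_Ico_succ_bot (by omega)]
      omega
  obtain ⟨s₁, g1, g2, g3, g4⟩ := Expr.exec_compile hV hσ he hs le_rfl
  have hs₁ : Agree s₁ σ := ⟨fun k hk => (g4 k hk).trans (hs.1 k hk), g2.trans hs.2⟩
  obtain ⟨T', t1, s', σ', t2, t3, t4, t5⟩ := key N 0 (by omega) σ s₁ hσ hs₁ h0 g3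
  refine ⟨_, ?_, s', σ', .seq g1 t2, t3, t4, t5⟩
  rw [Finset.range_eq_Ico]
  omega

/-- A loop with a uniform bound on the cost of its rounds. -/
theorem runs_whileLoop_const {V : ℕ} {e : Expr} {p : Program} {σ : State} (he : e.wf = true)
    (Inv : ℕ → State → Prop) (N T T' : ℕ) (h0 : Inv 0 σ)
    (hstep : ∀ j < N, ∀ σ, Bdd V σ → Inv j σ → e.eval σ ≠ 0 ∧ Runs V p σ T (Inv (j + 1)))
    (hend : ∀ σ, Bdd V σ → Inv N σ → e.eval σ = 0)
    (hT : N * (T + e.cost + 1) + e.cost + 1 ≤ T') {Q : State → Prop}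
    (hQ : ∀ σ', Bdd V σ' → Inv N σ' → Q σ') :
    Runs V (whileLoop e p) σ T' Q :=
  (runs_whileLoop he Inv N (fun _ => T) h0 hstep hend).mono (by simpa using hT) hQ

open Finset

/-! ### The discrete Fourier transform and its fast evaluation -/

theorem sum_range_two_mul {M : Type*} [AddCommMonoid M] (f : ℕ → M) (l : ℕ) :
    ∑ u ∈ range (2 * l), f u = ∑ v ∈ range l, (f (2 * v) + f (2 * v + 1)) := by
  induction l with
  | zero => simp
  | succ l ih => rw [mul_add, mul_one, sum_range_succ, sum_range_succ, ih, sum_range_succ, add_assoc]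

/-- The array after the stage of the fast Fourier transform with `l` entries per partial
transform; `r` is the number of partial transforms. -/
def partialDFT (ω : ℂ) (x : ℕ → ℂ) (l r i : ℕ) : ℂ :=
  ∑ u ∈ range l, x (i % r + r * u) * ω ^ (r * u * (i / r))

def dft (ω : ℂ) (x : ℕ → ℂ) (L b : ℕ) : ℂ := ∑ u ∈ range L, x u * ω ^ (u * b)

theorem partialDFT_one (ω : ℂ) (x : ℕ → ℂ) {L i : ℕ} (hi : i < L) :
    partialDFT ω x 1 L i = x i := by
  simp [partialDFT, Nat.mod_eq_of_lt hi]

theorem partialDFT_full (ω : ℂ) (x : ℕ → ℂ) (L i : ℕ) :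
    partialDFT ω x L 1 i = dft ω x L i := by
  simp [partialDFT, dft, Nat.mod_one]

/-- Write `i = s + r * b` with `s = i % r`. Then `i - s + i = s + 2 * r * b`, and reduction modulo
`2 * l * r` replaces `b` by `b % l`. So one remainder locates both inputs of the butterfly, `r`
apart, in natural order and without bit reversal. -/
theorem butterfly_index {l r i : ℕ} (hr : 0 < r) (hi : i < 2 * l * r) :
    (i - i % r + i) % (2 * l * r) + r < 2 * l * r ∧
    ((i - i % r + i) % (2 * l * r)) = i % r + (2 * r) * (i / r % l) := by
  have hd := Nat.div_add_mod i r
  have hs := Nat.mod_lt i hr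
  set b := i / r with hb
  set s := i % r with hsd
  have hbl : b < 2 * l := by
    by_contra h
    have : r * (2 * l) ≤ r * b := Nat.mul_le_mul_left r (by omega)
    have h2 : r * (2 * l) = 2 * l * r := by ring
    omega
  have hl : 0 < l := by
    rcases Nat.eq_zero_or_pos l with rfl | h
    · simp at hi
    · exact h
  have hbm := Nat.mod_lt b hl
  have e1 : i - s + i = s + (2 * r) * (b % l) + (2 * l * r) * (b / l) := by
    have h1 := Nat.div_add_mod b l
    have : (2 * r) * (b % l) + (2 * l * r) * (b / l) = 2 * (r * (l * (b / l) + b % l)) := by ring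
    rw [h1] at this
    omega
  have e2 : s + (2 * r) * (b % l) + r < 2 * l * r := by
    have : (2 * r) * (b % l + 1) ≤ 2 * r * l := Nat.mul_le_mul_left _ (by omega)
    have h2 : 2 * r * l = 2 * l * r := by ring
    rw [mul_add, mul_one] at this
    omega
  have e3 : (i - s + i) % (2 * l * r) = s + (2 * r) * (b % l) := by
    rw [e1, Nat.add_mul_mod_self_left, Nat.mod_eq_of_lt (by omega)]
  exact ⟨by rw [e3]; exact e2, e3⟩

/-- One stage of the fast Fourier transform. -/
theorem partialDFT_two_mul (ω : ℂ) (x : ℕ → ℂ) {l r i : ℕ} (hr : 0 < r) (hi : i < 2 * l * r)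
    (hω : ω ^ (2 * l * r) = 1) :
    partialDFT ω x (2 * l) r i =
      partialDFT ω x l (2 * r) ((i - i % r + i) % (2 * l * r)) +
        ω ^ (i - i % r) * partialDFT ω x l (2 * r) ((i - i % r + i) % (2 * l * r) + r) := by
  obtain ⟨-, hj⟩ := butterfly_index hr hi
  have hd := Nat.div_add_mod i r
  have hs := Nat.mod_lt i hr
  rw [hj]
  set b := i / r with hb
  set s := i % r with hsd
  -- Since `ω ^ (2 * l * r) = 1`, the exponent depends on `b` only modulo `l`.
  have hω' : ∀ u, ω ^ (2 * r * u * (b % l)) = ω ^ (2 * r * u * b) := by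
    intro u
    conv_rhs => rw [← Nat.div_add_mod b l, mul_add, pow_add,
      show 2 * r * u * (l * (b / l)) = (2 * l * r) * (u * (b / l)) by ring, pow_mul, hω, one_pow,
      one_mul]
  have d1 : (s + 2 * r * (b % l)) / (2 * r) = b % l := by
    rw [Nat.add_mul_div_left _ _ (by omega), Nat.div_eq_of_lt (by omega), zero_add]
  have m1 : (s + 2 * r * (b % l)) % (2 * r) = s := by
    rw [Nat.add_mul_mod_self_left, Nat.mod_eq_of_lt (by omega)]
  have d2 : (s + 2 * r * (b % l) + r) / (2 * r) = b % l := by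
    rw [add_right_comm, Nat.add_mul_div_left _ _ (by omega), Nat.div_eq_of_lt (by omega), zero_add]
  have m2 : (s + 2 * r * (b % l) + r) % (2 * r) = s + r := by
    rw [add_right_comm, Nat.add_mul_mod_self_left, Nat.mod_eq_of_lt (by omega)]
  simp only [partialDFT, d1, d2, m1, m2, hω', ← hb, ← hsd]
  -- Even `u` give the first partial transform; odd `u` give the second, with the common factor `ω ^
  -- (r * b)`.
  rw [sum_range_two_mul, sum_add_distrib, mul_sum]
  congr 1
  · refine sum_congr rfl fun v _ => ?_
    rw [show r * (2 * v) = 2 * r * v by ring]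
  · refine sum_congr rfl fun v _ => ?_
    rw [show s + r * (2 * v + 1) = s + r + 2 * r * v by ring,
      show r * (2 * v + 1) * b = 2 * r * v * b + r * b by ring, pow_add,
      show i - s = r * b by omega]
    ring

theorem norm_partialDFT_le {ω : ℂ} (hω : ‖ω‖ = 1) {x : ℕ → ℂ} {B : ℝ} {l r i : ℕ} (hr : 0 < r)
    (hx : ∀ i < l * r, ‖x i‖ ≤ B) : ‖partialDFT ω x l r i‖ ≤ l * B := by
  unfold partialDFT
  refine (norm_sum_le _ _).trans ?_
  have : ∀ u ∈ range l, ‖x (i % r + r * u) * ω ^ (r * u * (i / r))‖ ≤ B := by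
    intro u hu
    rw [norm_mul, norm_pow, hω, one_pow, mul_one]
    refine hx _ ?_
    have h1 := Nat.mod_lt i hr
    have h2 : r * (u + 1) ≤ r * l := Nat.mul_le_mul_left r (mem_range.1 hu)
    rw [mul_add, mul_one] at h2
    rw [mul_comm l r]
    omega
  refine (sum_le_sum this).trans ?_
  simp

theorem geom_sum_root {ω : ℂ} {L : ℕ} (hω : IsPrimitiveRoot ω L) (k : ℕ) :
    ∑ b ∈ range L, ω ^ (k * b) = if L ∣ k then (L : ℂ) else 0 := by
  simp only [pow_mul]
  split_ifs with h
  · rw [(hω.pow_eq_one_iff_dvd k).2 h]; simp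
  · have h1 : ω ^ k ≠ 1 := fun h1 => h ((hω.pow_eq_one_iff_dvd k).1 h1)
    rw [geom_sum_eq h1, ← pow_mul, mul_comm, pow_mul, hω.pow_eq_one]
    simp

/-- The number of representations of `j` as a sum of three indices from given index sets. -/
def tripleCount (P₁ P₂ P₃ : ℕ → ℕ) (L j : ℕ) : ℕ :=
  ∑ u ∈ range L, ∑ v ∈ range L, ∑ w ∈ range L, if u + v + w = j then P₁ u * P₂ v * P₃ w else 0

/-- The inverse transform is the forward transform read at `-j` modulo `L`, without the division by
`L`. The support condition excludes wrap-around, so the cyclic convolution is the true one. -/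
theorem dft_dft_mul {ω : ℂ} {L j : ℕ} (hω : IsPrimitiveRoot ω L) {P₁ P₂ P₃ : ℕ → ℕ}
    (hsupp : ∀ u v w, P₁ u ≠ 0 → P₂ v ≠ 0 → P₃ w ≠ 0 → u + v + w < L) (hj : j < L) :
    dft ω (fun b => dft ω (fun u => P₁ u) L b * dft ω (fun u => P₂ u) L b *
      dft ω (fun u => P₃ u) L b) L ((L - j) % L) = L * tripleCount P₁ P₂ P₃ L j := by
  have hk : ∀ u v w, P₁ u ≠ 0 → P₂ v ≠ 0 → P₃ w ≠ 0 →
      (L ∣ u + v + w + (L - j) % L ↔ u + v + w = j) := by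
    intro u v w h1 h2 h3
    have hlt := hsupp u v w h1 h2 h3
    rw [Nat.dvd_iff_mod_eq_zero, Nat.add_mod_mod]
    constructor
    · intro h
      obtain ⟨c, hc⟩ := Nat.dvd_of_mod_eq_zero h
      have : c < 2 := by
        by_contra hcon
        have : L * 2 ≤ L * c := Nat.mul_le_mul_left L (by omega)
        omega
      interval_cases c <;> omega
    · intro h
      rw [show u + v + w + (L - j) = L by omega, Nat.mod_self]
  have hterm : ∀ u v w, ∑ b ∈ range L, ((P₁ u : ℂ) * ω ^ (u * b)) * (P₂ v * ω ^ (v * b)) *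
      (P₃ w * ω ^ (w * b)) * ω ^ (b * ((L - j) % L)) =
      L * (if u + v + w = j then P₁ u * P₂ v * P₃ w else 0 : ℕ) := by
    intro u v w
    have e1 : ∀ b, ((P₁ u : ℂ) * ω ^ (u * b)) * (P₂ v * ω ^ (v * b)) *
      (P₃ w * ω ^ (w * b)) * ω ^ (b * ((L - j) % L)) =
      (P₁ u * P₂ v * P₃ w) * ω ^ ((u + v + w + (L - j) % L) * b) := by
      intro b
      rw [add_mul, add_mul, add_mul, pow_add, pow_add, pow_add, mul_comm b]
      ring
    simp only [e1]
    rw [← mul_sum, geom_sum_root hω]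
    by_cases h1 : P₁ u = 0
    · simp [h1]
    by_cases h2 : P₂ v = 0
    · simp [h2]
    by_cases h3 : P₃ w = 0
    · simp [h3]
    simp only [hk u v w h1 h2 h3]
    split_ifs
    · push_cast; ring
    · simp
  have hexp : ∀ b, (∑ u ∈ range L, (P₁ u : ℂ) * ω ^ (u * b)) *
      (∑ v ∈ range L, (P₂ v : ℂ) * ω ^ (v * b)) * (∑ w ∈ range L, (P₃ w : ℂ) * ω ^ (w * b)) *
      ω ^ (b * ((L - j) % L)) = ∑ u ∈ range L, ∑ v ∈ range L, ∑ w ∈ range L,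
        ((P₁ u : ℂ) * ω ^ (u * b)) * (P₂ v * ω ^ (v * b)) *
      (P₃ w * ω ^ (w * b)) * ω ^ (b * ((L - j) % L)) := by
    intro b
    rw [sum_mul_sum, sum_mul, sum_mul]
    refine sum_congr rfl fun u _ => ?_
    rw [sum_mul, sum_mul]
    refine sum_congr rfl fun v _ => ?_
    rw [mul_sum, sum_mul]
  simp only [tripleCount, Nat.cast_sum, mul_sum]
  unfold dft
  simp only [hexp]
  rw [sum_comm]
  refine sum_congr rfl fun u _ => ?_
  rw [sum_comm]
  refine sum_congr rfl fun v _ => ?_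
  rw [sum_comm]
  exact sum_congr rfl fun w _ => hterm u v w

theorem tripleCount_pos_iff {P₁ P₂ P₃ : ℕ → ℕ} {L j : ℕ} :
    0 < tripleCount P₁ P₂ P₃ L j ↔ ∃ u < L, ∃ v < L, ∃ w < L, u + v + w = j ∧
      P₁ u ≠ 0 ∧ P₂ v ≠ 0 ∧ P₃ w ≠ 0 := by
  have h : 0 < tripleCount P₁ P₂ P₃ L j ↔ tripleCount P₁ P₂ P₃ L j ≠ 0 := Nat.pos_iff_ne_zero
  rw [h, tripleCount]
  simp only [ne_eq, sum_eq_zero_iff, mem_range, ite_eq_right_iff, mul_eq_zero]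
  push Not
  constructor
  · rintro ⟨u, hu, v, hv, w, hw, h, h'⟩
    exact ⟨u, hu, v, hv, w, hw, by tauto, by tauto⟩
  · rintro ⟨u, hu, v, hv, w, hw, h, h'⟩
    exact ⟨u, hu, v, hv, w, hw, by tauto, by tauto⟩

/-! ### Fixed-point complex numbers

A real number `x` is approximated by `u / N ^ 16` with an integer `u`, which is stored as its
remainder modulo `2 * N ^ 40`. -/

/-- The cell contents `m₁`, `m₂` represent a complex number at distance at most `ε` from `z`. -/
def Cell (N m₁ m₂ : ℕ) (z : ℂ) (ε : ℝ) : Prop :=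
  ∃ u v : ℤ, (m₁ : ℤ) = u % (2 * N ^ 40 : ℕ) ∧ (m₂ : ℤ) = v % (2 * N ^ 40 : ℕ) ∧
    ‖(⟨u / (N : ℝ) ^ 16, v / (N : ℝ) ^ 16⟩ : ℂ) - z‖ ≤ ε

theorem Cell.mono {N m₁ m₂ : ℕ} {z : ℂ} {ε ε' : ℝ} (h : Cell N m₁ m₂ z ε) (hε : ε ≤ ε') :
    Cell N m₁ m₂ z ε' := by
  obtain ⟨u, v, h1, h2, h3⟩ := h
  exact ⟨u, v, h1, h2, h3.trans hε⟩

theorem Cell.lt {N m₁ m₂ : ℕ} (hN : 0 < N) {z : ℂ} {ε : ℝ} (h : Cell N m₁ m₂ z ε) :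
    m₁ < 2 * N ^ 40 ∧ m₂ < 2 * N ^ 40 := by
  obtain ⟨u, v, h1, h2, -⟩ := h
  have hM : (0 : ℤ) < (2 * N ^ 40 : ℕ) := by exact_mod_cast by positivity
  have hu := Int.emod_lt_of_pos u hM
  have hv := Int.emod_lt_of_pos v hM
  rw [← h1] at hu
  rw [← h2] at hv
  exact ⟨by exact_mod_cast hu, by exact_mod_cast hv⟩

theorem Cell.of_nat {N u v : ℕ} (hu : u < 2 * N ^ 40) (hv : v < 2 * N ^ 40) {z : ℂ} {ε : ℝ}
    (h : ‖(⟨u / (N : ℝ) ^ 16, v / (N : ℝ) ^ 16⟩ : ℂ) - z‖ ≤ ε) : Cell N u v z ε := by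
  refine ⟨u, v, ?_, ?_, by simpa only [Int.cast_natCast] using h⟩
  · rw [Int.emod_eq_of_lt (by positivity) (by exact_mod_cast hu)]
  · rw [Int.emod_eq_of_lt (by positivity) (by exact_mod_cast hv)]

/-- Division by the scale `N ^ 16`, rounded down, of a number stored modulo `2 * N ^ 40`. -/
def scaleDown (N p : ℕ) : ℕ :=
  (p + N ^ 40) % (2 * N ^ 40) / N ^ 16 + (2 * N ^ 40 - N ^ 40 / N ^ 16)

theorem half_div_scale {N : ℕ} (hN : 0 < N) : N ^ 40 / N ^ 16 = N ^ 24 := by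
  rw [Nat.pow_div (by norm_num) hN]

theorem emod_add_half {N p : ℕ} {v : ℤ} (h : (p : ℤ) ≡ v [ZMOD (2 * N ^ 40 : ℕ)])
    (hv : |v| < (N : ℤ) ^ 40) :
    (((p + N ^ 40) % (2 * N ^ 40) : ℕ) : ℤ) = v + (N : ℤ) ^ 40 := by
  rw [abs_lt] at hv
  rw [Int.natCast_mod, Nat.cast_add, (h.add_right _ : _ % _ = _), Nat.cast_pow,
    Int.emod_eq_of_lt (by linarith)]
  push_cast
  linarith

/-- Shifting by half the modulus turns a residue of small absolute value into the actual nonnegative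
integer `v + N ^ 40`. As `N ^ 16` divides `N ^ 40`, division rounded down commutes with the shift,
which is removed afterwards. -/
theorem scaleDown_modEq {N p : ℕ} (hN : 0 < N) {v : ℤ} (h : (p : ℤ) ≡ v [ZMOD (2 * N ^ 40 : ℕ)])
    (hv : |v| < (N : ℤ) ^ 40) :
    (scaleDown N p : ℤ) ≡ v / (N : ℤ) ^ 16 [ZMOD (2 * N ^ 40 : ℕ)] := by
  have hQ : (0 : ℤ) < (N : ℤ) ^ 16 := by positivity
  have h24 : N ^ 24 ≤ 2 * N ^ 40 := by
    have : N ^ 24 ≤ N ^ 40 := Nat.pow_le_pow_right hN (by norm_num)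
    omega
  unfold scaleDown
  rw [half_div_scale hN]
  push_cast [Nat.cast_sub h24]
  have e := emod_add_half h hv
  push_cast at e
  rw [e, show (N : ℤ) ^ 40 = N ^ 24 * N ^ 16 by ring, Int.add_mul_ediv_right _ _ hQ.ne']
  rw [Int.modEq_iff_dvd]
  exact ⟨-1, by ring⟩

/-- Subtraction is truncated, so `-wi` is represented by `2 * N ^ 40 - wi`. -/
def mulAddRe (N x wr wi yr yi : ℕ) : ℕ :=
  (x + scaleDown N (wr * yr + (2 * N ^ 40 - wi) * yi)) % (2 * N ^ 40)

def mulAddIm (N x wr wi yr yi : ℕ) : ℕ :=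
  (x + scaleDown N (wr * yi + wi * yr)) % (2 * N ^ 40)

/-- A product of two fixed-point numbers has scale `N ^ 32`. The half modulus `N ^ 40` thus leaves
room for products of absolute value below `N ^ 8`. -/
theorem abs_lt_of_real {N : ℕ} {p : ℤ} (h : |(p : ℝ) / (N : ℝ) ^ 32| < (N : ℝ) ^ 8) (hN : 0 < N) :
    |p| < (N : ℤ) ^ 40 := by
  have hN' : (0 : ℝ) < N := by exact_mod_cast hN
  rw [abs_div, abs_of_pos (by positivity : (0 : ℝ) < (N : ℝ) ^ 32), div_lt_iff₀ (by positivity),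
    ← pow_add] at h
  exact_mod_cast h

theorem abs_floor_sub_le (Q : ℝ) (q : ℤ) (hq : 0 < q) (hQ : Q = q) (x p : ℤ) :
    |((x + p / q : ℤ) : ℝ) / Q - (x / Q + p / Q ^ 2)| ≤ 1 / Q := by
  have hq' : (0 : ℝ) < q := by exact_mod_cast hq
  subst hQ
  have h1 := Int.ediv_mul_add_emod p q
  have h2 := Int.emod_nonneg p hq.ne'
  have h3 := Int.emod_lt_of_pos p hq
  have e : (p : ℝ) = (p / q : ℤ) * q + (p % q : ℤ) := by exact_mod_cast h1.symm
  have h2' : (0 : ℝ) ≤ (p % q : ℤ) := by exact_mod_cast h2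
  have h3' : ((p % q : ℤ) : ℝ) < q := by exact_mod_cast h3
  have : ((x + p / q : ℤ) : ℝ) / q - (x / q + p / (q : ℝ) ^ 2) = -((p % q : ℤ) / (q : ℝ) ^ 2) := by
    rw [e]; push_cast; field_simp; ring
  rw [this, abs_neg, abs_of_nonneg (by positivity), div_le_div_iff₀ (by positivity) hq']
  nlinarith

/-- The fixed-point evaluation of `z₀ + ζ * z₁`. -/
theorem Cell.mulAdd {N x₁ x₂ w₁ w₂ y₁ y₂ : ℕ} (hN : 0 < N) {z₀ ζ z₁ : ℂ} {ε₀ δ ε₁ : ℝ}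
    (hx : Cell N x₁ x₂ z₀ ε₀) (hw : Cell N w₁ w₂ ζ δ) (hy : Cell N y₁ y₂ z₁ ε₁)
    (hb : (‖ζ‖ + δ) * (‖z₁‖ + ε₁) < (N : ℝ) ^ 8) :
    Cell N (mulAddRe N x₁ w₁ w₂ y₁ y₂) (mulAddIm N x₂ w₁ w₂ y₁ y₂) (z₀ + ζ * z₁)
      (ε₀ + (‖ζ‖ + δ) * ε₁ + δ * ‖z₁‖ + 2 / (N : ℝ) ^ 16) := by
  have hw2 := (hw.lt hN).2
  obtain ⟨xu, xv, hx1, hx2, hx3⟩ := hx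
  obtain ⟨wu, wv, hw1, hw2', hw3⟩ := hw
  obtain ⟨yu, yv, hy1, hy2, hy3⟩ := hy
  have hN' : (0 : ℝ) < N := by exact_mod_cast hN
  have em : ∀ (n : ℕ) (u : ℤ), (n : ℤ) = u % (2 * N ^ 40 : ℕ) →
      (n : ℤ) ≡ u [ZMOD (2 * N ^ 40 : ℕ)] := fun n u h => by
    rw [h]; exact Int.mod_modEq _ _
  set X : ℂ := ⟨xu / (N : ℝ) ^ 16, xv / (N : ℝ) ^ 16⟩ with hX
  set W : ℂ := ⟨wu / (N : ℝ) ^ 16, wv / (N : ℝ) ^ 16⟩ with hW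
  set Y : ℂ := ⟨yu / (N : ℝ) ^ 16, yv / (N : ℝ) ^ 16⟩ with hY
  have hWn : ‖W‖ ≤ ‖ζ‖ + δ := by
    have := norm_add_le (W - ζ) ζ; rw [sub_add_cancel] at this; linarith
  have hYn : ‖Y‖ ≤ ‖z₁‖ + ε₁ := by
    have := norm_add_le (Y - z₁) z₁; rw [sub_add_cancel] at this; linarith
  have hWY : ‖W * Y‖ < (N : ℝ) ^ 8 := by
    rw [norm_mul]
    exact (mul_le_mul hWn hYn (norm_nonneg _) ((norm_nonneg _).trans hWn)).trans_lt hb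
  have hre : (W * Y).re = ((wu * yu - wv * yv : ℤ) : ℝ) / (N : ℝ) ^ 32 := by
    simp only [Complex.mul_re, hW, hY]; push_cast; field_simp
  have him : (W * Y).im = ((wu * yv + wv * yu : ℤ) : ℝ) / (N : ℝ) ^ 32 := by
    simp only [Complex.mul_im, hW, hY]; push_cast; field_simp
  have hp : |wu * yu - wv * yv| < (N : ℤ) ^ 40 :=
    abs_lt_of_real (by rw [← hre]; exact (Complex.abs_re_le_norm _).trans_lt hWY) hN
  have hq : |wu * yv + wv * yu| < (N : ℤ) ^ 40 :=
    abs_lt_of_real (by rw [← him]; exact (Complex.abs_im_le_norm _).trans_lt hWY) hN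
  -- The witnesses are the signed integers that exact integer arithmetic would produce; the bound on
  -- the product guarantees that residues modulo `2 * N ^ 40` determine them.
  refine ⟨xu + (wu * yu - wv * yv) / (N : ℤ) ^ 16, xv + (wu * yv + wv * yu) / (N : ℤ) ^ 16,
    ?_, ?_, ?_⟩
  · rw [mulAddRe, Int.natCast_mod, Nat.cast_add]
    refine (em _ _ hx1).add (scaleDown_modEq hN ?_ hp)
    rw [Nat.cast_add, Nat.cast_mul w₁ y₁, Nat.cast_mul _ y₂, Nat.cast_sub hw2.le, sub_eq_add_neg (wu * yu),
      ← neg_mul]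
    refine ((em _ _ hw1).mul (em _ _ hy1)).add (Int.ModEq.mul ?_ (em _ _ hy2))
    have := (em _ _ hw2').neg
    refine Int.ModEq.trans ?_ this
    rw [Int.modEq_iff_dvd]
    exact ⟨-1, by ring⟩
  · rw [mulAddIm, Int.natCast_mod, Nat.cast_add]
    refine (em _ _ hx2).add (scaleDown_modEq hN ?_ hq)
    rw [Nat.cast_add, Nat.cast_mul w₁ y₂, Nat.cast_mul w₂ y₁]
    exact ((em _ _ hw1).mul (em _ _ hy2)).add ((em _ _ hw2').mul (em _ _ hy1))
  · set Z : ℂ := ⟨((xu + (wu * yu - wv * yv) / (N : ℤ) ^ 16 : ℤ) : ℝ) / (N : ℝ) ^ 16,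
      ((xv + (wu * yv + wv * yu) / (N : ℤ) ^ 16 : ℤ) : ℝ) / (N : ℝ) ^ 16⟩ with hZ
    have hQ : (0 : ℤ) < (N : ℤ) ^ 16 := by positivity
    have hround : ‖Z - (X + W * Y)‖ ≤ 2 / (N : ℝ) ^ 16 := by
      refine (Complex.norm_le_abs_re_add_abs_im _).trans ?_
      have h1 := abs_floor_sub_le ((N : ℝ) ^ 16) ((N : ℤ) ^ 16) hQ (by push_cast; ring) xu
        (wu * yu - wv * yv)
      have h2 := abs_floor_sub_le ((N : ℝ) ^ 16) ((N : ℤ) ^ 16) hQ (by push_cast; ring) xv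
        (wu * yv + wv * yu)
      rw [← pow_mul, show 16 * 2 = 32 by norm_num] at h1 h2
      rw [Complex.sub_re, Complex.sub_im, Complex.add_re, Complex.add_im, hre, him]
      calc _ ≤ 1 / (N : ℝ) ^ 16 + 1 / (N : ℝ) ^ 16 := add_le_add h1 h2
        _ = _ := by ring
    -- The error splits into rounding, the error of `X`, that of `Y` scaled by `W`, and that of `W`
    -- scaled by `z₁`.
    have hsplit : Z - (z₀ + ζ * z₁) =
        (Z - (X + W * Y)) + ((X - z₀) + (W * (Y - z₁) + (W - ζ) * z₁)) := by ring
    have hδ : 0 ≤ δ := (norm_nonneg _).trans hw3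
    have hε : 0 ≤ ε₁ := (norm_nonneg _).trans hy3
    rw [hsplit]
    have t1 := norm_add_le (Z - (X + W * Y)) ((X - z₀) + (W * (Y - z₁) + (W - ζ) * z₁))
    have t2 := norm_add_le (X - z₀) (W * (Y - z₁) + (W - ζ) * z₁)
    have t3 := norm_add_le (W * (Y - z₁)) ((W - ζ) * z₁)
    rw [norm_mul, norm_mul] at t3
    have t4 : ‖W‖ * ‖Y - z₁‖ ≤ (‖ζ‖ + δ) * ε₁ :=
      mul_le_mul hWn hy3 (norm_nonneg _) ((norm_nonneg _).trans hWn)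
    have t5 : ‖W - ζ‖ * ‖z₁‖ ≤ δ * ‖z₁‖ := mul_le_mul_of_nonneg_right hw3 (norm_nonneg _)
    linarith

/-- Rounding a stored natural number and comparing it with zero. -/
theorem Cell.threshold {N m₁ m₂ K : ℕ} (hN : 2 ≤ N) {ε : ℝ} (h : Cell N m₁ m₂ (K : ℂ) ε)
    (hε : ε ≤ 1 / 4) (hK : K < N ^ 8) :
    1 - (1 - (2 * ((m₁ + N ^ 40) % (2 * N ^ 40)) - (2 * N ^ 40 + N ^ 16))) =
      if 0 < K then 1 else 0 := by
  obtain ⟨u, v, h1, -, h3⟩ := h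
  have hN' : (0 : ℝ) < N := by exact_mod_cast (by omega : 0 < N)
  have hQ : (0 : ℝ) < (N : ℝ) ^ 16 := by positivity
  have h4 : |(u : ℝ) / (N : ℝ) ^ 16 - K| ≤ 1 / 4 := by
    have := (Complex.abs_re_le_norm _).trans (h3.trans hε)
    simpa using this
  rw [abs_le] at h4
  have hb1 : ((K : ℝ) - 1 / 4) * (N : ℝ) ^ 16 ≤ u := by
    rw [← le_div_iff₀ hQ]; linarith
  have hb2 : (u : ℝ) ≤ (K + 1 / 4) * (N : ℝ) ^ 16 := by
    rw [← div_le_iff₀ hQ]; linarith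
  have hK' : (K : ℝ) + 1 ≤ (N : ℝ) ^ 8 := by exact_mod_cast hK
  have h816 : (N : ℝ) ^ 8 * (N : ℝ) ^ 16 ≤ (N : ℝ) ^ 40 := by
    rw [← pow_add]
    exact pow_le_pow_right₀ (by exact_mod_cast (by omega : 1 ≤ N)) (by norm_num)
  have hu : |u| < (N : ℤ) ^ 40 := by
    have : |(u : ℝ)| < (N : ℝ) ^ 40 := by
      rw [abs_lt]
      have hk0 : (0 : ℝ) ≤ K := by positivity
      constructor <;> nlinarith
    exact_mod_cast this
  have e := emod_add_half (p := m₁) (by rw [h1]; exact Int.mod_modEq _ _) hu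
  -- The threshold is 1/2: an approximation within 1/4 of an integer `K` exceeds it exactly when `K
  -- > 0`. The comparison is made on `u + N ^ 40`, and `1 - (1 - x)` turns a positive truncated
  -- difference into 1.
  have hcase : (0 < K → (N : ℤ) ^ 16 < 2 * u) ∧ (¬ 0 < K → 2 * u ≤ (N : ℤ) ^ 16) := by
    constructor
    · intro hk
      have : (1 : ℝ) ≤ K := by exact_mod_cast hk
      have : (N : ℝ) ^ 16 < 2 * u := by nlinarith
      exact_mod_cast this
    · intro hk
      have : (K : ℝ) = 0 := by exact_mod_cast (by omega : K = 0)
      have : (2 : ℝ) * u ≤ (N : ℝ) ^ 16 := by rw [this] at hb2; nlinarith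
      exact_mod_cast this
  have e2 : (((N ^ 40 : ℕ) : ℤ)) = (N : ℤ) ^ 40 := by push_cast; ring
  have e3 : (((N ^ 16 : ℕ) : ℤ)) = (N : ℤ) ^ 16 := by push_cast; ring
  rw [← e2] at e
  rw [← e3] at hcase
  generalize (m₁ + N ^ 40) % (2 * N ^ 40) = y at *
  generalize N ^ 40 = A at *
  generalize N ^ 16 = B at *
  split_ifs with hk
  · have := hcase.1 hk; omega
  · have := hcase.2 hk; omega

/-! ### Error bounds -/

/-- The error after `q` stages of the transform, for inputs of norm at most `B` that are known up
to `ε`. -/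
noncomputable def stageError (N : ℕ) (B ε : ℝ) (q : ℕ) : ℝ := 4 ^ q * (ε + 2 * B / (N : ℝ) ^ 10)

theorem stageError_le {N : ℕ} (hN : 8 ≤ N) {B ε : ℝ} (hB : 1 ≤ B) (hε : 0 ≤ ε) {q : ℕ}
    (hq : 2 ^ q ≤ N) : stageError N B ε q ≤ (N : ℝ) ^ 2 * (ε + 2 * B / (N : ℝ) ^ 10) := by
  unfold stageError
  have : (4 : ℝ) ^ q ≤ (N : ℝ) ^ 2 := by
    rw [show (4 : ℝ) = 2 ^ 2 by norm_num, ← pow_mul, mul_comm, pow_mul]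
    exact pow_le_pow_left₀ (by positivity) (by exact_mod_cast hq) 2
  gcongr

/-- With `E` the previous error bound, the two inputs contribute `2 * E`, the inexact root scaled by
the input error at most `E`, and the root error on `z₁` together with rounding at most `E`. The
summand `2 * B / N ^ 10` in `stageError` is there to absorb the last contribution. -/
theorem Cell.butterfly {N x₁ x₂ w₁ w₂ y₁ y₂ q : ℕ} (hN : 8 ≤ N) (hq : 2 ^ q ≤ N) {z₀ ζ z₁ : ℂ}
    {B ε : ℝ} (hB : 1 ≤ B) (hBN : B ≤ (N : ℝ) ^ 3) (hε : 0 ≤ ε) (hε1 : ε ≤ 1)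
    (hx : Cell N x₁ x₂ z₀ (stageError N B ε q)) (hw : Cell N w₁ w₂ ζ (1 / (N : ℝ) ^ 10))
    (hy : Cell N y₁ y₂ z₁ (stageError N B ε q)) (hζ : ‖ζ‖ = 1) (hz : ‖z₁‖ ≤ 2 ^ q * B) :
    Cell N (mulAddRe N x₁ w₁ w₂ y₁ y₂) (mulAddIm N x₂ w₁ w₂ y₁ y₂) (z₀ + ζ * z₁)
      (stageError N B ε (q + 1)) := by
  have hN' : (8 : ℝ) ≤ N := by exact_mod_cast hN
  have h10 : (1 : ℝ) / (N : ℝ) ^ 10 ≤ 1 := by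
    rw [div_le_one (by positivity)]; exact one_le_pow₀ (by linarith)
  have hq' : (2 : ℝ) ^ q ≤ N := by exact_mod_cast hq
  have hzN : ‖z₁‖ ≤ (N : ℝ) ^ 4 := by
    calc _ ≤ 2 ^ q * B := hz
      _ ≤ N * (N : ℝ) ^ 3 := by gcongr
      _ = _ := by ring
  have hE := stageError_le hN hB hε hq
  have hE2 : stageError N B ε q ≤ (N : ℝ) ^ 4 := by
    refine hE.trans ?_
    have h1 : 2 * B / (N : ℝ) ^ 10 ≤ 1 := by
      rw [div_le_one (by positivity)]
      calc 2 * B ≤ N * (N : ℝ) ^ 3 := by gcongr; linarith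
        _ = (N : ℝ) ^ 4 := by ring
        _ ≤ _ := pow_le_pow_right₀ (by linarith) (by norm_num)
    calc (N : ℝ) ^ 2 * (ε + 2 * B / (N : ℝ) ^ 10) ≤ (N : ℝ) ^ 2 * (1 + 1) := by gcongr
      _ ≤ (N : ℝ) ^ 2 * (N : ℝ) ^ 2 := by gcongr; nlinarith
      _ = _ := by ring
  have h0 : 0 ≤ stageError N B ε q := by unfold stageError; positivity
  refine (Cell.mulAdd (by omega) hx hw hy ?_).mono ?_
  · rw [hζ]
    calc (1 + 1 / (N : ℝ) ^ 10) * (‖z₁‖ + stageError N B ε q)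
        ≤ (1 + 1) * ((N : ℝ) ^ 4 + (N : ℝ) ^ 4) := by gcongr
      _ = 4 * (N : ℝ) ^ 4 := by ring
      _ < (N : ℝ) ^ 4 * (N : ℝ) ^ 4 := by
        have : (4 : ℝ) < (N : ℝ) ^ 4 := by
          calc (4 : ℝ) < 8 ^ 4 := by norm_num
            _ ≤ _ := by gcongr
        gcongr
      _ = _ := by ring
  · rw [hζ]
    have h16 : 2 / (N : ℝ) ^ 16 ≤ 1 / (N : ℝ) ^ 10 := by
      rw [div_le_div_iff₀ (by positivity) (by positivity),
        show (N : ℝ) ^ 16 = N ^ 6 * N ^ 10 by ring, one_mul]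
      have : (2 : ℝ) ≤ (N : ℝ) ^ 6 := by
        calc (2 : ℝ) ≤ 8 ^ 6 := by norm_num
          _ ≤ _ := by gcongr
      gcongr
    have h3 : 1 / (N : ℝ) ^ 10 * ‖z₁‖ ≤ 1 / (N : ℝ) ^ 10 * (2 ^ q * B) := by gcongr
    have h4 : stageError N B ε q * (1 / (N : ℝ) ^ 10) ≤ stageError N B ε q * 1 := by gcongr
    have h5 : 1 / (N : ℝ) ^ 10 * (2 ^ q * B) + 1 / (N : ℝ) ^ 10 ≤ stageError N B ε q := by
      have h1 : 1 ≤ (2 : ℝ) ^ q := one_le_pow₀ (by norm_num)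
      have h2 : (2 : ℝ) ^ q ≤ 4 ^ q := by gcongr; norm_num
      have hp : (0 : ℝ) < 1 / (N : ℝ) ^ 10 := by positivity
      unfold stageError
      calc 1 / (N : ℝ) ^ 10 * (2 ^ q * B) + 1 / (N : ℝ) ^ 10
          = 1 / (N : ℝ) ^ 10 * (2 ^ q * B + 1) := by ring
        _ ≤ 1 / (N : ℝ) ^ 10 * (2 ^ q * B + 2 ^ q * B) := by gcongr; nlinarith
        _ = 2 ^ q * (0 + 2 * B / (N : ℝ) ^ 10) := by ring
        _ ≤ 4 ^ q * (ε + 2 * B / (N : ℝ) ^ 10) := by gcongr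
    have h6 : stageError N B ε (q + 1) = 4 * stageError N B ε q := by
      unfold stageError; ring
    rw [h6]
    linarith

/-- The error of a product of transforms. -/
theorem Cell.product {N x₁ x₂ y₁ y₂ L k : ℕ} (hN : 8 ≤ N) (hL : L ≤ N) (hk : k ≤ 2) {z₀ z₁ : ℂ}
    (hx : Cell N x₁ x₂ z₀ (5 * k / (N : ℝ) ^ (9 - k))) (hz₀ : ‖z₀‖ ≤ (L : ℝ) ^ k)
    (hy : Cell N y₁ y₂ z₁ (2 / (N : ℝ) ^ 8)) (hz₁ : ‖z₁‖ ≤ L) :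
    Cell N (mulAddRe N 0 x₁ x₂ y₁ y₂) (mulAddIm N 0 x₁ x₂ y₁ y₂) (z₀ * z₁)
      (5 * (k + 1 : ℕ) / (N : ℝ) ^ (9 - (k + 1))) := by
  have hN' : (8 : ℝ) ≤ N := by exact_mod_cast hN
  have hL' : (L : ℝ) ≤ N := by exact_mod_cast hL
  have hzN : ‖z₀‖ ≤ (N : ℝ) ^ k := hz₀.trans (by gcongr)
  have hz1N : ‖z₁‖ ≤ N := hz₁.trans hL'
  have h0 : Cell N 0 0 (0 : ℂ) 0 := ⟨0, 0, by simp, by simp, by simp [Complex.ext_iff]⟩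
  have hk1 : (1 : ℝ) ≤ (N : ℝ) ^ k := one_le_pow₀ (by linarith)
  have hkN : (N : ℝ) ^ k ≤ (N : ℝ) ^ 2 := pow_le_pow_right₀ (by linarith) hk
  have hk2 : (k : ℝ) ≤ 2 := by exact_mod_cast hk
  have hd : 5 * (k : ℝ) / (N : ℝ) ^ (9 - k) ≤ 1 := by
    rw [div_le_one (by positivity)]
    calc 5 * (k : ℝ) ≤ 8 ^ 7 := by linarith
      _ ≤ (N : ℝ) ^ 7 := by gcongr
      _ ≤ _ := pow_le_pow_right₀ (by linarith) (by omega)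
  have hd8 : 2 / (N : ℝ) ^ 8 ≤ 1 := by
    rw [div_le_one (by positivity)]
    calc (2 : ℝ) ≤ 8 ^ 8 := by norm_num
      _ ≤ _ := by gcongr
  have hmain := Cell.mulAdd (by omega) h0 hx hy (by
    calc (‖z₀‖ + 5 * (k : ℝ) / (N : ℝ) ^ (9 - k)) * (‖z₁‖ + 2 / (N : ℝ) ^ 8)
        ≤ ((N : ℝ) ^ 2 + 1) * (N + 1) := by
          gcongr; exact hzN.trans hkN
      _ < (N : ℝ) ^ 2 * N * ((N : ℝ) ^ 2 * N) := by
          have : (8 : ℝ) ^ 2 ≤ (N : ℝ) ^ 2 := by gcongr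
          gcongr <;> nlinarith
      _ ≤ (N : ℝ) ^ 8 := by
          rw [show (N : ℝ) ^ 2 * N * ((N : ℝ) ^ 2 * N) = (N : ℝ) ^ 6 by ring]
          exact pow_le_pow_right₀ (by linarith) (by norm_num))
  rw [zero_add] at hmain
  refine hmain.mono ?_
  have hp : (0 : ℝ) < (N : ℝ) ^ 8 := by positivity
  have e9 : (N : ℝ) ^ (9 - k) * (N : ℝ) ^ k = (N : ℝ) ^ 8 * N := by
    rw [← pow_add, show 9 - k + k = 9 by omega]; ring
  have e8 : (N : ℝ) ^ (9 - (k + 1)) * (N : ℝ) ^ k = (N : ℝ) ^ 8 := by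
    rw [← pow_add, show 9 - (k + 1) + k = 8 by omega]
  have f9 : 5 * (k : ℝ) / (N : ℝ) ^ (9 - k) * N = 5 * k * (N : ℝ) ^ k / (N : ℝ) ^ 8 := by
    rw [div_mul_eq_mul_div, div_eq_div_iff (by positivity) (by positivity),
      mul_assoc _ ((N : ℝ) ^ k), mul_comm ((N : ℝ) ^ k), e9]
    ring
  have f8 : 5 * ((k + 1 : ℕ) : ℝ) / (N : ℝ) ^ (9 - (k + 1)) =
      5 * (k + 1) * (N : ℝ) ^ k / (N : ℝ) ^ 8 := by
    rw [div_eq_div_iff (by positivity) (by positivity), ← e8]; push_cast; ring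
  have g1 : (‖z₀‖ + 5 * (k : ℝ) / (N : ℝ) ^ (9 - k)) * (2 / (N : ℝ) ^ 8) ≤
      ((N : ℝ) ^ k + (N : ℝ) ^ k) * (2 / (N : ℝ) ^ 8) := by
    gcongr; linarith
  have g2 : 5 * (k : ℝ) / (N : ℝ) ^ (9 - k) * ‖z₁‖ ≤ 5 * k / (N : ℝ) ^ (9 - k) * N := by gcongr
  have g3 : 2 / (N : ℝ) ^ 16 ≤ (N : ℝ) ^ k / (N : ℝ) ^ 8 := by
    rw [div_le_div_iff₀ (by positivity) (by positivity)]
    calc 2 * (N : ℝ) ^ 8 ≤ (N : ℝ) ^ 8 * (N : ℝ) ^ 8 := by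
          have : (2 : ℝ) ≤ (N : ℝ) ^ 8 := by
            calc (2 : ℝ) ≤ 8 ^ 8 := by norm_num
              _ ≤ _ := by gcongr
          gcongr
      _ = 1 * (N : ℝ) ^ 16 := by ring
      _ ≤ _ := by gcongr
  rw [f9] at g2
  rw [f8]
  -- In units of `N ^ k / N ^ 8` the contributions are 4 from the error of the new factor, `5 * k`
  -- from the old product, and 1 from rounding.
  have : 5 * ((k : ℝ) + 1) * (N : ℝ) ^ k / (N : ℝ) ^ 8 =
      ((N : ℝ) ^ k + (N : ℝ) ^ k) * (2 / (N : ℝ) ^ 8) + 5 * k * (N : ℝ) ^ k / (N : ℝ) ^ 8 +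
      (N : ℝ) ^ k / (N : ℝ) ^ 8 := by ring
  rw [this, zero_add]
  linarith

theorem stageError_forward {N L q : ℕ} (hN : 8 ≤ N) (hL : 2 ^ q = L) (hLN : L ≤ N) :
    stageError N 1 0 q ≤ 2 / (N : ℝ) ^ 8 := by
  refine (stageError_le hN le_rfl le_rfl (hL ▸ hLN)).trans (le_of_eq ?_)
  have : (N : ℝ) ≠ 0 := by exact_mod_cast (by omega : N ≠ 0)
  field_simp
  ring

/-- The input is a product of three transforms, of size at most `N ^ 3` and with error `15 / N ^ 6`.
The resulting `(15 * N + 2) / N ^ 5` is below the rounding tolerance 1/4 once `N ≥ 8`. -/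
theorem stageError_backward {N q : ℕ} (hN : 8 ≤ N) (hLN : 2 ^ q ≤ N) :
    stageError N ((N : ℝ) ^ 3) (5 * (3 : ℕ) / (N : ℝ) ^ (9 - 3)) q ≤ 1 / 4 := by
  have hN' : (8 : ℝ) ≤ N := by exact_mod_cast hN
  refine (stageError_le hN (one_le_pow₀ (by linarith)) (by positivity) hLN).trans ?_
  have h1 : (0 : ℝ) < N := by linarith
  have : (N : ℝ) ^ 2 * (5 * (3 : ℕ) / (N : ℝ) ^ (9 - 3) + 2 * (N : ℝ) ^ 3 / (N : ℝ) ^ 10) =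
      (15 * N + 2) / (N : ℝ) ^ 5 := by
    norm_num; field_simp
  rw [this, div_le_div_iff₀ (by positivity) (by norm_num)]
  have : (8 : ℝ) ^ 4 ≤ (N : ℝ) ^ 4 := by gcongr
  nlinarith

/-! ### Approximate roots of unity -/

theorem abs_sqrt_sub_le {x y m : ℝ} (hx : 0 ≤ x) (hy : 0 ≤ y) (hm : 0 < m) (h : m ≤ √y) :
    |√x - √y| ≤ |x - y| / m := by
  rw [le_div_iff₀ hm]
  have e : x - y = (√x - √y) * (√x + √y) := by
    have h1 := Real.mul_self_sqrt hx
    have h2 := Real.mul_self_sqrt hy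
    linear_combination h2 - h1
  rw [e, abs_mul, abs_of_nonneg (by positivity : 0 ≤ √x + √y)]
  have := Real.sqrt_nonneg x
  gcongr
  linarith

theorem abs_natSqrt_div_sub_le {A Q s : ℕ} (hQ : 0 < Q) {x : ℝ}
    (h1 : (A : ℝ) ≤ Q ^ 2 * x) (h2 : (Q : ℝ) ^ 2 * x < A + 1) (hs : s * s ≤ A)
    (hs' : A < (s + 1) * (s + 1)) : |(s : ℝ) / Q - √x| ≤ 1 / Q := by
  have hQ' : (0 : ℝ) < Q := by exact_mod_cast hQ
  have e : √x = √(Q ^ 2 * x) / Q := by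
    rw [Real.sqrt_mul (by positivity), Real.sqrt_sq hQ'.le]; field_simp
  have hs1 : ((s : ℝ)) ^ 2 ≤ Q ^ 2 * x := by
    refine le_trans ?_ h1; rw [pow_two]; exact_mod_cast hs
  have hs2 : (Q : ℝ) ^ 2 * x ≤ (s + 1 : ℝ) ^ 2 := by
    refine h2.le.trans ?_; rw [pow_two]; exact_mod_cast hs'
  have g1 : (s : ℝ) ≤ √(Q ^ 2 * x) := Real.le_sqrt_of_sq_le hs1
  have g2 : √(Q ^ 2 * x) ≤ s + 1 := (Real.sqrt_le_left (by positivity)).2 hs2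
  rw [e, ← sub_div, abs_div, abs_of_pos hQ']
  gcongr
  rw [abs_le]
  constructor <;> linarith

/-- Halving the angle of an approximate cosine. -/
theorem cos_half_approx {Q c s : ℕ} (hQ : 0 < Q) {θ : ℝ} (hθ0 : 0 ≤ θ) (hθ : θ ≤ Real.pi / 2)
    (hc : c ≤ Q) (h : |(c : ℝ) / Q - Real.cos θ| ≤ 8 / Q) (hs : s * s ≤ (Q * Q + Q * c) / 2)
    (hs' : (Q * Q + Q * c) / 2 < (s + 1) * (s + 1)) :
    s ≤ Q ∧ |(s : ℝ) / Q - Real.cos (θ / 2)| ≤ 8 / Q := by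
  have hQ' : (0 : ℝ) < Q := by exact_mod_cast hQ
  constructor
  · have : Q * c ≤ Q * Q := Nat.mul_le_mul_left Q hc
    have h2 : s * s ≤ Q * Q := by omega
    exact Nat.mul_self_le_mul_self_iff.1 h2
  · have hcos : 0 ≤ Real.cos θ := Real.cos_nonneg_of_neg_pi_div_two_le_of_le (by linarith) hθ
    have hcos2 : Real.cos (θ / 2) = √((1 + Real.cos θ) / 2) :=
      Real.cos_half (by linarith [Real.pi_pos]) (by linarith [Real.pi_pos])
    set x : ℝ := (1 + c / Q) / 2 with hx
    have hx0 : 0 ≤ x := by positivity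
    have hQx : (Q : ℝ) ^ 2 * x = (Q * Q + Q * c : ℕ) / 2 := by
      rw [hx]; push_cast; field_simp
    have hd := Nat.div_add_mod (Q * Q + Q * c) 2
    have hmd := Nat.mod_lt (Q * Q + Q * c) (show 0 < 2 by norm_num)
    generalize hAB : Q * Q + Q * c = A at *
    have e1 : (A : ℝ) = 2 * (A / 2 : ℕ) + (A % 2 : ℕ) := by exact_mod_cast hd.symm
    have e2 : ((A % 2 : ℕ) : ℝ) < 2 := by exact_mod_cast hmd
    have e3 : (0 : ℝ) ≤ (A % 2 : ℕ) := by positivity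
    have h1 := abs_natSqrt_div_sub_le hQ (by rw [hQx]; linarith) (by rw [hQx]; linarith) hs hs'
    -- As `cos θ ≥ 0`, the new cosine is at least `√(1/2) > 2/3`. In units of `1 / Q` an error 8 is
    -- halved to 4, grows to 6 under the square root, and integer rounding adds 1. The bound 8
    -- therefore reproduces itself in every halving.
    have hm : (2 / 3 : ℝ) ≤ √((1 + Real.cos θ) / 2) := by
      apply Real.le_sqrt_of_sq_le; linarith
    have h2 := abs_sqrt_sub_le hx0 (by linarith : (0 : ℝ) ≤ (1 + Real.cos θ) / 2) (by norm_num) hm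
    have h3 : |x - (1 + Real.cos θ) / 2| ≤ 4 / Q := by
      rw [show x - (1 + Real.cos θ) / 2 = ((c : ℝ) / Q - Real.cos θ) / 2 by rw [hx]; ring, abs_div,
        abs_of_pos (by norm_num : (0 : ℝ) < 2)]
      rw [show (4 : ℝ) / Q = 8 / Q / 2 by ring]
      gcongr
    rw [hcos2]
    have h4 := abs_sub_le ((s : ℝ) / Q) (√x) (√((1 + Real.cos θ) / 2))
    have h5 : |x - (1 + Real.cos θ) / 2| / (2 / 3) ≤ 4 / Q / (2 / 3) := by gcongr
    have h6 : (4 : ℝ) / Q / (2 / 3) = 6 / Q := by ring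
    have h7 : (8 : ℝ) / Q = 1 / Q + 6 / Q + 1 / Q := by ring
    have h8 : (0 : ℝ) ≤ 1 / Q := by positivity
    linarith

/-- The square root is ill-conditioned near 0, but Jordan's inequality gives `sin (2π/N) ≥ 4 / N`.
So the error of the cosine is magnified only by a factor of order `N`. -/
theorem sin_approx {N Q c s : ℕ} (hN : 4 ≤ N) (hQ : 0 < Q) (hc : c ≤ Q)
    (h : |(c : ℝ) / Q - Real.cos (2 * Real.pi / N)| ≤ 8 / Q) (hs : s * s ≤ Q * Q - c * c)
    (hs' : Q * Q - c * c < (s + 1) * (s + 1)) :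
    s ≤ Q ∧ |(s : ℝ) / Q - Real.sin (2 * Real.pi / N)| ≤ (1 + 4 * N) / Q := by
  have hQ' : (0 : ℝ) < Q := by exact_mod_cast hQ
  have hN' : (4 : ℝ) ≤ N := by exact_mod_cast hN
  have hpi := Real.pi_pos
  constructor
  · exact Nat.mul_self_le_mul_self_iff.1 (hs.trans (Nat.sub_le _ _))
  · set θ := 2 * Real.pi / N with hθ
    have hθ0 : 0 ≤ θ := by positivity
    have hθ2 : θ ≤ Real.pi / 2 := by
      rw [hθ, div_le_div_iff₀ (by linarith) (by norm_num)]; nlinarith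
    have hsin : 4 / (N : ℝ) ≤ Real.sin θ := by
      have := Real.mul_le_sin hθ0 hθ2
      refine le_trans (le_of_eq ?_) this
      rw [hθ]; field_simp; norm_num
    have hcQ : (c : ℝ) / Q ≤ 1 := by rw [div_le_one hQ']; exact_mod_cast hc
    have hc0 : 0 ≤ (c : ℝ) / Q := by positivity
    set x : ℝ := 1 - (c / Q) ^ 2 with hx
    have hx0 : 0 ≤ x := by rw [hx]; nlinarith
    have hcc : c * c ≤ Q * Q := Nat.mul_le_mul hc hc
    have hQx : (Q : ℝ) ^ 2 * x = (Q * Q - c * c : ℕ) := by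
      rw [hx, Nat.cast_sub hcc]; push_cast; field_simp
    have h1 := abs_natSqrt_div_sub_le hQ hQx.ge (by rw [hQx]; linarith) hs hs'
    have hcos : Real.cos θ ≤ 1 := Real.cos_le_one θ
    have hcos0 : 0 ≤ Real.cos θ := Real.cos_nonneg_of_neg_pi_div_two_le_of_le (by linarith) hθ2
    have hsc := Real.sin_sq_add_cos_sq θ
    have hsp : 0 < 4 / (N : ℝ) := by positivity
    have hsq : √(1 - Real.cos θ ^ 2) = Real.sin θ := by
      rw [show 1 - Real.cos θ ^ 2 = Real.sin θ ^ 2 by linarith, Real.sqrt_sq (by linarith)]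
    have h2 := abs_sqrt_sub_le hx0 (by nlinarith : (0 : ℝ) ≤ 1 - Real.cos θ ^ 2) hsp
      (by rw [hsq]; exact hsin)
    rw [hsq] at h2
    have h3 : |x - (1 - Real.cos θ ^ 2)| ≤ (8 : ℝ) / Q * 2 := by
      rw [show x - (1 - Real.cos θ ^ 2) = -(((c : ℝ) / Q - Real.cos θ) * (c / Q + Real.cos θ)) by
        rw [hx]; ring, abs_neg, abs_mul, abs_of_nonneg (by positivity : 0 ≤ (c : ℝ) / Q + Real.cos θ)]
      gcongr
      linarith
    have h4 := abs_sub_le ((s : ℝ) / Q) (√x) (Real.sin θ)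
    have h5 : |x - (1 - Real.cos θ ^ 2)| / (4 / N) ≤ (8 : ℝ) / Q * 2 / (4 / N) := by gcongr
    have h6 : (8 : ℝ) / Q * 2 / (4 / N) = 4 * N / Q := by field_simp; norm_num
    rw [add_div]
    linarith

/-- The primitive `N`-th root of unity used by the transform. -/
noncomputable def root (N : ℕ) : ℂ := Complex.exp (2 * Real.pi * Complex.I / N)

theorem isPrimitiveRoot_root {N : ℕ} (hN : N ≠ 0) : IsPrimitiveRoot (root N) N :=
  Complex.isPrimitiveRoot_exp N hN

theorem norm_root {N : ℕ} (hN : N ≠ 0) : ‖root N‖ = 1 := (isPrimitiveRoot_root hN).norm'_eq_one hN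

theorem root_eq (N : ℕ) :
    root N = ⟨Real.cos (2 * Real.pi / N), Real.sin (2 * Real.pi / N)⟩ := by
  rw [root, show (2 * Real.pi * Complex.I / N : ℂ) = ((2 * Real.pi / N : ℝ) : ℂ) * Complex.I by
    push_cast; ring, Complex.exp_mul_I, ← Complex.ofReal_cos, ← Complex.ofReal_sin]
  apply Complex.ext <;>
    simp only [Complex.add_re, Complex.add_im, Complex.mul_re, Complex.mul_im, Complex.ofReal_re,
      Complex.ofReal_im, Complex.I_re, Complex.I_im] <;> ring

theorem cell_root {N c s : ℕ} (hN : 8 ≤ N) (hc : c ≤ N ^ 16) (hs : s ≤ N ^ 16)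
    (hcos : |(c : ℝ) / (N ^ 16 : ℕ) - Real.cos (2 * Real.pi / N)| ≤ 8 / (N ^ 16 : ℕ))
    (hsin : |(s : ℝ) / (N ^ 16 : ℕ) - Real.sin (2 * Real.pi / N)| ≤ (1 + 4 * N) / (N ^ 16 : ℕ)) :
    Cell N c s (root N) (1 / (N : ℝ) ^ 12) := by
  have hN' : (8 : ℝ) ≤ N := by exact_mod_cast hN
  have hlt : N ^ 16 < 2 * N ^ 40 := by
    have : N ^ 16 ≤ N ^ 40 := Nat.pow_le_pow_right (by omega) (by norm_num)
    have : 0 < N ^ 40 := Nat.pow_pos (by omega)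
    omega
  refine Cell.of_nat (by omega) (by omega) ?_
  rw [root_eq]
  refine (Complex.norm_le_abs_re_add_abs_im _).trans ?_
  simp only [Complex.sub_re, Complex.sub_im]
  push_cast at hcos hsin
  refine (add_le_add hcos hsin).trans ?_
  rw [← add_div, div_le_div_iff₀ (by positivity) (by positivity),
    show (1 : ℝ) * N ^ 16 = N ^ 4 * N ^ 12 by ring]
  gcongr
  have : (8 : ℝ) ^ 3 ≤ (N : ℝ) ^ 3 := by gcongr
  nlinarith

/-- Powers of the root, by repeated multiplication. -/
theorem Cell.powStep {N w₁ w₂ g₁ g₂ e : ℕ} (hN : 8 ≤ N) (he : e < N)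
    (hg : Cell N g₁ g₂ (root N) (1 / (N : ℝ) ^ 12))
    (hw : Cell N w₁ w₂ (root N ^ e) (3 * e / (N : ℝ) ^ 12)) :
    Cell N (mulAddRe N 0 g₁ g₂ w₁ w₂) (mulAddIm N 0 g₁ g₂ w₁ w₂) (root N ^ (e + 1))
      (3 * (e + 1 : ℕ) / (N : ℝ) ^ 12) := by
  have hN' : (8 : ℝ) ≤ N := by exact_mod_cast hN
  have he' : (e : ℝ) ≤ N := by exact_mod_cast he.le
  have h0 : Cell N 0 0 (0 : ℂ) 0 := ⟨0, 0, by simp, by simp, by simp [Complex.ext_iff]⟩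
  have h1 : ‖root N ^ e‖ = 1 := by rw [norm_pow, norm_root (by omega), one_pow]
  have h2 : 3 * (e : ℝ) / (N : ℝ) ^ 12 ≤ 1 := by
    rw [div_le_one (by positivity), show (N : ℝ) ^ 12 = N ^ 11 * N by ring]
    have : (3 : ℝ) ≤ N ^ 11 := by
      calc (3 : ℝ) ≤ 8 ^ 11 := by norm_num
        _ ≤ _ := by gcongr
    gcongr
  have h3 : 1 / (N : ℝ) ^ 12 ≤ 1 := by
    rw [div_le_one (by positivity)]; exact one_le_pow₀ (by linarith)
  have hb := Cell.mulAdd (by omega) h0 hg hw (by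
    rw [h1, norm_root (by omega)]
    calc (1 + 1 / (N : ℝ) ^ 12) * (1 + 3 * e / (N : ℝ) ^ 12) ≤ (1 + 1) * (1 + 1) := by gcongr
      _ < 8 ^ 8 := by norm_num
      _ ≤ _ := by gcongr)
  rw [zero_add, ← pow_succ'] at hb
  refine hb.mono ?_
  rw [h1, norm_root (by omega)]
  have h4 : 2 / (N : ℝ) ^ 16 ≤ 1 / (N : ℝ) ^ 12 := by
    rw [div_le_div_iff₀ (by positivity) (by positivity), show (1 : ℝ) * N ^ 16 = N ^ 4 * N ^ 12 by ring]
    have : (2 : ℝ) ≤ N ^ 4 := by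
      calc (2 : ℝ) ≤ 8 ^ 4 := by norm_num
        _ ≤ _ := by gcongr
    gcongr
  have h5 : 1 / (N : ℝ) ^ 12 * (3 * e / (N : ℝ) ^ 12) ≤ 1 / (N : ℝ) ^ 12 * 1 := by gcongr
  have e1 : 3 * ((e + 1 : ℕ) : ℝ) / (N : ℝ) ^ 12 = 3 * e / (N : ℝ) ^ 12 + 3 * (1 / (N : ℝ) ^ 12) := by
    push_cast; ring
  rw [e1]
  linarith

theorem powError_le {N e : ℕ} (hN : 8 ≤ N) (he : e < N) :
    3 * (e : ℝ) / (N : ℝ) ^ 12 ≤ 1 / (N : ℝ) ^ 10 := by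
  have hN' : (8 : ℝ) ≤ N := by exact_mod_cast hN
  have he' : (e : ℝ) ≤ N := by exact_mod_cast he.le
  rw [div_le_div_iff₀ (by positivity) (by positivity), show (1 : ℝ) * N ^ 12 = N * N * N ^ 10 by ring]
  gcongr
  linarith

/-! ### The fast Fourier transform on the word RAM

Registers: `4`, `5`, `6`, `7` hold `N`, `N ^ 16`, `N ^ 40`, `2 * N ^ 40`, registers `12` to `15` the
addresses of the table of roots, of two buffers and of the product; `33` holds the length `L` and
`34` the quotient `N / L`. -/

namespace Expr

def scaleDown (p : Expr) : Expr :=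
  (p + var 6) % var 7 / var 5 + (var 7 - var 6 / var 5)

def mulAddRe (x wr wi yr yi : Expr) : Expr :=
  (x + scaleDown (wr * yr + (var 7 - wi) * yi)) % var 7

def mulAddIm (x wr wi yr yi : Expr) : Expr :=
  (x + scaleDown (wr * yi + wi * yr)) % var 7

end Expr

/-- The registers with the constants of the fixed-point arithmetic. -/
structure Consts (N : ℕ) (σ : State) : Prop where
  reg4 : σ.reg 4 = N
  reg5 : σ.reg 5 = N ^ 16
  reg6 : σ.reg 6 = N ^ 40
  reg7 : σ.reg 7 = 2 * N ^ 40

theorem Consts.congr {N : ℕ} {σ σ' : State} (h : Consts N σ) (hr : ∀ k < 24, σ'.reg k = σ.reg k) :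
    Consts N σ' :=
  ⟨by rw [hr 4 (by norm_num), h.reg4], by rw [hr 5 (by norm_num), h.reg5],
    by rw [hr 6 (by norm_num), h.reg6], by rw [hr 7 (by norm_num), h.reg7]⟩

/-- The memory holds an approximation of the array `z` of length `L` from address `p` on. -/
def ArrayAt (N : ℕ) (m : ℕ → ℕ) (p L : ℕ) (z : ℕ → ℂ) (ε : ℝ) : Prop :=
  ∀ i < L, Cell N (m (p + 2 * i)) (m (p + 2 * i + 1)) (z i) ε

theorem ArrayAt.congr {N : ℕ} {m m' : ℕ → ℕ} {p L : ℕ} {z : ℕ → ℂ} {ε : ℝ}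
    (h : ArrayAt N m p L z ε) (hm : ∀ k, p ≤ k → k < p + 2 * L → m' k = m k) :
    ArrayAt N m' p L z ε := fun i hi => by
  rw [hm _ (by omega) (by omega), hm _ (by omega) (by omega)]; exact h i hi

/-- Writing one more entry of an array. -/
theorem ArrayAt.update {N : ℕ} {m : ℕ → ℕ} {p i u v : ℕ} {z : ℕ → ℂ} {ε : ℝ}
    (h : ArrayAt N m p i z ε) (hc : Cell N u v (z i) ε) :
    ArrayAt N (Function.update (Function.update m (p + 2 * i) u) (p + 2 * i + 1) v) p (i + 1) z ε := by
  intro j hj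
  rcases Nat.lt_succ_iff_lt_or_eq.1 hj with hj | rfl
  · rw [Function.update_of_ne (by omega), Function.update_of_ne (by omega),
      Function.update_of_ne (by omega), Function.update_of_ne (by omega)]
    exact h j hj
  · rw [Function.update_of_ne (by omega : p + 2 * j ≠ p + 2 * j + 1), Function.update_self,
      Function.update_self]
    exact hc

/-- The setting in which transforms are computed. -/
structure FftEnv (V N W A : ℕ) (σ : State) : Prop extends Consts N σ where
  hN : 8 ≤ N
  hV : 2 * N ^ 40 < V
  hA : A + 6 * N < V
  hWA : W + 2 * N ≤ A
  reg12 : σ.reg 12 = W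
  reg13 : σ.reg 13 = A
  reg14 : σ.reg 14 = A + 2 * N
  reg15 : σ.reg 15 = A + 4 * N
  table : ArrayAt N σ.mem W N (fun e => root N ^ e) (1 / (N : ℝ) ^ 10)

theorem FftEnv.congr {V N W A : ℕ} {σ σ' : State} (h : FftEnv V N W A σ)
    (hr : ∀ k < 24, σ'.reg k = σ.reg k) (hm : ∀ p, W ≤ p → p < A → σ'.mem p = σ.mem p) :
    FftEnv V N W A σ' where
  toConsts := h.toConsts.congr hr
  hN := h.hN
  hV := h.hV
  hA := h.hA
  hWA := h.hWA
  reg12 := by rw [hr 12 (by norm_num), h.reg12]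
  reg13 := by rw [hr 13 (by norm_num), h.reg13]
  reg14 := by rw [hr 14 (by norm_num), h.reg14]
  reg15 := by rw [hr 15 (by norm_num), h.reg15]
  table := h.table.congr fun k h1 h2 => hm k h1 (by have := h.hWA; omega)

theorem FftEnv.le_pow {V N W A : ℕ} {σ : State} (h : FftEnv V N W A σ) : 100 * N ≤ N ^ 40 := by
  have h1 : 8 ^ 39 ≤ N ^ 39 := Nat.pow_le_pow_left h.hN 39
  rw [pow_succ N 39]
  exact Nat.mul_le_mul_right N (le_trans (by norm_num) h1)

/-- One butterfly; `42` holds the number `r` of partial transforms, `43` the index. -/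
def butterflyBlock : List Cmd :=
  [.set 44 (.var 43 % .var 42),
   .set 45 (.var 43 - .var 44),
   .set 46 (.var 40 + 2 * ((.var 45 + .var 43) % .var 33)),
   .set 47 (.var 46 + 2 * .var 42),
   .set 48 (.var 12 + 2 * (.var 45 * .var 34)),
   .set 49 (.mulAddRe (.read (.var 46)) (.read (.var 48)) (.read (.var 48 + 1)) (.read (.var 47))
     (.read (.var 47 + 1))),
   .set 50 (.mulAddIm (.read (.var 46 + 1)) (.read (.var 48)) (.read (.var 48 + 1)) (.read (.var 47))
     (.read (.var 47 + 1))),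
   .put (.var 41 + 2 * .var 43) (.var 49),
   .put (.var 41 + 2 * .var 43 + 1) (.var 50),
   .set 43 (.var 43 + 1)]

def stageLoop : Program :=
  .seq (block [.set 43 0]) (whileLoop (.var 33 - .var 43) (block butterflyBlock))

theorem runs_butterfly {V N W A : ℕ} {σ : State} (h : FftEnv V N W A σ) {X Y L r i str : ℕ}
    (hX : σ.reg 40 = X) (hY : σ.reg 41 = Y) (hr : σ.reg 42 = r) (hi : σ.reg 43 = i)
    (hL : σ.reg 33 = L) (hs : σ.reg 34 = str) (hiL : i < L) (hLN : L ≤ N)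
    (hXA : X ≤ A + 2 * N) (hr0 : r ≤ N) (hstr : (i - i % r) * str < N)
    (Q : State → Prop)
    (hQ : ∀ σ' : State, (∀ k < 43, σ'.reg k = σ.reg k) → σ'.reg 43 = i + 1 →
      σ'.mem = Function.update (Function.update σ.mem (Y + 2 * i)
        (mulAddRe N (σ.mem (X + 2 * ((i - i % r + i) % L)))
          (σ.mem (W + 2 * ((i - i % r) * str))) (σ.mem (W + 2 * ((i - i % r) * str) + 1))
          (σ.mem (X + 2 * ((i - i % r + i) % L) + 2 * r))
          (σ.mem (X + 2 * ((i - i % r + i) % L) + 2 * r + 1)))) (Y + 2 * i + 1)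
        (mulAddIm N (σ.mem (X + 2 * ((i - i % r + i) % L) + 1))
          (σ.mem (W + 2 * ((i - i % r) * str))) (σ.mem (W + 2 * ((i - i % r) * str) + 1))
          (σ.mem (X + 2 * ((i - i % r + i) % L) + 2 * r))
          (σ.mem (X + 2 * ((i - i % r + i) % L) + 2 * r + 1))) → Q σ') :
    Runs V (block butterflyBlock) σ 1000 Q := by
  have hN := h.hN
  have hV := h.hV
  have hA := h.hA
  have hWA := h.hWA
  have hP := h.le_pow
  have hmod : (i - i % r + i) % L < L := Nat.mod_lt _ (by omega)
  have hmr : i % r ≤ i := Nat.mod_le i r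
  refine runs_block (by decide) (by decide) ?_ (hQ _ ?_ ?_ ?_)
  · simp only [butterflyBlock, blockOk, Cmd.value, Cmd.run]
    simp [h.reg12, hX, hY, hr, hi, hL, hs, Expr.mulAddRe, Expr.scaleDown, Expr.mulAddIm, h.reg5, h.reg6, h.reg7]
    have h40 : 0 < 2 * N ^ 40 := by omega
    exact ⟨by omega, by omega, by omega, by omega, by omega, (Nat.mod_lt _ h40).trans hV,
      (Nat.mod_lt _ h40).trans hV, (Nat.mod_lt _ h40).trans hV, (Nat.mod_lt _ h40).trans hV,
      by omega⟩
  · exact fun k hk => reg_runBlock (by decide) σ hk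
  · simp [butterflyBlock, runBlock, Cmd.run, hi]
  · simp only [butterflyBlock, runBlock, Cmd.run]
    simp [h.reg12, hX, hY, hr, hi, hL, hs, Expr.mulAddRe, Expr.scaleDown, Expr.mulAddIm, h.reg5, h.reg6, h.reg7, mulAddRe, mulAddIm, scaleDown]

/-- The stage reads buffer `X` and writes buffer `Y`, so its inputs survive until the end. A
transform of length `L = N / str` uses the table of `N`-th roots with stride `str`. -/
theorem runs_stageLoop {V N W A : ℕ} {σ : State} (h : FftEnv V N W A σ) {X Y l r q str : ℕ}
    (hX : σ.reg 40 = X) (hY : σ.reg 41 = Y) (hr : σ.reg 42 = r) (hL : σ.reg 33 = 2 * l * r)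
    (hs : σ.reg 34 = str) (hNL : 2 * l * r * str = N) (hr0 : 0 < r) (hl : l = 2 ^ q)
    (hXY : X = A ∧ Y = A + 2 * N ∨ X = A + 2 * N ∧ Y = A) {x : ℕ → ℂ} {B ε : ℝ}
    (hB : 1 ≤ B) (hBN : B ≤ (N : ℝ) ^ 3) (hε : 0 ≤ ε) (hε1 : ε ≤ 1)
    (hx : ∀ i < 2 * l * r, ‖x i‖ ≤ B)
    (hz : ArrayAt N σ.mem X (2 * l * r) (partialDFT (root N ^ str) x l (2 * r))
      (stageError N B ε q)) :
    Runs V stageLoop σ (2000 * (2 * l * r) + 2000) (fun σ' =>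
      (∀ k < 43, σ'.reg k = σ.reg k) ∧ (∀ p, p < A ∨ A + 4 * N ≤ p → σ'.mem p = σ.mem p) ∧
      ArrayAt N σ'.mem Y (2 * l * r) (partialDFT (root N ^ str) x (2 * l) r)
        (stageError N B ε (q + 1))) := by
  have hN := h.hN
  have hV := h.hV
  have hA := h.hA
  have hWA := h.hWA
  have hP := h.le_pow
  set L := 2 * l * r with hLdef
  have hstr0 : 0 < str := by
    rcases Nat.eq_zero_or_pos str with rfl | h
    · omega
    · exact h
  have hLN : L ≤ N := hNL ▸ Nat.le_mul_of_pos_right L hstr0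
  have hl0 : 0 < l := hl ▸ Nat.pow_pos (by norm_num)
  have hrL : r ≤ L := Nat.le_mul_of_pos_left r (by omega)
  have hlL : 2 * l ≤ L := Nat.le_mul_of_pos_right (2 * l) hr0
  have hω : ‖root N ^ str‖ = 1 := by rw [norm_pow, norm_root (by omega), one_pow]
  have hω1 : (root N ^ str) ^ L = 1 := by
    rw [← pow_mul, mul_comm, hNL, (isPrimitiveRoot_root (by omega)).pow_eq_one]
  let Inv : ℕ → State → Prop := fun i σ' => (∀ k < 43, σ'.reg k = σ.reg k) ∧ σ'.reg 43 = i ∧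
    (∀ p, p < Y ∨ Y + 2 * N ≤ p → σ'.mem p = σ.mem p) ∧
    ArrayAt N σ'.mem Y i (partialDFT (root N ^ str) x (2 * l) r) (stageError N B ε (q + 1))
  have hinit : Runs V (block [.set 43 0]) σ 10 (Inv 0) := by
    refine runs_block (by decide) (by decide) ?_ ⟨?_, ?_, ?_, ?_⟩
    · simp [blockOk, Cmd.value]; omega
    · exact fun k hk => reg_runBlock (by decide) σ hk
    · simp [runBlock, Cmd.run]
    · intro p _; rfl
    · intro i hi; omega
  refine (hinit.seq fun σ₀ _ h₀ => runs_whileLoop_const (by decide) Inv L 1000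
    (2000 * L + 1000) h₀ ?_ ?_ ?_ ?_).mono (by omega) fun _ _ h => h
  · intro i hi σ' _ hI
    obtain ⟨h1, h2, h3, h4⟩ := hI
    have hreg : ∀ k < 43, σ'.reg k = σ.reg k := h1
    refine ⟨by simp [h2, h1 33 (by norm_num), hL]; omega, ?_⟩
    have hXY2 : ∀ p, X ≤ p → p < X + 2 * N → p < Y ∨ Y + 2 * N ≤ p := by
      intro p _ _; omega
    have henv : FftEnv V N W A σ' := h.congr (fun k hk => h1 k (by omega))
      (fun p hp1 hp2 => h3 p (by omega))
    have hbi := butterfly_index hr0 hi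
    rw [← hLdef] at hbi
    have hmr : i % r ≤ i := Nat.mod_le i r
    have he : (i - i % r) * str < N := by
      calc (i - i % r) * str ≤ i * str := Nat.mul_le_mul_right _ (Nat.sub_le _ _)
        _ < L * str := Nat.mul_lt_mul_of_pos_right hi hstr0
        _ = N := hNL
    refine runs_butterfly henv (X := X) (Y := Y) (L := L) (r := r) (i := i) (str := str)
      (by rw [hreg 40 (by norm_num), hX]) (by rw [hreg 41 (by norm_num), hY])
      (by rw [hreg 42 (by norm_num), hr]) h2 (by rw [hreg 33 (by norm_num), hL])
      (by rw [hreg 34 (by norm_num), hs]) hi hLN (by omega) (by omega) he _ ?_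
    intro σ'' g1 g2 g3
    refine ⟨fun k hk => (g1 k hk).trans (h1 k hk), g2, ?_, ?_⟩
    · intro p hp
      rw [g3, Function.update_of_ne (by omega), Function.update_of_ne (by omega), h3 p hp]
    · rw [g3]
      refine h4.update ?_
      have hXarr : ArrayAt N σ'.mem X L (partialDFT (root N ^ str) x l (2 * r))
          (stageError N B ε q) := hz.congr fun p hp1 hp2 => h3 p (hXY2 p hp1 (by omega))
      rw [partialDFT_two_mul _ _ hr0 hi hω1]
      have c1 := hXarr ((i - i % r + i) % L) (by omega)
      have c2 := hXarr ((i - i % r + i) % L + r) hbi.1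
      rw [show X + 2 * ((i - i % r + i) % L + r) = X + 2 * ((i - i % r + i) % L) + 2 * r by ring]
        at c2
      have cw := henv.table ((i - i % r) * str) he
      have hpow : (fun e => root N ^ e) ((i - i % r) * str) = (root N ^ str) ^ (i - i % r) := by
        simp only [← pow_mul]; rw [mul_comm]
      rw [hpow] at cw
      refine Cell.butterfly hN (hl ▸ by omega) hB hBN hε hε1 c1 cw c2 (by rw [norm_pow, hω, one_pow]) ?_
      have := norm_partialDFT_le hω (x := x) (B := B) (l := l) (r := 2 * r)
        (i := (i - i % r + i) % L + r) (by omega) (fun i hi => hx i (by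
          rw [hLdef]; rw [show l * (2 * r) = 2 * l * r by ring] at hi; exact hi))
      rwa [show (l : ℝ) = 2 ^ q by rw [hl]; push_cast; rfl] at this
  · intro σ' _ hI
    simp [hI.2.1, hI.1 33 (by norm_num), hL]
  · have : (Expr.var 33 - Expr.var 43).cost = 5 := rfl
    rw [this]; ring_nf; omega
  · rintro σ' _ ⟨h1, h2, h3, h4⟩
    exact ⟨h1, fun p hp => h3 p (by omega), h4⟩

/-- The transform of the array in the first buffer; afterwards `40` holds the address of the
result. -/
def fft : Program :=
  .seq (block [.set 40 (.var 13), .set 41 (.var 14), .set 42 (.var 33 / 2)])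
    (whileLoop (.var 42) (.seq stageLoop
      (block [.set 44 (.var 40), .set 40 (.var 41), .set 41 (.var 44), .set 42 (.var 42 / 2)])))

theorem runs_fft {V N W A : ℕ} {σ : State} (h : FftEnv V N W A σ) {L k str : ℕ}
    (hL : σ.reg 33 = L) (hs : σ.reg 34 = str) (hNL : L * str = N) (hk : L = 2 ^ k) {x : ℕ → ℂ}
    {B ε : ℝ} (hB : 1 ≤ B) (hBN : B ≤ (N : ℝ) ^ 3) (hε : 0 ≤ ε) (hε1 : ε ≤ 1)
    (hx : ∀ i < L, ‖x i‖ ≤ B) (hz : ArrayAt N σ.mem A L x ε) :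
    Runs V fft σ (5000 * (L * (k + 1))) (fun σ' => (∀ k < 40, σ'.reg k = σ.reg k) ∧
      (∀ p, p < A ∨ A + 4 * N ≤ p → σ'.mem p = σ.mem p) ∧
      (σ'.reg 40 = A ∨ σ'.reg 40 = A + 2 * N) ∧
      ArrayAt N σ'.mem (σ'.reg 40) L (dft (root N ^ str) x L) (stageError N B ε k)) := by
  have hN := h.hN
  have hV := h.hV
  have hA := h.hA
  have hWA := h.hWA
  have hP := h.le_pow
  have hstr0 : 0 < str := by
    rcases Nat.eq_zero_or_pos str with rfl | h
    · omega
    · exact h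
  have hLN : L ≤ N := hNL ▸ Nat.le_mul_of_pos_right L hstr0
  have hL0 : 0 < L := hk ▸ Nat.pow_pos (by norm_num)
  let Inv : ℕ → State → Prop := fun q σ' => (∀ k < 40, σ'.reg k = σ.reg k) ∧
    (∀ p, p < A ∨ A + 4 * N ≤ p → σ'.mem p = σ.mem p) ∧
    (σ'.reg 40 = A ∧ σ'.reg 41 = A + 2 * N ∨ σ'.reg 40 = A + 2 * N ∧ σ'.reg 41 = A) ∧
    -- The register is one halving ahead: it holds the number of partial transforms after the coming
    -- stage. After the last stage it is `1 / 2 = 0`, which stops the loop.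
    σ'.reg 42 = 2 ^ (k - q) / 2 ∧
    ArrayAt N σ'.mem (σ'.reg 40) L (partialDFT (root N ^ str) x (2 ^ q) (2 ^ (k - q)))
      (stageError N B ε q)
  have hinit : Runs V (block [.set 40 (.var 13), .set 41 (.var 14), .set 42 (.var 33 / 2)]) σ 100
      (Inv 0) := by
    refine runs_block (by decide) (by decide) ?_ ⟨?_, ?_, ?_, ?_, ?_⟩
    · simp [blockOk, Cmd.value, Cmd.run, h.reg13, h.reg14, hL]; omega
    · exact fun k hk => reg_runBlock (by decide) σ hk
    · intro p _; rfl
    · simp [runBlock, Cmd.run, h.reg13, h.reg14]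
    · simp [runBlock, Cmd.run, hL, hk]
    · simp only [runBlock, Cmd.run]
      simp only [Expr.eval_var, h.reg13]
      intro i hi
      rw [pow_zero, Nat.sub_zero, ← hk, partialDFT_one _ _ hi]
      simp only [Function.update_apply]
      simpa [stageError] using (hz i hi).mono (le_add_of_nonneg_right (by positivity))
  refine (hinit.seq fun σ₀ _ h₀ => runs_whileLoop_const (by decide) Inv k (2000 * L + 2100)
    (k * (5000 * L) + 100) h₀ ?_ ?_ ?_ ?_).mono ?_ fun _ _ h => h
  · intro q hq σ₁ _ hI
    obtain ⟨h1, h2, h3, h4, h5⟩ := hI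
    have hpow : 2 ^ (k - q) = 2 * 2 ^ (k - (q + 1)) := by
      rw [← pow_succ']; congr 1; omega
    have h4' : σ₁.reg 42 = 2 ^ (k - (q + 1)) := by rw [h4, hpow]; simp
    have hr0 : 0 < 2 ^ (k - (q + 1)) := Nat.pow_pos (by norm_num)
    have hLe : L = 2 * 2 ^ q * 2 ^ (k - (q + 1)) := by
      rw [hk, ← pow_succ', ← pow_add]; congr 1; omega
    refine ⟨by simp [h4'], ?_⟩
    have henv : FftEnv V N W A σ₁ := h.congr (fun k hk => h1 k (by omega))
      (fun p hp1 hp2 => h2 p (by omega))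
    rw [hpow] at h5
    have hst := runs_stageLoop henv (X := σ₁.reg 40) (Y := σ₁.reg 41) (l := 2 ^ q) rfl rfl h4'
      (by rw [h1 33 (by norm_num), hL, hLe]) (by rw [h1 34 (by norm_num), hs]) (by rw [← hLe, hNL])
      hr0 rfl h3 hB hBN hε hε1 (by rw [← hLe]; exact hx) (by rw [← hLe]; exact h5)
    rw [← hLe] at hst
    refine (hst.seq (T₂ := 100) fun σ₂ _ h₂ => ?_).mono (by omega) fun _ _ h => h
    obtain ⟨g1, g2, g3⟩ := h₂
    have e40 := g1 40 (by norm_num)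
    have e41 := g1 41 (by norm_num)
    have e42 := g1 42 (by norm_num)
    refine runs_block (by decide) (by decide) ?_ ⟨?_, ?_, ?_, ?_, ?_⟩
    · simp [blockOk, Cmd.value, Cmd.run, e40, e41, e42]
      have : 2 ^ (k - (q + 1)) ≤ L := by rw [hLe]; exact Nat.le_mul_of_pos_left _ (by positivity)
      omega
    · intro k hk
      rw [reg_runBlock (K := 40) (by decide) _ hk, g1 k (by omega), h1 k hk]
    · intro p hp
      simp only [runBlock, Cmd.run]
      rw [g2 p hp, h2 p hp]
    · simp [runBlock, Cmd.run, e40, e41]; omega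
    · simp [runBlock, Cmd.run, e42, h4']
    · simp [runBlock, Cmd.run, e41]
      rw [pow_succ']
      exact g3
  · intro σ' _ hI
    simp [hI.2.2.2.1]
  · have : (Expr.var 42).cost = 2 := rfl
    rw [this]
    have : k * (2000 * L + 2100 + 2 + 1) ≤ k * (5000 * L) := Nat.mul_le_mul_left k (by omega)
    linarith
  · rintro σ' _ ⟨h1, h2, h3, h4, h5⟩
    refine ⟨h1, h2, by tauto, fun i hi => ?_⟩
    have := h5 i hi
    rw [Nat.sub_self, pow_zero, ← hk, partialDFT_full] at this
    exact this
  · have : 5000 * (L * (k + 1)) = k * (5000 * L) + 5000 * L := by ring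
    omega

/-! ### Convolution of three vectors on the word RAM -/

/-- Run `body` for the values `0, …, L - 1` of register `43`, where `L` is in register `33`. -/
def forLoop (body : List Cmd) : Program :=
  .seq (block [.set 43 0]) (whileLoop (.var 33 - .var 43) (block body))

/-- In round `i` only the entries before `i` have changed, so a body may read entry `i` of the very
array it overwrites; the pointwise product needs this. -/
theorem runs_forLoop {V N : ℕ} {σ : State} {body : List Cmd} {L base : ℕ} {z : ℕ → ℂ} {ε : ℝ}
    (hL : σ.reg 33 = L)
    (hbody : ∀ i < L, ∀ σ', (∀ k < 43, σ'.reg k = σ.reg k) → σ'.reg 43 = i →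
      (∀ q, q < base ∨ base + 2 * i ≤ q → σ'.mem q = σ.mem q) → ∃ u v, Cell N u v (z i) ε ∧
      Runs V (block body) σ' 1000 (fun σ'' => (∀ k < 43, σ''.reg k = σ.reg k) ∧
        σ''.reg 43 = i + 1 ∧ σ''.mem = Function.update (Function.update σ'.mem (base + 2 * i) u)
          (base + 2 * i + 1) v)) :
    Runs V (forLoop body) σ (2000 * L + 2000) (fun σ' => (∀ k < 43, σ'.reg k = σ.reg k) ∧
      (∀ q, q < base ∨ base + 2 * L ≤ q → σ'.mem q = σ.mem q) ∧ ArrayAt N σ'.mem base L z ε) := by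
  let Inv : ℕ → State → Prop := fun i σ' => (∀ k < 43, σ'.reg k = σ.reg k) ∧ σ'.reg 43 = i ∧
    (∀ q, q < base ∨ base + 2 * i ≤ q → σ'.mem q = σ.mem q) ∧ ArrayAt N σ'.mem base i z ε
  refine Runs.of_bdd fun hV hσ => ?_
  have hinit : Runs V (block [.set 43 0]) σ 10 (Inv 0) := by
    refine runs_block (by decide) (by decide) ?_ ⟨?_, ?_, ?_, ?_⟩
    · simp [blockOk, Cmd.value]; omega
    · exact fun k hk => reg_runBlock (by decide) σ hk
    · simp [runBlock, Cmd.run]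
    · intro p _; rfl
    · intro i hi; omega
  refine (hinit.seq fun σ₀ _ h₀ => runs_whileLoop_const (by decide) Inv L 1000
    (2000 * L + 1000) h₀ ?_ ?_ ?_ ?_).mono (by linarith) fun _ _ h => h
  · rintro i hi σ' _ ⟨h1, h2, h3, h4⟩
    refine ⟨by simp [h2, h1 33 (by norm_num), hL]; omega, ?_⟩
    obtain ⟨u, v, hc, hr⟩ := hbody i hi σ' h1 h2 h3
    refine hr.mono le_rfl ?_
    rintro σ'' _ ⟨g1, g2, g3⟩
    refine ⟨g1, g2, ?_, ?_⟩
    · intro q hq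
      rw [g3, Function.update_of_ne (by omega), Function.update_of_ne (by omega),
        h3 q (by omega)]
    · rw [g3]
      exact h4.update hc
  · rintro σ' _ ⟨h1, h2, h3, h4⟩
    simp [h2, h1 33 (by norm_num), hL]
  · have : (Expr.var 33 - Expr.var 43).cost = 5 := rfl
    rw [this]; ring_nf; omega
  · rintro σ' _ ⟨h1, h2, h3, h4⟩
    exact ⟨h1, h3, h4⟩

/-- A vector of zeros and ones in memory, extended by zeros. -/
def vec (m : ℕ → ℕ) (s l i : ℕ) : ℕ := if i < l then m (s + i) else 0

theorem vec_congr {m m' : ℕ → ℕ} {s l : ℕ} (h : ∀ i < l, m' (s + i) = m (s + i)) :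
    vec m' s l = vec m s l := by
  funext i
  unfold vec
  split_ifs with hi
  · exact h i hi
  · rfl

theorem vec_le_one {m : ℕ → ℕ} {s l : ℕ} (h : ∀ i < l, m (s + i) ≤ 1) (i : ℕ) :
    vec m s l i ≤ 1 := by
  unfold vec; split_ifs with hi
  · exact h i hi
  · omega

/-- The constant vector one as a first product. -/
def onesBody : List Cmd :=
  [.put (.var 15 + 2 * .var 43) (.var 5), .put (.var 15 + 2 * .var 43 + 1) 0,
   .set 43 (.var 43 + 1)]

/-- Load the vector of length `reg 37` at address `reg 36` into the first buffer. -/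
def loadBody : List Cmd :=
  [.set 44 (.read (.var 36 + .var 43) * (.var 5 * (1 - (1 - (.var 37 - .var 43))))),
   .put (.var 13 + 2 * .var 43) (.var 44), .put (.var 13 + 2 * .var 43 + 1) 0,
   .set 43 (.var 43 + 1)]

/-- Multiply the array at `reg 15` by the one at `reg 40`. -/
def productBody : List Cmd :=
  [.set 44 (.var 15 + 2 * .var 43),
   .set 45 (.var 40 + 2 * .var 43),
   .set 49 (.mulAddRe 0 (.read (.var 44)) (.read (.var 44 + 1)) (.read (.var 45))
     (.read (.var 45 + 1))),
   .set 50 (.mulAddIm 0 (.read (.var 44)) (.read (.var 44 + 1)) (.read (.var 45))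
     (.read (.var 45 + 1))),
   .put (.var 44) (.var 49), .put (.var 44 + 1) (.var 50), .set 43 (.var 43 + 1)]

/-- Copy the array at `reg 15` into the first buffer. -/
def copyBody : List Cmd :=
  [.put (.var 13 + 2 * .var 43) (.read (.var 15 + 2 * .var 43)),
   .put (.var 13 + 2 * .var 43 + 1) (.read (.var 15 + 2 * .var 43 + 1)),
   .set 43 (.var 43 + 1)]

theorem cell_bit {N b : ℕ} (hN : 0 < N) (hb : b ≤ 1) : Cell N (b * N ^ 16) 0 (b : ℂ) 0 := by
  have h1 : N ^ 16 ≤ N ^ 40 := Nat.pow_le_pow_right hN (by norm_num)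
  have h2 : 0 < N ^ 40 := by positivity
  have h3 : b * N ^ 16 ≤ 1 * N ^ 16 := Nat.mul_le_mul_right _ hb
  refine Cell.of_nat (by omega) (by omega) (le_of_eq ?_)
  have : (N : ℝ) ≠ 0 := by exact_mod_cast hN.ne'
  rw [norm_eq_zero, sub_eq_zero]
  apply Complex.ext <;> simp [this]

theorem runs_ones {V N W A : ℕ} {σ : State} (h : FftEnv V N W A σ) {L : ℕ} (hL : σ.reg 33 = L)
    (hLN : L ≤ N) :
    Runs V (forLoop onesBody) σ (2000 * L + 2000) (fun σ' => (∀ k < 43, σ'.reg k = σ.reg k) ∧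
      (∀ q < A, σ'.mem q = σ.mem q) ∧ ArrayAt N σ'.mem (A + 4 * N) L (fun _ => 1) 0) := by
  have hN := h.hN
  have hV := h.hV
  have hA := h.hA
  have hP := h.le_pow
  have hQ : N ^ 16 ≤ N ^ 40 := Nat.pow_le_pow_right (by omega) (by norm_num)
  refine (runs_forLoop (N := N) (base := A + 4 * N) (z := fun _ => 1) (ε := 0) hL ?_).mono le_rfl ?_
  · intro i hi σ' h1 h2 h3
    have e15 : σ'.reg 15 = A + 4 * N := by rw [h1 15 (by norm_num), h.reg15]
    have e5 : σ'.reg 5 = N ^ 16 := by rw [h1 5 (by norm_num), h.reg5]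
    refine ⟨N ^ 16, 0, by simpa using cell_bit (N := N) (b := 1) (by omega) le_rfl,
      runs_block (by decide) (by decide) ?_ ⟨?_, ?_, ?_⟩⟩
    · simp [onesBody, blockOk, Cmd.value, Cmd.run, e5, h2]; omega
    · intro k hk
      rw [reg_runBlock (K := 43) (by decide) _ hk, h1 k hk]
    · simp [onesBody, runBlock, Cmd.run, h2]
    · simp [onesBody, runBlock, Cmd.run, h2, e15, e5]
  · rintro σ' _ ⟨h1, h2, h3⟩
    exact ⟨h1, fun q hq => h2 q (by omega), h3⟩

theorem runs_load {V N W A : ℕ} {σ : State} (h : FftEnv V N W A σ) {L s l : ℕ} (hL : σ.reg 33 = L)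
    (hLN : L ≤ N) (hs : σ.reg 36 = s) (hl : σ.reg 37 = l) (hsA : s + l ≤ A)
    (hb : ∀ i < l, σ.mem (s + i) ≤ 1) :
    Runs V (forLoop loadBody) σ (2000 * L + 2000) (fun σ' => (∀ k < 43, σ'.reg k = σ.reg k) ∧
      (∀ q, q < A ∨ A + 4 * N ≤ q → σ'.mem q = σ.mem q) ∧
      ArrayAt N σ'.mem A L (fun i => vec σ.mem s l i) 0) := by
  have hN := h.hN
  have hV := h.hV
  have hA := h.hA
  have hP := h.le_pow
  have hQ : N ^ 16 ≤ N ^ 40 := Nat.pow_le_pow_right (by omega) (by norm_num)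
  refine (runs_forLoop (N := N) (base := A) (z := fun i => vec σ.mem s l i) (ε := 0) hL ?_).mono le_rfl ?_
  · intro i hi σ' h1 h2 h3
    have e13 : σ'.reg 13 = A := by rw [h1 13 (by norm_num), h.reg13]
    have e5 : σ'.reg 5 = N ^ 16 := by rw [h1 5 (by norm_num), h.reg5]
    have e36 : σ'.reg 36 = s := by rw [h1 36 (by norm_num), hs]
    have e37 : σ'.reg 37 = l := by rw [h1 37 (by norm_num), hl]
    -- `1 - (1 - (l - i))` is the indicator of `i < l`; it masks whatever is read beyond the end of
    -- the vector.
    have hval : σ'.mem (s + i) * (N ^ 16 * (1 - (1 - (l - i)))) = vec σ.mem s l i * N ^ 16 := by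
      unfold vec
      split_ifs with hil
      · rw [h3 _ (by omega), show 1 - (1 - (l - i)) = 1 by omega, mul_one]
      · rw [show 1 - (1 - (l - i)) = 0 by omega]; simp
    have hvec := vec_le_one hb i
    have hle : vec σ.mem s l i * N ^ 16 ≤ 1 * N ^ 16 := Nat.mul_le_mul_right _ hvec
    refine ⟨vec σ.mem s l i * N ^ 16, 0, cell_bit (by omega) hvec,
      runs_block (by decide) (by decide) ?_ ⟨?_, ?_, ?_⟩⟩
    · simp only [loadBody, blockOk, Cmd.value, Cmd.run]
      simp [e5, e36, e37, h2, hval]; omega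
    · intro k hk
      rw [reg_runBlock (K := 43) (by decide) _ hk, h1 k hk]
    · simp [loadBody, runBlock, Cmd.run, h2]
    · simp only [loadBody, runBlock, Cmd.run]
      simp [e5, e36, e37, h2, hval, e13]
  · rintro σ' _ ⟨h1, h2, h3⟩
    exact ⟨h1, fun q hq => h2 q (by omega), h3⟩

theorem runs_product {V N W A : ℕ} {σ : State} (h : FftEnv V N W A σ) {L k X : ℕ}
    (hL : σ.reg 33 = L) (hLN : L ≤ N) (hX : σ.reg 40 = X) (hXA : X = A ∨ X = A + 2 * N)
    (hk : k ≤ 2) {z x : ℕ → ℂ}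
    (hz : ArrayAt N σ.mem (A + 4 * N) L z (5 * k / (N : ℝ) ^ (9 - k)))
    (hzn : ∀ i < L, ‖z i‖ ≤ (L : ℝ) ^ k)
    (hx : ArrayAt N σ.mem X L x (2 / (N : ℝ) ^ 8)) (hxn : ∀ i < L, ‖x i‖ ≤ L) :
    Runs V (forLoop productBody) σ (2000 * L + 2000) (fun σ' => (∀ k < 43, σ'.reg k = σ.reg k) ∧
      (∀ q < A, σ'.mem q = σ.mem q) ∧ ArrayAt N σ'.mem (A + 4 * N) L (fun i => z i * x i)
        (5 * (k + 1 : ℕ) / (N : ℝ) ^ (9 - (k + 1)))) := by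
  have hN := h.hN
  have hV := h.hV
  have hA := h.hA
  have hP := h.le_pow
  refine (runs_forLoop (N := N) (base := A + 4 * N) (z := fun i => z i * x i)
    (ε := 5 * (k + 1 : ℕ) / (N : ℝ) ^ (9 - (k + 1))) hL ?_).mono le_rfl ?_
  · intro i hi σ' h1 h2 h3
    have e15 : σ'.reg 15 = A + 4 * N := by rw [h1 15 (by norm_num), h.reg15]
    have e40 : σ'.reg 40 = X := by rw [h1 40 (by norm_num), hX]
    have hc := h.toConsts.congr (σ' := σ') fun k hk => h1 k (by omega)
    have m1 := h3 (A + 4 * N + 2 * i) (by omega)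
    have m2 := h3 (A + 4 * N + 2 * i + 1) (by omega)
    have m3 := h3 (X + 2 * i) (by omega)
    have m4 := h3 (X + 2 * i + 1) (by omega)
    refine ⟨_, _, Cell.product hN hLN hk (hz i hi) (hzn i hi) (hx i hi) (hxn i hi),
      runs_block (by decide) (by decide) ?_ ⟨?_, ?_, ?_⟩⟩
    · have h40 : 0 < 2 * N ^ 40 := by omega
      simp only [productBody, blockOk, Cmd.value, Cmd.run]
      simp [h2, e15, e40, Expr.mulAddRe, Expr.scaleDown, Expr.mulAddIm, hc.reg5, hc.reg6, hc.reg7]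
      exact ⟨by omega, by omega, (Nat.mod_lt _ h40).trans hV, (Nat.mod_lt _ h40).trans hV,
        (Nat.mod_lt _ h40).trans hV, (Nat.mod_lt _ h40).trans hV, by omega⟩
    · intro k hk
      rw [reg_runBlock (K := 43) (by decide) _ hk, h1 k hk]
    · simp [productBody, runBlock, Cmd.run, h2]
    · simp only [productBody, runBlock, Cmd.run]
      simp [h2, e15, e40, Expr.mulAddRe, Expr.scaleDown, Expr.mulAddIm, hc.reg5, hc.reg6, hc.reg7,
        mulAddRe, mulAddIm, scaleDown, m1, m2, m3, m4]
  · rintro σ' _ ⟨h1, h2, h3⟩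
    exact ⟨h1, fun q hq => h2 q (by omega), h3⟩

theorem runs_copy {V N W A : ℕ} {σ : State} (h : FftEnv V N W A σ) {L : ℕ} (hL : σ.reg 33 = L)
    (hLN : L ≤ N) {z : ℕ → ℂ} {ε : ℝ} (hz : ArrayAt N σ.mem (A + 4 * N) L z ε) :
    Runs V (forLoop copyBody) σ (2000 * L + 2000) (fun σ' => (∀ k < 43, σ'.reg k = σ.reg k) ∧
      (∀ q < A, σ'.mem q = σ.mem q) ∧ ArrayAt N σ'.mem A L z ε) := by
  have hN := h.hN
  have hV := h.hV
  have hA := h.hA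
  have hP := h.le_pow
  refine (runs_forLoop (N := N) (base := A) (z := z) (ε := ε) hL ?_).mono le_rfl ?_
  · intro i hi σ' h1 h2 h3
    have e15 : σ'.reg 15 = A + 4 * N := by rw [h1 15 (by norm_num), h.reg15]
    have e13 : σ'.reg 13 = A := by rw [h1 13 (by norm_num), h.reg13]
    have m1 := h3 (A + 4 * N + 2 * i) (by omega)
    have m2 := h3 (A + 4 * N + 2 * i + 1) (by omega)
    have hlt := (hz i hi).lt (by omega)
    have ne : A + 4 * N + 2 * i + 1 ≠ A + 2 * i := by omega
    refine ⟨_, _, hz i hi, runs_block (by decide) (by decide) ?_ ⟨?_, ?_, ?_⟩⟩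
    · simp [copyBody, blockOk, Cmd.value, Cmd.run, h2, e13, e15, m1, m2, ne]
      omega
    · intro k hk
      rw [reg_runBlock (K := 43) (by decide) _ hk, h1 k hk]
    · simp [copyBody, runBlock, Cmd.run, h2]
    · simp [copyBody, runBlock, Cmd.run, h2, e13, e15, m1, m2, ne]
  · rintro σ' _ ⟨h1, h2, h3⟩
    exact ⟨h1, fun q hq => h2 q (by omega), h3⟩

/-- Multiply the product by the transform of the vector at `reg 36` of length `reg 37`. -/
def factor : Program := .seq (forLoop loadBody) (.seq fft (forLoop productBody))

theorem norm_dft_le {ω : ℂ} (hω : ‖ω‖ = 1) {x : ℕ → ℂ} {L : ℕ} (hx : ∀ i < L, ‖x i‖ ≤ 1)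
    (b : ℕ) : ‖dft ω x L b‖ ≤ L := by
  rw [← partialDFT_full]
  simpa using norm_partialDFT_le hω (x := x) (B := 1) (l := L) (r := 1) (i := b) one_pos
    (by simpa using hx)

theorem runs_factor {V N W A : ℕ} {σ : State} (h : FftEnv V N W A σ) {L s l k str j : ℕ}
    (hL : σ.reg 33 = L) (hstr : σ.reg 34 = str) (hNL : L * str = N) (hk : L = 2 ^ k)
    (hs : σ.reg 36 = s) (hl : σ.reg 37 = l) (hsA : s + l ≤ A)
    (hb : ∀ i < l, σ.mem (s + i) ≤ 1) (hj : j ≤ 2) {z : ℕ → ℂ}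
    (hz : ArrayAt N σ.mem (A + 4 * N) L z (5 * j / (N : ℝ) ^ (9 - j)))
    (hzn : ∀ i < L, ‖z i‖ ≤ (L : ℝ) ^ j) :
    Runs V factor σ (20000 * (L * (k + 1))) (fun σ' => (∀ k < 40, σ'.reg k = σ.reg k) ∧
      (∀ q < A, σ'.mem q = σ.mem q) ∧
      ArrayAt N σ'.mem (A + 4 * N) L
        (fun i => z i * dft (root N ^ str) (fun i => vec σ.mem s l i) L i)
        (5 * (j + 1 : ℕ) / (N : ℝ) ^ (9 - (j + 1)))) := by
  have hN := h.hN
  have hstr0 : 0 < str := by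
    rcases Nat.eq_zero_or_pos str with rfl | h
    · omega
    · exact h
  have hLN : L ≤ N := hNL ▸ Nat.le_mul_of_pos_right L hstr0
  have hL0 : 0 < L := hk ▸ Nat.pow_pos (by norm_num)
  have hN' : (8 : ℝ) ≤ N := by exact_mod_cast hN
  have hvn : ∀ i < L, ‖((vec σ.mem s l i : ℕ) : ℂ)‖ ≤ 1 := fun i _ => by
    rw [Complex.norm_natCast]; exact_mod_cast vec_le_one hb i
  refine ((runs_load h hL hLN hs hl hsA hb).seq (T₂ := 5000 * (L * (k + 1)) + (2000 * L + 2000))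
    fun σ₁ _ h₁ => ?_).mono ?_ fun _ _ h => h
  · obtain ⟨a1, a2, a3⟩ := h₁
    have henv : FftEnv V N W A σ₁ := h.congr (fun k hk => a1 k (by omega))
      (fun p hp1 hp2 => a2 p (by omega))
    refine (runs_fft henv (by rw [a1 33 (by norm_num), hL]) (by rw [a1 34 (by norm_num), hstr]) hNL
      hk le_rfl (one_le_pow₀ (by linarith)) le_rfl zero_le_one hvn a3).seq fun σ₂ _ h₂ => ?_
    obtain ⟨b1, b2, b3, b4⟩ := h₂
    have henv₂ : FftEnv V N W A σ₂ := henv.congr (fun k hk => b1 k (by omega))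
      (fun p hp1 hp2 => b2 p (by omega))
    have hb4 : ArrayAt N σ₂.mem (σ₂.reg 40) L (dft (root N ^ str) (fun i => vec σ.mem s l i) L)
        (2 / (N : ℝ) ^ 8) := fun i hi => (b4 i hi).mono (stageError_forward hN hk.symm hLN)
    refine (runs_product henv₂ (by rw [b1 33 (by norm_num), a1 33 (by norm_num), hL]) hLN rfl b3 hj
      (hz.congr fun p hp1 hp2 => ?_) hzn hb4
      (fun i _ => norm_dft_le (by rw [norm_pow, norm_root (by omega), one_pow]) hvn i)).mono le_rfl ?_
    · rw [b2 p (by omega), a2 p (by omega)]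
    · rintro σ₃ _ ⟨c1, c2, c3⟩
      refine ⟨fun k hk => ?_, fun q hq => ?_, c3⟩
      · rw [c1 k (by omega), b1 k hk, a1 k (by omega)]
      · rw [c2 q hq, b2 q (by omega), a2 q (by omega)]
  · have : L ≤ L * (k + 1) := Nat.le_mul_of_pos_right L (by omega)
    omega

/-- Multiply the product by the transform of the vector whose address and length are in the
registers `s` and `l`. -/
def factorOf (s l : ℕ) : Program := .seq (block [.set 36 (.var s), .set 37 (.var l)]) factor

theorem runs_factorOf {V N W A : ℕ} {σ : State} (h : FftEnv V N W A σ) {L s l k str j rs rl : ℕ}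
    (hrs : rs < 36) (hrl : rl < 36)
    (hL : σ.reg 33 = L) (hstr : σ.reg 34 = str) (hNL : L * str = N) (hk : L = 2 ^ k)
    (hs : σ.reg rs = s) (hl : σ.reg rl = l) (hsA : s + l ≤ A)
    (hb : ∀ i < l, σ.mem (s + i) ≤ 1) (hj : j ≤ 2) {z : ℕ → ℂ}
    (hz : ArrayAt N σ.mem (A + 4 * N) L z (5 * j / (N : ℝ) ^ (9 - j)))
    (hzn : ∀ i < L, ‖z i‖ ≤ (L : ℝ) ^ j) :
    Runs V (factorOf rs rl) σ (21000 * (L * (k + 1))) (fun σ' => (∀ k < 36, σ'.reg k = σ.reg k) ∧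
      (∀ q < A, σ'.mem q = σ.mem q) ∧
      ArrayAt N σ'.mem (A + 4 * N) L
        (fun i => z i * dft (root N ^ str) (fun i => vec σ.mem s l i) L i)
        (5 * (j + 1 : ℕ) / (N : ℝ) ^ (9 - (j + 1)))) := by
  have hL0 : 0 < L * (k + 1) := Nat.mul_pos (hk ▸ Nat.pow_pos (by norm_num)) (by omega)
  have hA := h.hA
  have hblock : Runs V (block [.set 36 (.var rs), .set 37 (.var rl)]) σ 100 (fun σ' =>
      (∀ k < 36, σ'.reg k = σ.reg k) ∧ σ'.reg 36 = s ∧ σ'.reg 37 = l ∧ σ'.mem = σ.mem) := by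
    refine runs_block (by simp [blockCost, Cmd.cost, Expr.cost]) ?_ ?_ ⟨?_, ?_, ?_, rfl⟩
    · simp [blockWf, Cmd.wf, Expr.wf]; omega
    · simp [blockOk, Cmd.value, Cmd.run, Function.update_of_ne (show rl ≠ 36 by omega), hs, hl]
      omega
    · exact fun k hk => reg_runBlock (by simp [setsFrom]) σ hk
    · simp [runBlock, Cmd.run, hs]
    · simp [runBlock, Cmd.run, Function.update_of_ne (show rl ≠ 36 by omega), hl]
  refine (hblock.seq (T₂ := 20000 * (L * (k + 1))) fun σ₁ _ h₁ => ?_).mono (by omega) fun _ _ h => h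
  obtain ⟨a1, a2, a3, a4⟩ := h₁
  have henv : FftEnv V N W A σ₁ := h.congr (fun k hk => a1 k (by omega)) (fun p _ _ => by rw [a4])
  refine (runs_factor henv (by rw [a1 33 (by norm_num), hL]) (by rw [a1 34 (by norm_num), hstr]) hNL
    hk a2 a3 hsA (by rw [a4]; exact hb) hj (by rw [a4]; exact hz) hzn).mono le_rfl ?_
  rintro σ₂ _ ⟨b1, b2, b3⟩
  rw [a4] at b2 b3
  exact ⟨fun k hk => (b1 k (by omega)).trans (a1 k hk), b2, b3⟩

/-- Write the bits that tell which entries of the array at `reg 40` are positive. -/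
def outputBody : List Cmd :=
  [.set 44 (.var 40 + 2 * ((.var 33 - (.var 30 + .var 43)) % .var 33)),
   .put (.var 32 + .var 43)
     (1 - (1 - (2 * ((.read (.var 44) + .var 6) % .var 7) - (2 * .var 6 + .var 5)))),
   .set 43 (.var 43 + 1)]

def output : Program :=
  .seq (block [.set 43 0]) (whileLoop (.var 31 - .var 43) (block outputBody))

/-- The destination ends before the buffers at `A`, so writing bits never damages the array still to
be read. Entry `j` is found at `(L - j) % L` because the backward transform is a forward one. -/
theorem runs_output {V N W A : ℕ} {σ : State} (h : FftEnv V N W A σ) {L X off len dst : ℕ}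
    (hL : σ.reg 33 = L) (hLN : L ≤ N) (hX : σ.reg 40 = X) (hXA : X = A ∨ X = A + 2 * N)
    (hoff : σ.reg 30 = off) (hlen : σ.reg 31 = len) (hdst : σ.reg 32 = dst) (hlenL : off + len ≤ L)
    (hdA : dst + len ≤ A) {K : ℕ → ℕ} (hK : ∀ j < L, K j < N ^ 8)
    (hz : ∀ j < L, Cell N (σ.mem (X + 2 * ((L - j) % L))) (σ.mem (X + 2 * ((L - j) % L) + 1)) (K j)
      (1 / 4)) :
    Runs V output σ (2000 * L + 2000) (fun σ' => (∀ k < 43, σ'.reg k = σ.reg k) ∧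
      (∀ q, q < dst ∨ dst + len ≤ q → σ'.mem q = σ.mem q) ∧
      ∀ r < len, σ'.mem (dst + r) = if 0 < K (off + r) then 1 else 0) := by
  have hN := h.hN
  have hV := h.hV
  have hA := h.hA
  have hP := h.le_pow
  let Inv : ℕ → State → Prop := fun i σ' => (∀ k < 43, σ'.reg k = σ.reg k) ∧ σ'.reg 43 = i ∧
    (∀ q, q < dst ∨ dst + i ≤ q → σ'.mem q = σ.mem q) ∧
    ∀ r < i, σ'.mem (dst + r) = if 0 < K (off + r) then 1 else 0
  have hinit : Runs V (block [.set 43 0]) σ 10 (Inv 0) := by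
    refine runs_block (by decide) (by decide) ?_ ⟨?_, ?_, ?_, ?_⟩
    · simp [blockOk, Cmd.value]; omega
    · exact fun k hk => reg_runBlock (by decide) σ hk
    · simp [runBlock, Cmd.run]
    · intro p _; rfl
    · intro i hi; omega
  refine (hinit.seq fun σ₀ _ h₀ => runs_whileLoop_const (by decide) Inv len 1000
    (2000 * L + 1000) h₀ ?_ ?_ ?_ ?_).mono (by linarith) fun _ _ h => h
  · rintro i hi σ' _ ⟨h1, h2, h3, h4⟩
    have e31 : σ'.reg 31 = len := by rw [h1 31 (by norm_num), hlen]
    have e30 : σ'.reg 30 = off := by rw [h1 30 (by norm_num), hoff]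
    have e32 : σ'.reg 32 = dst := by rw [h1 32 (by norm_num), hdst]
    have e33 : σ'.reg 33 = L := by rw [h1 33 (by norm_num), hL]
    have e40 : σ'.reg 40 = X := by rw [h1 40 (by norm_num), hX]
    have hc := h.toConsts.congr (σ' := σ') fun k hk => h1 k (by omega)
    have hmod : (L - (off + i)) % L < L := Nat.mod_lt _ (by omega)
    have hmem : σ'.mem (X + 2 * ((L - (off + i)) % L)) = σ.mem (X + 2 * ((L - (off + i)) % L)) :=
      h3 _ (by omega)
    have hthr := (hz (off + i) (by omega)).threshold (by omega) le_rfl (hK _ (by omega))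
    refine ⟨by simp [h2, e31]; omega, runs_block (by decide) (by decide) ?_ ⟨?_, ?_, ?_, ?_⟩⟩
    · simp only [outputBody, blockOk, Cmd.value, Cmd.run]
      simp [h2, e30, e32, e33, e40, hc.reg5, hc.reg6, hc.reg7]
      omega
    · intro k hk
      rw [reg_runBlock (K := 43) (by decide) _ hk, h1 k hk]
    · simp [outputBody, runBlock, Cmd.run, h2]
    · intro q hq
      simp [outputBody, runBlock, Cmd.run, h2, e32]
      rw [Function.update_of_ne (by omega), h3 q (by omega)]
    · intro r hr
      simp only [outputBody, runBlock, Cmd.run]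
      simp only [Expr.eval_var, Expr.eval_add, Expr.eval_sub, Expr.eval_mul, Expr.eval_mod,
        Expr.eval_read, Expr.eval_ofNat, Function.update_self, Function.update_apply]
      simp [h2, e30, e32, e33, e40, hc.reg5, hc.reg6, hc.reg7, hmem]
      rcases Nat.lt_succ_iff_lt_or_eq.1 hr with hr | rfl
      · rw [if_neg (by omega), h4 r hr]
      · rw [if_pos rfl, hthr]
  · rintro σ' _ ⟨h1, h2, h3, h4⟩
    simp [h2, h1 31 (by norm_num), hlen]
  · have : (Expr.var 31 - Expr.var 43).cost = 5 := rfl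
    rw [this]
    have : len * (1000 + 5 + 1) ≤ L * (1000 + 5 + 1) := Nat.mul_le_mul_right _ (by omega)
    linarith
  · rintro σ' _ ⟨h1, h2, h3, h4⟩
    exact ⟨h1, h3, h4⟩

/-- The support of the convolution of three vectors. -/
def conv : Program :=
  .seq (forLoop onesBody) (.seq (factorOf 24 25) (.seq (factorOf 26 27) (.seq (factorOf 28 29)
    (.seq (forLoop copyBody) (.seq fft output)))))

theorem tripleCount_le {P₁ P₂ P₃ : ℕ → ℕ} (h₁ : ∀ i, P₁ i ≤ 1) (h₂ : ∀ i, P₂ i ≤ 1)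
    (h₃ : ∀ i, P₃ i ≤ 1) (L j : ℕ) : tripleCount P₁ P₂ P₃ L j ≤ L ^ 3 := by
  have : ∀ u v w, (if u + v + w = j then P₁ u * P₂ v * P₃ w else 0) ≤ 1 := by
    intro u v w
    split_ifs
    · calc _ ≤ 1 * 1 * 1 := Nat.mul_le_mul (Nat.mul_le_mul (h₁ u) (h₂ v)) (h₃ w)
        _ = 1 := rfl
    · omega
  unfold tripleCount
  calc _ ≤ ∑ u ∈ range L, ∑ v ∈ range L, ∑ w ∈ range L, 1 :=
        sum_le_sum fun u _ => sum_le_sum fun v _ => sum_le_sum fun w _ => this u v w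
    _ = L ^ 3 := by simp; ring

/-- Three forward transforms are multiplied onto the constant array 1, and one more transform yields
`L` times the representation counts. The sources are read before the destination is written, so both
may overlap. -/
theorem runs_conv {V N W A : ℕ} {σ : State} (h : FftEnv V N W A σ)
    {L k str s₁ l₁ s₂ l₂ s₃ l₃ off len dst : ℕ}
    (r24 : σ.reg 24 = s₁) (r25 : σ.reg 25 = l₁) (r26 : σ.reg 26 = s₂) (r27 : σ.reg 27 = l₂)
    (r28 : σ.reg 28 = s₃) (r29 : σ.reg 29 = l₃) (r30 : σ.reg 30 = off) (r31 : σ.reg 31 = len)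
    (r32 : σ.reg 32 = dst) (r33 : σ.reg 33 = L) (r34 : σ.reg 34 = str)
    (hNL : L * str = N) (hk : L = 2 ^ k)
    (hs₁ : s₁ + l₁ ≤ A) (hs₂ : s₂ + l₂ ≤ A) (hs₃ : s₃ + l₃ ≤ A)
    (hb₁ : ∀ i < l₁, σ.mem (s₁ + i) ≤ 1) (hb₂ : ∀ i < l₂, σ.mem (s₂ + i) ≤ 1)
    (hb₃ : ∀ i < l₃, σ.mem (s₃ + i) ≤ 1) (hsum : l₁ + l₂ + l₃ ≤ L + 2)
    (hoff : off + len ≤ L) (hdst : dst + len ≤ W) :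
    Runs V conv σ (100000 * (L * (k + 1))) (fun σ' => (∀ k < 36, σ'.reg k = σ.reg k) ∧
      (∀ q < A, q < dst ∨ dst + len ≤ q → σ'.mem q = σ.mem q) ∧
      FftEnv V N W A σ' ∧
      (∀ r < len, σ'.mem (dst + r) ≤ 1) ∧
      ∀ r < len, (σ'.mem (dst + r) = 1 ↔ ∃ u < l₁, ∃ v < l₂, ∃ w < l₃, u + v + w = off + r ∧
        σ.mem (s₁ + u) = 1 ∧ σ.mem (s₂ + v) = 1 ∧ σ.mem (s₃ + w) = 1)) := by
  have hN := h.hN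
  have hWA := h.hWA
  have hstr0 : 0 < str := by
    rcases Nat.eq_zero_or_pos str with rfl | h
    · omega
    · exact h
  have hLN : L ≤ N := hNL ▸ Nat.le_mul_of_pos_right L hstr0
  have hL0 : 0 < L := hk ▸ Nat.pow_pos (by norm_num)
  have hN' : (8 : ℝ) ≤ N := by exact_mod_cast hN
  have hLN' : (L : ℝ) ≤ N := by exact_mod_cast hLN
  have hω : ‖root N ^ str‖ = 1 := by rw [norm_pow, norm_root (by omega), one_pow]
  have hprim : IsPrimitiveRoot (root N ^ str) L :=
    (isPrimitiveRoot_root (by omega)).pow (by omega) (by rw [mul_comm, hNL])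
  have hv₁ := vec_le_one hb₁
  have hv₂ := vec_le_one hb₂
  have hv₃ := vec_le_one hb₃
  set P₁ := vec σ.mem s₁ l₁ with hP₁
  set P₂ := vec σ.mem s₂ l₂ with hP₂
  set P₃ := vec σ.mem s₃ l₃ with hP₃
  have hd : ∀ {P : ℕ → ℕ}, (∀ i, P i ≤ 1) → ∀ i, ‖dft (root N ^ str) (fun i => P i) L i‖ ≤ L :=
    fun hP i => norm_dft_le hω (fun i _ => by rw [Complex.norm_natCast]; exact_mod_cast hP i) i
  have hLk : L ≤ L * (k + 1) := Nat.le_mul_of_pos_right L (by omega)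
  set T := L * (k + 1) with hT
  refine ((runs_ones h r33 hLN).seq (T₂ := 90000 * T) fun σ₁ _ h₁ => ?_).mono (by omega)
    fun _ _ h => h
  obtain ⟨a1, a2, a3⟩ := h₁
  have e1 : FftEnv V N W A σ₁ := h.congr (fun k hk => a1 k (by omega)) (fun p _ hp => a2 p hp)
  have A1 : ∀ k < 36, σ₁.reg k = σ.reg k := fun k hk => a1 k (by omega)
  refine ((runs_factorOf e1 (s := s₁) (l := l₁) (by norm_num) (by norm_num) ((A1 33 (by norm_num)).trans r33)
    ((A1 34 (by norm_num)).trans r34) hNL hk ((A1 24 (by norm_num)).trans r24)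
    ((A1 25 (by norm_num)).trans r25) hs₁ (fun i hi => by rw [a2 _ (by omega)]; exact hb₁ i hi)
    (j := 0) (by norm_num) (by simpa using a3) (by simp)).seq (T₂ := 69000 * T)
    fun σ₂ _ h₂ => ?_).mono (by omega) fun _ _ h => h
  obtain ⟨b1, b2, b3⟩ := h₂
  rw [vec_congr (m := σ.mem) (fun i hi => a2 _ (by omega)), ← hP₁] at b3
  have B1 : ∀ k < 36, σ₂.reg k = σ.reg k := fun k hk => (b1 k hk).trans (A1 k hk)
  have B2 : ∀ q < A, σ₂.mem q = σ.mem q := fun q hq => (b2 q hq).trans (a2 q hq)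
  have e2 : FftEnv V N W A σ₂ := h.congr (fun k hk => B1 k (by omega)) (fun p _ hp => B2 p hp)
  refine ((runs_factorOf e2 (s := s₂) (l := l₂) (by norm_num) (by norm_num) ((B1 33 (by norm_num)).trans r33)
    ((B1 34 (by norm_num)).trans r34) hNL hk ((B1 26 (by norm_num)).trans r26)
    ((B1 27 (by norm_num)).trans r27) hs₂ (fun i hi => by rw [B2 _ (by omega)]; exact hb₂ i hi)
    (j := 1) (by norm_num) b3 (fun i _ => by rw [one_mul, pow_one]; exact hd hv₁ i)).seq
    (T₂ := 48000 * T) fun σ₃ _ h₃ => ?_).mono (by omega) fun _ _ h => h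
  obtain ⟨c1, c2, c3⟩ := h₃
  rw [vec_congr (m := σ.mem) (fun i hi => B2 _ (by omega)), ← hP₂] at c3
  have C1 : ∀ k < 36, σ₃.reg k = σ.reg k := fun k hk => (c1 k hk).trans (B1 k hk)
  have C2 : ∀ q < A, σ₃.mem q = σ.mem q := fun q hq => (c2 q hq).trans (B2 q hq)
  have e3 : FftEnv V N W A σ₃ := h.congr (fun k hk => C1 k (by omega)) (fun p _ hp => C2 p hp)
  refine ((runs_factorOf e3 (s := s₃) (l := l₃) (by norm_num) (by norm_num) ((C1 33 (by norm_num)).trans r33)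
    ((C1 34 (by norm_num)).trans r34) hNL hk ((C1 28 (by norm_num)).trans r28)
    ((C1 29 (by norm_num)).trans r29) hs₃ (fun i hi => by rw [C2 _ (by omega)]; exact hb₃ i hi)
    (j := 2) (by norm_num) c3 (fun i _ => by
      rw [one_mul, norm_mul, pow_two]
      exact mul_le_mul (hd hv₁ i) (hd hv₂ i) (norm_nonneg _) (by positivity))).seq
    (T₂ := 27000 * T) fun σ₄ _ h₄ => ?_).mono (by omega) fun _ _ h => h
  obtain ⟨d1, d2, d3⟩ := h₄
  rw [vec_congr (m := σ.mem) (fun i hi => C2 _ (by omega)), ← hP₃] at d3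
  have D1 : ∀ k < 36, σ₄.reg k = σ.reg k := fun k hk => (d1 k hk).trans (C1 k hk)
  have D2 : ∀ q < A, σ₄.mem q = σ.mem q := fun q hq => (d2 q hq).trans (C2 q hq)
  have e4 : FftEnv V N W A σ₄ := h.congr (fun k hk => D1 k (by omega)) (fun p _ hp => D2 p hp)
  refine ((runs_copy e4 ((D1 33 (by norm_num)).trans r33) hLN d3).seq (T₂ := 23000 * T)
    fun σ₅ _ h₅ => ?_).mono (by omega) fun _ _ h => h
  obtain ⟨f1, f2, f3⟩ := h₅
  have F1 : ∀ k < 36, σ₅.reg k = σ.reg k := fun k hk => (f1 k (by omega)).trans (D1 k hk)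
  have F2 : ∀ q < A, σ₅.mem q = σ.mem q := fun q hq => (f2 q hq).trans (D2 q hq)
  have e5 : FftEnv V N W A σ₅ := h.congr (fun k hk => F1 k (by omega)) (fun p _ hp => F2 p hp)
  have herr : 5 * ((2 + 1 : ℕ) : ℝ) / (N : ℝ) ^ (9 - (2 + 1)) ≤ 1 := by
    rw [div_le_one (by positivity)]
    calc 5 * ((2 + 1 : ℕ) : ℝ) ≤ 8 ^ 6 := by norm_num
      _ ≤ (N : ℝ) ^ 6 := by gcongr
  refine ((runs_fft e5 ((F1 33 (by norm_num)).trans r33) ((F1 34 (by norm_num)).trans r34) hNL hk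
    (one_le_pow₀ (by linarith)) le_rfl (by positivity) herr (fun i _ => by
      rw [one_mul, norm_mul, norm_mul, pow_succ, pow_two]
      have h1 := (hd hv₁ i).trans hLN'
      have h2 := (hd hv₂ i).trans hLN'
      have h3 := (hd hv₃ i).trans hLN'
      gcongr) f3).seq (T₂ := 4000 * T) fun σ₆ _ h₆ => ?_).mono (by omega) fun _ _ h => h
  obtain ⟨g1, g2, g3, g4⟩ := h₆
  have G1 : ∀ k < 36, σ₆.reg k = σ.reg k := fun k hk => (g1 k (by omega)).trans (F1 k hk)
  have G2 : ∀ q < A, σ₆.mem q = σ.mem q := fun q hq => (g2 q (by omega)).trans (F2 q hq)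
  have e6 : FftEnv V N W A σ₆ := h.congr (fun k hk => G1 k (by omega)) (fun p _ hp => G2 p hp)
  -- Indices are at most `l₁ - 1`, `l₂ - 1`, `l₃ - 1`, hence the slack 2 in `hsum`.
  have hsupp : ∀ u v w, P₁ u ≠ 0 → P₂ v ≠ 0 → P₃ w ≠ 0 → u + v + w < L := by
    intro u v w h1 h2 h3
    have hu : u < l₁ := by by_contra hc; exact h1 (if_neg hc)
    have hv : v < l₂ := by by_contra hc; exact h2 (if_neg hc)
    have hw : w < l₃ := by by_contra hc; exact h3 (if_neg hc)
    omega
  refine (runs_output e6 (K := fun j => L * tripleCount P₁ P₂ P₃ L j)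
    ((G1 33 (by norm_num)).trans r33) hLN rfl g3 ((G1 30 (by norm_num)).trans r30)
    ((G1 31 (by norm_num)).trans r31) ((G1 32 (by norm_num)).trans r32) hoff (by omega) ?_ ?_).mono
    (by omega) ?_
  · intro j _
    calc L * tripleCount P₁ P₂ P₃ L j ≤ L * L ^ 3 :=
          Nat.mul_le_mul_left _ (tripleCount_le hv₁ hv₂ hv₃ L j)
      _ = L ^ 4 := by ring
      _ ≤ N ^ 4 := Nat.pow_le_pow_left hLN 4
      _ < N ^ 8 := Nat.pow_lt_pow_right (by omega) (by norm_num)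
  · intro j hj
    have := g4 ((L - j) % L) (Nat.mod_lt _ hL0)
    simp only [one_mul] at this
    rw [dft_dft_mul hprim hsupp hj] at this
    push_cast
    exact this.mono (stageError_backward hN (hk ▸ hLN))
  · rintro σ₇ _ ⟨i1, i2, i3⟩
    have I1 : ∀ k < 36, σ₇.reg k = σ.reg k := fun k hk => (i1 k (by omega)).trans (G1 k hk)
    have I2 : ∀ q < A, q < dst ∨ dst + len ≤ q → σ₇.mem q = σ.mem q :=
      fun q hq hq2 => (i2 q hq2).trans (G2 q hq)
    refine ⟨I1, I2, h.congr (fun k hk => I1 k (by omega)) (fun p hp1 hp2 => I2 p hp2 (by omega)),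
      fun r hr => ?_, fun r hr => ?_⟩
    · rw [i3 r hr]; split_ifs <;> omega
    · have hiff : (if 0 < L * tripleCount P₁ P₂ P₃ L (off + r) then 1 else 0) = 1 ↔
          0 < tripleCount P₁ P₂ P₃ L (off + r) := by
        have hpos := Nat.mul_pos_iff_of_pos_left (b := tripleCount P₁ P₂ P₃ L (off + r)) hL0
        split_ifs with hif
        · exact iff_of_true rfl (hpos.1 hif)
        · exact iff_of_false (by norm_num) fun h => hif (hpos.2 h)
      have hvec : ∀ {s l : ℕ}, (∀ i < l, σ.mem (s + i) ≤ 1) → ∀ i,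
          vec σ.mem s l i ≠ 0 ↔ i < l ∧ σ.mem (s + i) = 1 := by
        intro s l hb i
        unfold vec
        split_ifs with hi
        · have := hb i hi; constructor
          · intro h; exact ⟨hi, by omega⟩
          · intro h; omega
        · simp [hi]
      rw [i3 r hr]
      refine hiff.trans ?_
      rw [tripleCount_pos_iff]
      simp only [hP₁, hP₂, hP₃, hvec hb₁, hvec hb₂, hvec hb₃]
      constructor
      · rintro ⟨u, _, v, _, w, _, e, ⟨h1, h2⟩, ⟨h3, h4⟩, h5, h6⟩
        exact ⟨u, h1, v, h3, w, h5, e, h2, h4, h6⟩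
      · rintro ⟨u, h1, v, h3, w, h5, e, h2, h4, h6⟩
        exact ⟨u, by omega, v, by omega, w, by omega, e, ⟨h1, h2⟩, ⟨h3, h4⟩, h5, h6⟩

/-! ### Memory layout and characteristic vector of the items -/

/-- The layout of the memory: `1`, `2`, `3` hold `n`, `t` and the largest item `m`, the registers
`10`, `11`, `16`, `17` the addresses of four vectors, and `12` to `15` those for the transforms. -/
structure Layout (V n m t N D : ℕ) (σ : State) : Prop extends Consts N σ where
  hm : 0 < m
  hn : n ≤ m
  hNm : 4 * m + 4 ≤ N
  hV : 2 * N ^ 40 < V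
  hA : D + 16 * N < V
  hD : D = (t + 3) * (m + 3)
  reg1 : σ.reg 1 = n
  reg2 : σ.reg 2 = t
  reg3 : σ.reg 3 = m
  reg10 : σ.reg 10 = D
  reg11 : σ.reg 11 = D + 2 * N
  reg12 : σ.reg 12 = D + 8 * N
  reg13 : σ.reg 13 = D + 10 * N
  reg14 : σ.reg 14 = D + 12 * N
  reg15 : σ.reg 15 = D + 14 * N
  reg16 : σ.reg 16 = D + 4 * N
  reg17 : σ.reg 17 = D + 6 * N

theorem Layout.congr {V n m t N D : ℕ} {σ σ' : State} (h : Layout V n m t N D σ)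
    (hr : ∀ k < 18, σ'.reg k = σ.reg k) : Layout V n m t N D σ' where
  reg4 := by rw [hr 4 (by norm_num), h.reg4]
  reg5 := by rw [hr 5 (by norm_num), h.reg5]
  reg6 := by rw [hr 6 (by norm_num), h.reg6]
  reg7 := by rw [hr 7 (by norm_num), h.reg7]
  hm := h.hm
  hn := h.hn
  hNm := h.hNm
  hV := h.hV
  hA := h.hA
  hD := h.hD
  reg1 := by rw [hr 1 (by norm_num), h.reg1]
  reg2 := by rw [hr 2 (by norm_num), h.reg2]
  reg3 := by rw [hr 3 (by norm_num), h.reg3]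
  reg10 := by rw [hr 10 (by norm_num), h.reg10]
  reg11 := by rw [hr 11 (by norm_num), h.reg11]
  reg12 := by rw [hr 12 (by norm_num), h.reg12]
  reg13 := by rw [hr 13 (by norm_num), h.reg13]
  reg14 := by rw [hr 14 (by norm_num), h.reg14]
  reg15 := by rw [hr 15 (by norm_num), h.reg15]
  reg16 := by rw [hr 16 (by norm_num), h.reg16]
  reg17 := by rw [hr 17 (by norm_num), h.reg17]

theorem Layout.hN {V n m t N D : ℕ} {σ : State} (h : Layout V n m t N D σ) : 8 ≤ N := by
  have := h.hm; have := h.hNm; omega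

/-- The addresses below `D` have room for the input and for `t + 2` vectors of length `m`; since `R
≤ t`, all stored sets fit. Untouched memory costs no time, so this generous choice is free. -/
theorem Layout.le_D {V n m t N D : ℕ} {σ : State} (h : Layout V n m t N D σ) :
    (t + 2) * m ≤ D ∧ n + 3 ≤ D ∧ 3 * t + m + 3 ≤ D := by
  have h1 := h.hn
  have h2 : D = (t + 2) * m + (m + 3 * t + 9) := by rw [h.hD]; ring
  have h3 : (t + 2) * m = t * m + 2 * m := by ring
  have h4 : t ≤ t * m := Nat.le_mul_of_pos_right t h.hm
  refine ⟨by omega, by omega, by omega⟩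

def readInput : List Cmd :=
  [.set 1 (.read 0), .set 2 (.read 1), .set 3 (.read (.var 1 + 2)), .set 4 4]

def allocate : List Cmd :=
  [.set 5 (.var 4 * .var 4), .set 5 (.var 5 * .var 5), .set 8 (.var 5 * .var 5),
   .set 5 (.var 8 * .var 8), .set 6 (.var 5 * .var 5 * .var 8), .set 7 (2 * .var 6),
   .set 10 ((.var 2 + 3) * (.var 3 + 3)), .set 11 (.var 10 + 2 * .var 4),
   .set 12 (.var 10 + 8 * .var 4), .set 13 (.var 10 + 10 * .var 4),
   .set 14 (.var 10 + 12 * .var 4), .set 15 (.var 10 + 14 * .var 4),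
   .set 16 (.var 10 + 4 * .var 4), .set 17 (.var 10 + 6 * .var 4)]

/-- Read the input and compute the layout. -/
def layout : Program :=
  .seq (block readInput) (.seq (whileLoop (4 * .var 3 + 4 - .var 4) (block [.set 4 (2 * .var 4)]))
    (block allocate))

/-- The condition `2^(j+2) < 4 * m + 4` is `2^j < m + 1`, so doubling stops after exactly `Nat.clog
2 (m + 1)` rounds. -/
theorem runs_layout {V n m t N κ : ℕ} {σ : State} (hm : 0 < m) (hn : n ≤ m)
    (h0 : σ.mem 0 = n) (h1 : σ.mem 1 = t) (h2 : σ.mem (n + 2) = m)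
    (hκ : κ = Nat.clog 2 (m + 1) + 2) (hN : N = 2 ^ κ) (hV : 2 * N ^ 40 < V)
    (hA : (t + 3) * (m + 3) + 16 * N < V) :
    Runs V layout σ (300 * κ) (fun σ' => Layout V n m t N ((t + 3) * (m + 3)) σ' ∧
      σ'.mem = σ.mem) := by
  set c := Nat.clog 2 (m + 1) with hc
  have hNm : 4 * m + 4 ≤ N := by
    have : m + 1 ≤ 2 ^ c := Nat.le_pow_clog (by norm_num) _
    rw [hN, hκ, pow_add]; omega
  set D := (t + 3) * (m + 3) with hD
  have hDm : t + m ≤ D := by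
    have : D = t * m + 3 * t + 3 * m + 9 := by rw [hD]; ring
    omega
  have hnV : n < V ∧ t < V ∧ m < V := by omega
  let Inv : ℕ → State → Prop := fun j σ' => σ'.reg 1 = n ∧ σ'.reg 2 = t ∧ σ'.reg 3 = m ∧
    σ'.reg 4 = 2 ^ (j + 2) ∧ σ'.mem = σ.mem
  have hinit : Runs V (block readInput) σ 50 (Inv 0) := by
    refine runs_block (by decide) (by decide) ?_ ?_
    · simp [readInput, blockOk, Cmd.value, Cmd.run, h0, h1, h2]; omega
    · simp [Inv, readInput, runBlock, Cmd.run, h0, h1, h2]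
  refine (hinit.seq fun σ₀ _ h₀ => (runs_whileLoop_const (by decide) Inv c 50 (70 * c + 50) h₀
    ?_ ?_ ?_ fun _ _ h => h).seq (T₂ := 150) fun σ₁ _ h₁ => ?_).mono (by omega) fun _ _ h => h
  · rintro j hj σ' _ ⟨g1, g2, g3, g4, g5⟩
    have hlt : 2 ^ j < m + 1 := (Nat.lt_clog_iff_pow_lt (by norm_num)).1 hj
    refine ⟨by simp [g3, g4, pow_add]; omega, runs_block (by decide) (by decide) ?_ ?_⟩
    · simp [blockOk, Cmd.value, g4, pow_add]; omega
    · simp [Inv, runBlock, Cmd.run, g1, g2, g3, g4, g5, pow_add]; ring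
  · rintro σ' _ ⟨g1, g2, g3, g4, g5⟩
    simp [g3, g4, ← hκ, ← hN]; omega
  · have : (4 * .var 3 + 4 - .var 4 : Expr).cost = 9 := rfl
    rw [this]; omega
  · obtain ⟨g1, g2, g3, g4, g5⟩ := h₁
    rw [← hκ, ← hN] at g4
    have hle : ∀ k ≤ 40, N ^ k < V := fun k hk =>
      lt_of_le_of_lt (Nat.pow_le_pow_right (by omega) hk) (by omega)
    have e2 : N * N = N ^ 2 := by ring
    have e4 : N ^ 2 * N ^ 2 = N ^ 4 := by ring
    have e8 : N ^ 4 * N ^ 4 = N ^ 8 := by ring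
    have e16 : N ^ 8 * N ^ 8 = N ^ 16 := by ring
    have e40 : N ^ 16 * N ^ 16 * N ^ 8 = N ^ 40 := by ring
    refine runs_block (by decide) (by decide) ?_ ⟨?_, ?_⟩
    · simp only [allocate, blockOk, Cmd.value, Cmd.run]
      simp [g2, g3, g4, e2, e4, e8, e16, e40, hle, ← hD]
      omega
    · constructor
      · constructor <;> simp [allocate, runBlock, Cmd.run, g4, e2, e4, e8, e16, e40]
      all_goals first
        | assumption
        | rfl
        | simp [allocate, runBlock, Cmd.run, g2, g3, g4, hD]
    · simp [allocate, runBlock, Cmd.run, g5]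

def markItems : Program :=
  .seq (block [.put (.var 10) 1, .set 43 0]) (whileLoop (.var 1 + 1 - .var 43)
    (block [.put (.var 10 + .read (.var 43 + 2)) 1, .set 43 (.var 43 + 1)]))

-- The cells from `D` on are zero initially because the input ends before `D`. Cell 0 is marked as
-- well, since the recursion uses the items together with 0.
open Classical in
theorem runs_markItems {V n t N D : ℕ} {a : Fin (n + 1) → ℕ} {σ : State}
    (h : Layout V n (maxItem a) t N D σ) (hm : σ.mem = inputMem a t) :
    Runs V markItems σ (100 * N) (fun σ' => (∀ k < 18, σ'.reg k = σ.reg k) ∧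
      ∀ i, σ'.mem (D + i) = if i ∈ insert 0 (Set.range a) then 1 else 0) := by
  have hN := h.hN
  have hNm := h.hNm
  have hn := h.hn
  have hA := h.hA
  obtain ⟨-, hD, -⟩ := h.le_D
  have hin : ∀ k (hk : k < n + 1), inputMem a t (k + 2) = a ⟨k, hk⟩ := fun k hk => dif_pos hk
  have hout : ∀ i, inputMem a t (D + i) = 0 := by
    intro i
    obtain ⟨k, hk⟩ : ∃ k, D + i = k + 2 := ⟨D + i - 2, by omega⟩
    rw [hk]; exact dif_neg (by omega)
  let Inv : ℕ → State → Prop := fun j σ' => (∀ k < 18, σ'.reg k = σ.reg k) ∧ σ'.reg 43 = j ∧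
    (∀ q < D, σ'.mem q = σ.mem q) ∧
    ∀ i, σ'.mem (D + i) = if i = 0 ∨ ∃ k : Fin (n + 1), k < j ∧ a k = i then 1 else 0
  have hinit : Runs V (block [.put (.var 10) 1, .set 43 0]) σ 10 (Inv 0) := by
    refine runs_block (by decide) (by decide) ?_ ⟨?_, ?_, ?_, ?_⟩
    · simp [blockOk, Cmd.value]; omega
    · exact fun k hk => reg_runBlock (by decide) σ hk
    · simp [runBlock, Cmd.run]
    · intro q hq
      simp [runBlock, Cmd.run, h.reg10]
      rw [Function.update_of_ne hq.ne]
    · intro i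
      simp [runBlock, Cmd.run, h.reg10, Function.update_apply, hm, hout]
  refine (hinit.seq fun σ₀ _ h₀ => runs_whileLoop_const (by decide) Inv (n + 1) 50
    (70 * (n + 1) + 20) h₀ ?_ ?_ ?_ ?_).mono (by omega) fun _ _ h => h
  · rintro j hj σ' _ ⟨g1, g2, g3, g4⟩
    have hl := h.congr g1
    have hread : σ'.mem (j + 2) = a ⟨j, hj⟩ := by rw [g3 _ (by omega), hm, hin j hj]
    refine ⟨by simp [g2, hl.reg1]; omega, runs_block (by decide) (by decide) ?_ ⟨?_, ?_, ?_, ?_⟩⟩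
    · simp [blockOk, Cmd.value, Cmd.run, g2]; omega
    · intro k hk
      rw [reg_runBlock (K := 18) (by decide) _ hk, g1 k hk]
    · simp [runBlock, Cmd.run, g2]
    · intro q hq
      simp [runBlock, Cmd.run, hl.reg10]
      rw [Function.update_of_ne (by omega), g3 q hq]
    · intro i
      simp only [runBlock, Cmd.run]
      simp [hl.reg10, g2, hread, Function.update_apply, g4]
      by_cases hi : i = a ⟨j, hj⟩
      · rw [if_pos hi, if_pos (Or.inr ⟨⟨j, hj⟩, by simp, hi.symm⟩)]
      · rw [if_neg hi]
        congr 1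
        refine propext (or_congr_right ⟨fun ⟨k, h1, h2⟩ => ⟨k, by omega, h2⟩, fun ⟨k, h1, h2⟩ =>
          ⟨k, ?_, h2⟩⟩)
        rcases Nat.lt_or_eq_of_le h1 with h1 | h1
        · exact h1
        · exact absurd (by rw [← h2]; congr 1; exact Fin.ext h1) hi
  · rintro σ' _ ⟨g1, g2, g3, g4⟩
    simp [g2, (h.congr g1).reg1]
  · have : (.var 1 + 1 - .var 43 : Expr).cost = 7 := rfl
    rw [this]; omega
  · rintro σ' _ ⟨g1, g2, g3, g4⟩
    refine ⟨g1, fun i => ?_⟩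
    rw [g4 i]
    congr 1
    simp only [Set.mem_insert_iff, Set.mem_range]
    refine propext (or_congr_right ⟨fun ⟨k, _, h⟩ => ⟨k, h⟩, fun ⟨k, h⟩ => ⟨k, k.isLt, h⟩⟩)

/-! ### The table of roots of unity -/

/-- The integer square root of register `44`, put into register `45`. -/
def isqrt : Program :=
  .seq (block [.set 45 0, .set 46 (.var 5)]) (whileLoop (.var 46)
    (block [.set 45 (.var 45 + .var 46 *
      (1 - ((.var 45 + .var 46) * (.var 45 + .var 46) - .var 44))), .set 46 (.var 46 / 2)]))

/-- The root is found bit by bit, keeping `x² ≤ X < (x + b)²` while `b` is halved from `2^(q+1)` to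
1. The factor `1 - (y² - X)` is the indicator of `y² ≤ X`. -/
theorem runs_isqrt {V q X : ℕ} {σ : State} (h5 : σ.reg 5 = 2 ^ q) (hX : σ.reg 44 = X)
    (hle : X ≤ 2 ^ q * 2 ^ q) (hV : 2 * 2 ^ q < V) :
    Runs V isqrt σ (100 * q + 200) (fun σ' => (∀ k < 45, σ'.reg k = σ.reg k) ∧ σ'.mem = σ.mem ∧
      σ'.reg 45 * σ'.reg 45 ≤ X ∧ X < (σ'.reg 45 + 1) * (σ'.reg 45 + 1)) := by
  let Inv : ℕ → State → Prop := fun j σ' => (∀ k < 45, σ'.reg k = σ.reg k) ∧ σ'.mem = σ.mem ∧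
    σ'.reg 46 = 2 ^ (q + 1 - j) / 2 ∧ σ'.reg 45 * σ'.reg 45 ≤ X ∧
    X < (σ'.reg 45 + 2 ^ (q + 1 - j)) * (σ'.reg 45 + 2 ^ (q + 1 - j))
  have hinit : Runs V (block [.set 45 0, .set 46 (.var 5)]) σ 10 (Inv 0) := by
    refine runs_block (by decide) (by decide) ?_ ⟨?_, ?_, ?_, ?_, ?_⟩
    · simp [blockOk, Cmd.value, Cmd.run, h5]; omega
    · exact fun k hk => reg_runBlock (by decide) σ hk
    · rfl
    · simp [runBlock, Cmd.run, h5, pow_succ]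
    · simp [runBlock, Cmd.run]
    · simp [runBlock, Cmd.run]
      refine lt_of_le_of_lt hle ?_
      have : 2 ^ q < 2 ^ (q + 1) := Nat.pow_lt_pow_right (by norm_num) (by omega)
      exact Nat.mul_lt_mul'' this this
  refine (hinit.seq fun σ₀ _ h₀ => runs_whileLoop_const (by decide) Inv (q + 1) 60
    (100 * q + 180) h₀ ?_ ?_ ?_ ?_).mono (by omega) fun _ _ h => h
  · rintro j hj σ' _ ⟨g1, g2, g3, g4, g5⟩
    obtain ⟨p, hp⟩ : ∃ p, q + 1 - j = p + 1 := ⟨q - j, by omega⟩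
    have hp' : q + 1 - (j + 1) = p := by omega
    have hb : (2 : ℕ) ^ (p + 1) / 2 = 2 ^ p := by rw [pow_succ]; omega
    rw [hp, hb] at g3
    rw [hp] at g5
    have hpos : 0 < 2 ^ p := Nat.pow_pos (by norm_num)
    have e44 : σ'.reg 44 = X := by rw [g1 44 (by norm_num), hX]
    set x := σ'.reg 45 with hx
    set b := 2 ^ p with hbdef
    have hval : x + b * (1 - ((x + b) * (x + b) - X)) = if (x + b) * (x + b) ≤ X then x + b else x := by
      split_ifs with hc
      · rw [Nat.sub_eq_zero_of_le hc]; omega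
      · rw [show 1 - ((x + b) * (x + b) - X) = 0 by omega]; omega
    have hsq : ∀ y, y * y ≤ X → y ≤ 2 ^ q := fun y hy =>
      Nat.mul_self_le_mul_self_iff.1 (hy.trans hle)
    have hnew : (if (x + b) * (x + b) ≤ X then x + b else x) < V := by
      split_ifs with hc
      · have := hsq _ hc; omega
      · have := hsq _ g4; omega
    have hbV : b / 2 < V := by
      have : b ≤ 2 ^ q := Nat.pow_le_pow_right (by norm_num) (by omega)
      omega
    refine ⟨by simp [g3, hpos.ne'], runs_block (by decide) (by decide) ?_ ⟨?_, ?_, ?_, ?_, ?_⟩⟩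
    · simp [blockOk, Cmd.value, Cmd.run, g3, ← hx, e44, hval, hnew, hbV]
    · intro k hk
      rw [reg_runBlock (K := 45) (by decide) _ hk, g1 k hk]
    · simp [runBlock, Cmd.run, g2]
    · simp [runBlock, Cmd.run, g3, hp', hbdef]
    · simp [runBlock, Cmd.run, g3, ← hx, e44, hval]
      split_ifs with hc
      · exact hc
      · exact g4
    · simp [runBlock, Cmd.run, g3, ← hx, e44, hval, hp', ← hbdef]
      split_ifs with hc
      · rw [pow_succ, ← hbdef, show b * 2 = b + b by ring, ← add_assoc] at g5; exact g5
      · omega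
  · rintro σ' _ ⟨g1, g2, g3, g4, g5⟩
    simp [g3]
  · have : (Expr.var 46).cost = 2 := rfl
    rw [this]; omega
  · rintro σ' _ ⟨g1, g2, g3, g4, g5⟩
    exact ⟨g1, g2, g4, by simpa using g5⟩

/-- Halve the angle until register `41` holds the cosine of the angle `2π/N`. -/
def cosine : Program :=
  .seq (block [.set 41 0, .set 42 4]) (whileLoop (.var 4 - .var 42)
    (.seq (block [.set 44 ((.var 5 * .var 5 + .var 5 * .var 41) / 2)])
      (.seq isqrt (block [.set 41 (.var 45), .set 42 (2 * .var 42)]))))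

/-- Start from `cos (π/2) = 0`, with 4 as the denominator of `2π`, and apply the half-angle formula
`κ` times. Each square root costs `O(log N)`, so the total is only quadratic in `log N`. -/
theorem runs_cosine {V n m t N D κ : ℕ} {σ : State} (h : Layout V n m t N D σ)
    (hκ : N = 2 ^ (κ + 2)) :
    Runs V cosine σ (4000 * (κ + 1) * (κ + 1)) (fun σ' => (∀ k < 18, σ'.reg k = σ.reg k) ∧
      σ'.mem = σ.mem ∧ σ'.reg 41 ≤ N ^ 16 ∧
      |(σ'.reg 41 : ℝ) / (N ^ 16 : ℕ) - Real.cos (2 * Real.pi / N)| ≤ 8 / (N ^ 16 : ℕ)) := by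
  have hV := h.hV
  have hN := h.hN
  have hA := h.hA
  have h5 := h.reg5
  have hQ : 0 < N ^ 16 := Nat.pow_pos (by omega)
  have hQ2 : 2 ^ (16 * (κ + 2)) = N ^ 16 := by rw [hκ, ← pow_mul, mul_comm]
  have hQQ : N ^ 16 * N ^ 16 ≤ N ^ 40 := by
    rw [← pow_add]; exact Nat.pow_le_pow_right (by omega) (by norm_num)
  have hQle : N ^ 16 ≤ N ^ 40 := Nat.pow_le_pow_right (by omega) (by norm_num)
  generalize N ^ 16 = Q at *
  generalize N ^ 40 = M at *
  let Inv : ℕ → State → Prop := fun j σ' => (∀ k < 18, σ'.reg k = σ.reg k) ∧ σ'.mem = σ.mem ∧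
    σ'.reg 42 = 2 ^ (j + 2) ∧ σ'.reg 41 ≤ Q ∧
    |(σ'.reg 41 : ℝ) / Q - Real.cos (2 * Real.pi / 2 ^ (j + 2))| ≤ 8 / Q
  have hinit : Runs V (block [.set 41 0, .set 42 4]) σ 10 (Inv 0) := by
    refine runs_block (by decide) (by decide) ?_ ⟨?_, ?_, ?_, ?_, ?_⟩
    · simp [blockOk, Cmd.value]; omega
    · exact fun k hk => reg_runBlock (by decide) σ hk
    · rfl
    · simp [runBlock, Cmd.run]
    · simp [runBlock, Cmd.run]
    · have : 2 * Real.pi / 2 ^ 2 = Real.pi / 2 := by ring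
      simp only [runBlock, Cmd.run, zero_add, this]
      simp
      positivity
  refine (hinit.seq fun σ₀ _ h₀ => runs_whileLoop_const (by decide) Inv κ
    (20 + (100 * (16 * (κ + 2)) + 200 + 20)) (4000 * (κ + 1) * (κ + 1) - 10) h₀ ?_ ?_ ?_ ?_).mono ?_
    fun _ _ h => h
  · rintro j hj σ' _ ⟨g1, g2, g3, g4, g5⟩
    have hl := h.congr g1
    have e5 : σ'.reg 5 = Q := by rw [g1 5 (by norm_num), h5]
    have hlt : 2 ^ (j + 2) < N := hκ ▸ Nat.pow_lt_pow_right (by norm_num) (by omega)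
    set c := σ'.reg 41 with hc
    have hX : (Q * Q + Q * c) / 2 ≤ Q * Q := by
      have := Nat.mul_le_mul_left (Q) g4
      omega
    have hb : Runs V (block [.set 44 ((.var 5 * .var 5 + .var 5 * .var 41) / 2)]) σ' 20 (fun σ'' =>
        (∀ k < 44, σ''.reg k = σ'.reg k) ∧ σ''.reg 44 = (Q * Q + Q * c) / 2 ∧
        σ''.mem = σ'.mem) := by
      refine runs_block (by decide) (by decide) ?_ ⟨?_, ?_, ?_⟩
      · simp [blockOk, Cmd.value, e5, ← hc]; omega
      · exact fun k hk => reg_runBlock (by decide) σ' hk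
      · simp [runBlock, Cmd.run, e5, ← hc]
      · rfl
    refine ⟨by simp [g3, hl.reg4]; omega, hb.seq fun σ₁ _ h₁ => ?_⟩
    obtain ⟨a1, a2, a3⟩ := h₁
    have hsq := runs_isqrt (V := V) (q := 16 * (κ + 2)) (by rw [a1 5 (by norm_num), e5, hQ2]) a2
      (by rw [hQ2]; exact hX) (by rw [hQ2]; omega)
    refine hsq.seq fun σ₂ _ h₂ => ?_
    obtain ⟨b1, b2, b3, b4⟩ := h₂
    have hpow : (1 : ℝ) ≤ 2 ^ j := one_le_pow₀ (by norm_num)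
    have hangle : 2 * Real.pi / 2 ^ (j + 2) ≤ Real.pi / 2 := by
      rw [pow_add, div_le_div_iff₀ (by positivity) (by norm_num)]
      nlinarith [Real.pi_pos]
    obtain ⟨c1, c2⟩ := cos_half_approx hQ (by positivity) hangle g4 g5 b3 b4
    have hz : σ₂.reg 42 = 2 ^ (j + 2) := by
      rw [b1 42 (by norm_num), a1 42 (by norm_num), g3]
    refine runs_block (by decide) (by decide) ?_ ⟨?_, ?_, ?_, ?_, ?_⟩
    · simp [blockOk, Cmd.value, Cmd.run, hz]; omega
    · intro k hk
      rw [reg_runBlock (K := 18) (by decide) _ hk, b1 k (by omega), a1 k (by omega), g1 k hk]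
    · simp [runBlock, Cmd.run, b2, a3, g2]
    · simp [runBlock, Cmd.run, hz, pow_succ]; omega
    · simpa [runBlock, Cmd.run] using c1
    · have : 2 * Real.pi / 2 ^ (j + 2) / 2 = 2 * Real.pi / 2 ^ (j + 1 + 2) := by
        rw [div_div, ← pow_succ]
      rw [this] at c2
      simpa [runBlock, Cmd.run] using c2
  · rintro σ' _ ⟨g1, g2, g3, g4, g5⟩
    simp [g3, (h.congr g1).reg4, hκ]
  · have : (.var 4 - .var 42 : Expr).cost = 5 := rfl
    rw [this]
    have e : 4000 * (κ + 1) * (κ + 1) = 4000 * (κ * κ) + 8000 * κ + 4000 := by ring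
    have e2 : κ * (20 + (100 * (16 * (κ + 2)) + 200 + 20) + 5 + 1) = 1600 * (κ * κ) + 3446 * κ := by
      ring
    omega
  · rintro σ' _ ⟨g1, g2, g3, g4, g5⟩
    refine ⟨g1, g2, g4, ?_⟩
    have : (N : ℝ) = 2 ^ (κ + 2) := by rw [hκ]; push_cast; rfl
    rw [this]; exact g5
  · have : 10 ≤ 4000 * (κ + 1) * (κ + 1) := by
      calc 10 ≤ 4000 * 1 * 1 := by norm_num
        _ ≤ _ := by gcongr <;> omega
    omega

def sine : Program :=
  .seq (block [.set 44 (.var 5 * .var 5 - .var 41 * .var 41)]) (.seq isqrt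
    (block [.set 42 (.var 45)]))

def powersBody : List Cmd :=
  [.set 44 (.var 12 + 2 * .var 43),
   .set 45 (.mulAddRe 0 (.var 41) (.var 42) (.read (.var 44)) (.read (.var 44 + 1))),
   .set 46 (.mulAddIm 0 (.var 41) (.var 42) (.read (.var 44)) (.read (.var 44 + 1))),
   .put (.var 44 + 2) (.var 45), .put (.var 44 + 3) (.var 46), .set 43 (.var 43 + 1)]

/-- The powers of the root of unity in the registers `41` and `42`. -/
def powers : Program :=
  .seq (block [.put (.var 12) (.var 5), .put (.var 12 + 1) 0, .set 43 0])
    (whileLoop (.var 4 - .var 43) (block powersBody))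

theorem runs_powers {V n m t N D : ℕ} {σ : State} (h : Layout V n m t N D σ)
    (hg : Cell N (σ.reg 41) (σ.reg 42) (root N) (1 / (N : ℝ) ^ 12)) :
    Runs V powers σ (1000 * N) (fun σ' => (∀ k < 18, σ'.reg k = σ.reg k) ∧
      (∀ q < D + 8 * N, σ'.mem q = σ.mem q) ∧
      ArrayAt N σ'.mem (D + 8 * N) N (fun e => root N ^ e) (1 / (N : ℝ) ^ 10)) := by
  have hV := h.hV
  have hN := h.hN
  have hA := h.hA
  have hQle : N ^ 16 ≤ N ^ 40 := Nat.pow_le_pow_right (by omega) (by norm_num)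
  set W := D + 8 * N with hW
  -- After `N` rounds also the power `N` has been written, just past the table. It lands in the
  -- first transform buffer, which holds nothing yet.
  let Inv : ℕ → State → Prop := fun j σ' => (∀ k < 43, σ'.reg k = σ.reg k) ∧ σ'.reg 43 = j ∧
    (∀ q < W, σ'.mem q = σ.mem q) ∧ ∀ e ≤ j, Cell N (σ'.mem (W + 2 * e)) (σ'.mem (W + 2 * e + 1))
      (root N ^ e) (3 * e / (N : ℝ) ^ 12)
  have hinit : Runs V (block [.put (.var 12) (.var 5), .put (.var 12 + 1) 0, .set 43 0]) σ 20
      (Inv 0) := by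
    refine runs_block (by decide) (by decide) ?_ ⟨?_, ?_, ?_, ?_⟩
    · simp [blockOk, Cmd.value, Cmd.run, h.reg5]; omega
    · exact fun k hk => reg_runBlock (by decide) σ hk
    · simp [runBlock, Cmd.run]
    · intro q hq
      simp [runBlock, Cmd.run, h.reg12, ← hW]
      rw [Function.update_of_ne (by omega), Function.update_of_ne (by omega)]
    · intro e he
      obtain rfl : e = 0 := by omega
      simpa [runBlock, Cmd.run, h.reg12, h.reg5, ← hW] using cell_bit (N := N) (b := 1) (by omega) le_rfl
  refine (hinit.seq fun σ₀ _ h₀ => runs_whileLoop_const (by decide) Inv N 900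
    (980 * N) h₀ ?_ ?_ ?_ ?_).mono (by omega) fun _ _ h => h
  · rintro j hj σ' hB ⟨g1, g2, g3, g4⟩
    have hl := h.congr fun k hk => g1 k (by omega)
    have hcell := Cell.powStep hN hj hg (g4 j le_rfl)
    have e41 : σ'.reg 41 = σ.reg 41 := g1 41 (by norm_num)
    have e42 : σ'.reg 42 = σ.reg 42 := g1 42 (by norm_num)
    refine ⟨by simp [g2, hl.reg4]; omega, runs_block (by decide) (by decide) ?_ ?_⟩
    · simp only [powersBody, blockOk, Cmd.value, Cmd.run]
      simp [hl.reg12, g2, Expr.mulAddRe, Expr.scaleDown, Expr.mulAddIm, hl.reg5, hl.reg6, hl.reg7]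
      have h40 : 0 < 2 * N ^ 40 := by positivity
      exact ⟨by omega, (Nat.mod_lt _ h40).trans hV, (Nat.mod_lt _ h40).trans hV,
        (Nat.mod_lt _ h40).trans hV, (Nat.mod_lt _ h40).trans hV, by omega⟩
    · have hmem : (runBlock powersBody σ').mem = Function.update (Function.update σ'.mem
          (W + 2 * j + 2) (mulAddRe N 0 (σ.reg 41) (σ.reg 42) (σ'.mem (W + 2 * j))
            (σ'.mem (W + 2 * j + 1)))) (W + 2 * j + 3)
          (mulAddIm N 0 (σ.reg 41) (σ.reg 42) (σ'.mem (W + 2 * j)) (σ'.mem (W + 2 * j + 1))) := by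
        simp only [powersBody, runBlock, Cmd.run]
        simp [hl.reg12, g2, Expr.mulAddRe, Expr.scaleDown, Expr.mulAddIm, hl.reg5, hl.reg6, hl.reg7,
          mulAddRe, mulAddIm, scaleDown, e41, e42, ← hW]
      refine ⟨?_, ?_, ?_, ?_⟩
      · intro k hk
        rw [reg_runBlock (K := 43) (by decide) _ hk, g1 k hk]
      · simp [powersBody, runBlock, Cmd.run, g2]
      · intro q hq
        rw [hmem, Function.update_of_ne (by omega), Function.update_of_ne (by omega), g3 q hq]
      · intro e he
        rw [hmem]
        rcases Nat.lt_or_eq_of_le he with he | rfl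
        · rw [Function.update_of_ne (by omega), Function.update_of_ne (by omega),
            Function.update_of_ne (by omega), Function.update_of_ne (by omega)]
          exact g4 e (by omega)
        · rw [show W + 2 * (j + 1) = W + 2 * j + 2 by ring, Function.update_self,
            Function.update_of_ne (by omega), Function.update_self]
          exact hcell
  · rintro σ' _ ⟨g1, g2, g3, g4⟩
    simp [g2, g1 4 (by norm_num), h.reg4]
  · have : (.var 4 - .var 43 : Expr).cost = 5 := rfl
    rw [this]; omega
  · rintro σ' _ ⟨g1, g2, g3, g4⟩
    exact ⟨fun k hk => g1 k (by omega), g3, fun e he => (g4 e he.le).mono (powError_le hN he)⟩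

/-- The table of the roots of unity. -/
def twiddles : Program := .seq cosine (.seq sine powers)

theorem runs_twiddles {V n m t N D κ : ℕ} {σ : State} (h : Layout V n m t N D σ)
    (hκ : N = 2 ^ (κ + 2)) :
    Runs V twiddles σ (4000 * (κ + 1) * (κ + 1) + 2000 * (κ + 2) + 1000 * N)
      (fun σ' => (∀ k < 18, σ'.reg k = σ.reg k) ∧ (∀ q < D + 8 * N, σ'.mem q = σ.mem q) ∧
        FftEnv V N (D + 8 * N) (D + 10 * N) σ') := by
  have hV := h.hV
  have hN := h.hN
  have hA := h.hA
  have hQ : 0 < N ^ 16 := Nat.pow_pos (by omega)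
  have hQ2 : 2 ^ (16 * (κ + 2)) = N ^ 16 := by rw [hκ, ← pow_mul, mul_comm]
  have hQQ : N ^ 16 * N ^ 16 ≤ N ^ 40 := by
    rw [← pow_add]; exact Nat.pow_le_pow_right (by omega) (by norm_num)
  have hQle : N ^ 16 ≤ N ^ 40 := Nat.pow_le_pow_right (by omega) (by norm_num)
  refine ((runs_cosine h hκ).seq (T₂ := 2000 * (κ + 2) + 1000 * N) fun σ₁ _ h₁ => ?_).mono
    (by omega) fun _ _ h => h
  obtain ⟨a1, a2, a3, a4⟩ := h₁
  have hl₁ := h.congr a1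
  have hb : Runs V (block [.set 44 (.var 5 * .var 5 - .var 41 * .var 41)]) σ₁ 20 (fun σ'' =>
      (∀ k < 44, σ''.reg k = σ₁.reg k) ∧ σ''.reg 44 = N ^ 16 * N ^ 16 - σ₁.reg 41 * σ₁.reg 41 ∧
      σ''.mem = σ₁.mem) := by
    refine runs_block (by decide) (by decide) ?_ ⟨?_, ?_, ?_⟩
    · simp [blockOk, Cmd.value, hl₁.reg5]; omega
    · exact fun k hk => reg_runBlock (by decide) σ₁ hk
    · simp [runBlock, Cmd.run, hl₁.reg5]
    · rfl
  have hsine : Runs V sine σ₁ (2000 * (κ + 2)) (fun σ' => (∀ k < 42, σ'.reg k = σ₁.reg k) ∧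
      σ'.mem = σ₁.mem ∧ σ'.reg 42 ≤ N ^ 16 ∧
      |(σ'.reg 42 : ℝ) / (N ^ 16 : ℕ) - Real.sin (2 * Real.pi / N)| ≤ (1 + 4 * N) / (N ^ 16 : ℕ)) := by
    refine (hb.seq (T₂ := 1600 * (κ + 2) + 200 + 20) fun σ₂ _ h₂ => ?_).mono (by omega) fun _ _ h => h
    obtain ⟨b1, b2, b3⟩ := h₂
    have hsq := runs_isqrt (V := V) (q := 16 * (κ + 2))
      (by rw [b1 5 (by norm_num), hl₁.reg5, hQ2]) b2
      (by rw [hQ2]; exact Nat.sub_le _ _) (by rw [hQ2]; omega)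
    refine (hsq.seq (T₂ := 20) fun σ₃ _ h₃ => ?_).mono (by omega) fun _ _ h => h
    obtain ⟨c1, c2, c3, c4⟩ := h₃
    obtain ⟨d1, d2⟩ := sin_approx (by omega) hQ a3 a4 c3 c4
    refine runs_block (by decide) (by decide) ?_ ⟨?_, ?_, ?_, ?_⟩
    · simp [blockOk, Cmd.value]; omega
    · intro k hk
      rw [reg_runBlock (K := 42) (by decide) _ hk, c1 k (by omega), b1 k (by omega)]
    · simp [runBlock, Cmd.run, c2, b3]
    · simpa [runBlock, Cmd.run] using d1
    · simpa [runBlock, Cmd.run] using d2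
  refine hsine.seq fun σ₂ _ h₂ => ?_
  obtain ⟨b1, b2, b3, b4⟩ := h₂
  have B1 : ∀ k < 18, σ₂.reg k = σ.reg k := fun k hk => (b1 k (by omega)).trans (a1 k hk)
  rw [← b1 41 (by norm_num)] at a3 a4
  refine (runs_powers (h.congr B1) (cell_root hN a3 b3 a4 b4)).mono le_rfl ?_
  rintro σ₃ _ ⟨c1, c2, c3⟩
  have C1 : ∀ k < 18, σ₃.reg k = σ.reg k := fun k hk => (c1 k hk).trans (B1 k hk)
  have hl := h.congr C1
  refine ⟨C1, fun q hq => by rw [c2 q hq, b2, a2], ⟨hl.toConsts, hN, hV, by omega, by omega, hl.reg12,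
    hl.reg13, by rw [hl.reg14]; ring, by rw [hl.reg15]; ring, c3⟩⟩

/-! ### Feasibility of small targets -/

/-- The memory cell is the bit of the proposition. -/
def IsBit (k : ℕ) (P : Prop) : Prop := k ≤ 1 ∧ (k = 1 ↔ P)

theorem IsBit.of_iff {k : ℕ} {P P' : Prop} (h : IsBit k P) (hP : P ↔ P') : IsBit k P' :=
  ⟨h.1, h.2.trans hP⟩

theorem isBit_ite (P : Prop) [Decidable P] : IsBit (if P then 1 else 0) P := by
  unfold IsBit; split_ifs <;> simp [*]

theorem runs_conv_isBit {V N W A : ℕ} {σ : State} (h : FftEnv V N W A σ)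
    {L k str s₁ l₁ s₂ l₂ s₃ l₃ off len dst : ℕ} {P₁ P₂ P₃ : ℕ → Prop}
    (r24 : σ.reg 24 = s₁) (r25 : σ.reg 25 = l₁) (r26 : σ.reg 26 = s₂) (r27 : σ.reg 27 = l₂)
    (r28 : σ.reg 28 = s₃) (r29 : σ.reg 29 = l₃) (r30 : σ.reg 30 = off) (r31 : σ.reg 31 = len)
    (r32 : σ.reg 32 = dst) (r33 : σ.reg 33 = L) (r34 : σ.reg 34 = str)
    (hNL : L * str = N) (hk : L = 2 ^ k)
    (hs₁ : s₁ + l₁ ≤ A) (hs₂ : s₂ + l₂ ≤ A) (hs₃ : s₃ + l₃ ≤ A)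
    (hb₁ : ∀ i < l₁, IsBit (σ.mem (s₁ + i)) (P₁ i)) (hb₂ : ∀ i < l₂, IsBit (σ.mem (s₂ + i)) (P₂ i))
    (hb₃ : ∀ i < l₃, IsBit (σ.mem (s₃ + i)) (P₃ i)) (hsum : l₁ + l₂ + l₃ ≤ L + 2)
    (hoff : off + len ≤ L) (hdst : dst + len ≤ W) :
    Runs V conv σ (100000 * (L * (k + 1))) (fun σ' => (∀ k < 36, σ'.reg k = σ.reg k) ∧
      (∀ q < A, q < dst ∨ dst + len ≤ q → σ'.mem q = σ.mem q) ∧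
      FftEnv V N W A σ' ∧
      ∀ r < len, IsBit (σ'.mem (dst + r)) (∃ u < l₁, ∃ v < l₂, ∃ w < l₃, u + v + w = off + r ∧
        P₁ u ∧ P₂ v ∧ P₃ w)) := by
  refine (runs_conv h r24 r25 r26 r27 r28 r29 r30 r31 r32 r33 r34 hNL hk hs₁ hs₂ hs₃
    (fun i hi => (hb₁ i hi).1) (fun i hi => (hb₂ i hi).1) (fun i hi => (hb₃ i hi).1) hsum hoff
    hdst).mono le_rfl ?_
  rintro σ' _ ⟨h1, h2, h3, h4, h5⟩
  refine ⟨h1, h2, h3, fun r hr => ⟨h4 r hr, (h5 r hr).trans ?_⟩⟩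
  constructor
  · rintro ⟨u, hu, v, hv, w, hw, e, p1, p2, p3⟩
    exact ⟨u, hu, v, hv, w, hw, e, (hb₁ u hu).2.1 p1, (hb₂ v hv).2.1 p2, (hb₃ w hw).2.1 p3⟩
  · rintro ⟨u, hu, v, hv, w, hw, e, p1, p2, p3⟩
    exact ⟨u, hu, v, hv, w, hw, e, (hb₁ u hu).2.2 p1, (hb₂ v hv).2.2 p2, (hb₃ w hw).2.2 p3⟩

/-- The layout, the table of roots and the characteristic vector of the items. -/
structure Setting (V n t N D : ℕ) (a : Fin (n + 1) → ℕ) (σ : State) : Prop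
    extends Layout V n (maxItem a) t N D σ where
  env : FftEnv V N (D + 8 * N) (D + 10 * N) σ
  items : ∀ i < 2 * N, IsBit (σ.mem (D + i)) (i ∈ insert 0 (Set.range a))

theorem Setting.congr {V n t N D : ℕ} {a : Fin (n + 1) → ℕ} {σ σ' : State}
    (h : Setting V n t N D a σ) (hr : ∀ k < 18, σ'.reg k = σ.reg k)
    (hm : ∀ i < 2 * N, σ'.mem (D + i) = σ.mem (D + i))
    (he : FftEnv V N (D + 8 * N) (D + 10 * N) σ') : Setting V n t N D a σ' where
  toLayout := h.toLayout.congr hr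
  env := he
  items i hi := by rw [hm i hi]; exact h.items i hi

/-- Registers 18 to 23 are working registers of the outer phases, so preservation may be asked only
of the layout registers below 18. -/
theorem FftEnv.congr_of_layout {V N W A n m t D : ℕ} {σ σ' : State} (h : FftEnv V N W A σ)
    (hl : Layout V n m t N D σ) (hr : ∀ k < 18, σ'.reg k = σ.reg k)
    (hm : ∀ p, W ≤ p → p < A → σ'.mem p = σ.mem p) : FftEnv V N W A σ' where
  toConsts := (hl.congr hr).toConsts
  hN := h.hN
  hV := h.hV
  hA := h.hA
  hWA := h.hWA
  reg12 := by rw [hr 12 (by norm_num), h.reg12]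
  reg13 := by rw [hr 13 (by norm_num), h.reg13]
  reg14 := by rw [hr 14 (by norm_num), h.reg14]
  reg15 := by rw [hr 15 (by norm_num), h.reg15]
  table := h.table.congr fun k h1 h2 => hm k h1 (by have := h.hWA; omega)

theorem Setting.congr' {V n t N D : ℕ} {a : Fin (n + 1) → ℕ} {σ σ' : State}
    (h : Setting V n t N D a σ) (hr : ∀ k < 18, σ'.reg k = σ.reg k)
    (hm : ∀ i < 2 * N, σ'.mem (D + i) = σ.mem (D + i))
    (he : ∀ p, D + 8 * N ≤ p → p < D + 10 * N → σ'.mem p = σ.mem p) : Setting V n t N D a σ' :=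
  h.congr hr hm (h.env.congr_of_layout h.toLayout hr he)

def doubleArgs : List Cmd :=
  [.set 24 (.var 11), .set 25 (.var 18), .set 26 (.var 11), .set 27 (.var 18), .set 28 (.var 10),
   .set 29 (2 * .var 18), .set 30 0, .set 31 (2 * .var 18), .set 32 (.var 11)]

/-- The bits of the feasible targets below `N / 4`, at the address in register `11`. -/
def smallTargets : Program :=
  .seq (block [.put (.var 11) 1, .set 18 1, .set 33 4, .set 34 (.var 4 / 4)])
    (whileLoop (.var 4 - .var 33) (.seq (block doubleArgs) (.seq conv
      (block [.set 18 (2 * .var 18), .set 33 (2 * .var 33), .set 34 (.var 34 / 2)]))))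

/-- Round `j` extends the known targets from `2^j` to `2^(j+1)` by a convolution of length
`2^(j+2)`, matching the vector lengths `2^j`, `2^j` and `2 * 2^j`. -/
theorem runs_smallTargets {V n t N D κ : ℕ} {a : Fin (n + 1) → ℕ} {σ : State}
    (h : Setting V n t N D a σ) (hκ : N = 2 ^ (κ + 2)) :
    Runs V smallTargets σ (200000 * (N * (κ + 3))) (fun σ' => (∀ k < 18, σ'.reg k = σ.reg k) ∧
      (∀ q < D + 10 * N, q < D + 2 * N ∨ D + 4 * N ≤ q → σ'.mem q = σ.mem q) ∧
      Setting V n t N D a σ' ∧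
      ∀ i ≤ maxItem a, IsBit (σ'.mem (D + 2 * N + i)) (Feasible a i)) := by
  have hN := h.hN
  have hA := h.hA
  have hNm := h.hNm
  let Inv : ℕ → State → Prop := fun j σ' => (∀ k < 18, σ'.reg k = σ.reg k) ∧
    (∀ q < D + 10 * N, q < D + 2 * N ∨ D + 4 * N ≤ q → σ'.mem q = σ.mem q) ∧
    Setting V n t N D a σ' ∧ σ'.reg 18 = 2 ^ j ∧ σ'.reg 33 = 2 ^ (j + 2) ∧
    σ'.reg 34 = 2 ^ (κ - j) ∧
    ∀ i < 2 ^ j, IsBit (σ'.mem (D + 2 * N + i)) (Feasible a i)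
  have hinit : Runs V (block [.put (.var 11) 1, .set 18 1, .set 33 4, .set 34 (.var 4 / 4)]) σ 20
      (Inv 0) := by
    have hreg : ∀ k < 18, (runBlock [.put (.var 11) 1, .set 18 1, .set 33 4,
        .set 34 (.var 4 / 4)] σ).reg k = σ.reg k := fun k hk => reg_runBlock (by decide) σ hk
    have hmem : ∀ q, q ≠ D + 2 * N → (runBlock [.put (.var 11) 1, .set 18 1, .set 33 4,
        .set 34 (.var 4 / 4)] σ).mem q = σ.mem q := by
      intro q hq
      simp [runBlock, Cmd.run, h.reg11, Function.update_of_ne hq]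
    refine runs_block (by decide) (by decide) ?_ ⟨hreg, fun q _ _ => hmem q (by omega),
      h.congr' hreg (fun i hi => hmem _ (by omega)) fun q _ _ => hmem q (by omega), ?_, ?_, ?_, ?_⟩
    · simp [blockOk, Cmd.value, Cmd.run, h.reg4]; omega
    · simp [runBlock, Cmd.run]
    · simp [runBlock, Cmd.run]
    · simp [runBlock, Cmd.run, h.reg4]
      rw [hκ, pow_add]; omega
    · intro i hi
      obtain rfl : i = 0 := by simpa using hi
      simp [runBlock, Cmd.run, h.reg11, IsBit, feasible_zero]
  refine (hinit.seq fun σ₀ _ h₀ => runs_whileLoop (by decide) Inv κ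
    (fun j => 100 + (100000 * (2 ^ (j + 2) * (j + 2 + 1)) + 100)) h₀ ?_ ?_).mono ?_ ?_
  · rintro j hj σ' _ ⟨g1, g2, g3, g4, g5, g6, g7⟩
    have hlt : 2 ^ (j + 2) < N := hκ ▸ Nat.pow_lt_pow_right (by norm_num) (by omega)
    have hb : Runs V (block doubleArgs) σ' 100 (fun σ₁ => (∀ k < 24, σ₁.reg k = σ'.reg k) ∧
        σ₁.mem = σ'.mem ∧ σ₁.reg 24 = D + 2 * N ∧ σ₁.reg 25 = 2 ^ j ∧ σ₁.reg 26 = D + 2 * N ∧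
        σ₁.reg 27 = 2 ^ j ∧ σ₁.reg 28 = D ∧ σ₁.reg 29 = 2 * 2 ^ j ∧ σ₁.reg 30 = 0 ∧
        σ₁.reg 31 = 2 * 2 ^ j ∧ σ₁.reg 32 = D + 2 * N ∧ σ₁.reg 33 = 2 ^ (j + 2) ∧
        σ₁.reg 34 = 2 ^ (κ - j)) := by
      rw [pow_add] at hlt
      refine runs_block (by decide) (by decide) ?_ ⟨fun k hk => reg_runBlock (by decide) σ' hk, ?_⟩
      · simp [doubleArgs, blockOk, Cmd.value, Cmd.run, g3.reg11, g3.reg10, g4]; omega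
      · simp [doubleArgs, runBlock, Cmd.run, g3.reg11, g3.reg10, g4, g5, g6]
    have hp4 : 2 ^ (j + 2) = 4 * 2 ^ j := by ring
    refine ⟨by simp [g5, g3.reg4]; omega, hb.seq fun σ₁ _ h₁ => ?_⟩
    obtain ⟨a1, a2, r24, r25, r26, r27, r28, r29, r30, r31, r32, r33, r34⟩ := h₁
    have hs₁ : Setting V n t N D a σ₁ := g3.congr' (fun k hk => a1 k (by omega))
      (fun i _ => by rw [a2]) (fun q _ _ => by rw [a2])
    refine (runs_conv_isBit hs₁.env r24 r25 r26 r27 r28 r29 r30 r31 r32 r33 r34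
      (by rw [hκ, ← pow_add]; congr 1; omega) rfl (by omega) (by omega) (by omega)
      (fun i hi => by rw [a2]; exact g7 i hi) (fun i hi => by rw [a2]; exact g7 i hi)
      (fun i hi => hs₁.items i (by omega)) (by omega) (by omega) (by omega)).seq fun σ₂ _ h₂ => ?_
    obtain ⟨b1, b2, b3, b4⟩ := h₂
    have B1 : ∀ k < 18, σ₂.reg k = σ.reg k := fun k hk =>
      ((b1 k (by omega)).trans (a1 k (by omega))).trans (g1 k hk)
    have e18 : σ₂.reg 18 = 2 ^ j := by rw [b1 18 (by norm_num), a1 18 (by norm_num), g4]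
    have e33 : σ₂.reg 33 = 2 ^ (j + 2) := by rw [b1 33 (by norm_num), r33]
    have e34 : σ₂.reg 34 = 2 ^ (κ - j) := by rw [b1 34 (by norm_num), r34]
    have hs₂ : Setting V n t N D a σ₂ := hs₁.congr (fun k hk => b1 k (by omega))
      (fun i hi => b2 _ (by omega) (by omega)) b3
    set l : List Cmd := [.set 18 (2 * .var 18), .set 33 (2 * .var 33), .set 34 (.var 34 / 2)]
    have hreg : ∀ k < 18, (runBlock l σ₂).reg k = σ₂.reg k :=
      fun k hk => reg_runBlock (by decide) σ₂ hk
    have hmem : (runBlock l σ₂).mem = σ₂.mem := rfl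
    have hle : 2 ^ (κ - j) ≤ N := hκ ▸ Nat.pow_le_pow_right (by norm_num) (by omega)
    refine runs_block (by decide) (by decide) ?_ ⟨fun k hk => (hreg k hk).trans (B1 k hk), ?_,
      hs₂.congr' hreg (fun i hi => by rw [hmem]) (fun q _ _ => by rw [hmem]), ?_, ?_, ?_, ?_⟩
    · simp [l, blockOk, Cmd.value, Cmd.run, e18, e33, e34]; omega
    · intro q hq hq2
      rw [hmem, b2 q hq (by omega), a2, g2 q hq hq2]
    · simp [l, runBlock, Cmd.run, e18, pow_succ]; ring
    · simp [l, runBlock, Cmd.run, e33, pow_succ]; ring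
    · simp [l, runBlock, Cmd.run, e34]
      rw [show κ - j = κ - (j + 1) + 1 by omega, pow_succ]; omega
    · intro i hi
      rw [hmem]
      rw [pow_succ] at hi
      refine (b4 i (by omega)).of_iff ?_
      rw [feasible_lt_two_mul_iff (Nat.pow_pos (by norm_num) : 0 < 2 ^ j) (by omega)]
      constructor
      · rintro ⟨x, hx, y, hy, z, hz, e, p1, p2, p3⟩
        exact ⟨x, hx, y, hy, z, hz, p3, by omega, p1, p2⟩
      · rintro ⟨x, hx, y, hy, z, hz, p3, e, p1, p2⟩
        exact ⟨x, hx, y, hy, z, hz, by omega, p1, p2, p3⟩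
  · rintro σ' _ ⟨g1, g2, g3, g4, g5, g6, g7⟩
    simp [g5, g3.reg4, hκ]
  · have : (.var 4 - .var 33 : Expr).cost = 5 := rfl
    rw [this]
    -- The lengths form a geometric series, so all rounds together cost as much as one convolution
    -- of length `N`, up to a constant.
    have hsum : ∑ j ∈ range κ, 2 ^ (j + 2) ≤ N := by
      have : ∀ k, ∑ j ∈ range k, 2 ^ (j + 2) ≤ 2 ^ (k + 2) := by
        intro k
        induction k with
        | zero => simp
        | succ k ih => rw [sum_range_succ, pow_succ 2 (k + 2)]; omega
      rw [hκ]; exact this κ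
    calc _ ≤ 20 + (∑ j ∈ range κ, 2 ^ (j + 2) * (101000 * (κ + 3)) + 5 + 1) := by
          gcongr with j hj
          have h1 : j + 3 ≤ κ + 3 := by simp at hj; omega
          have h2 : 0 < 2 ^ (j + 2) := Nat.pow_pos (by norm_num)
          have h3 : 2 ^ (j + 2) * (j + 2 + 1) ≤ 2 ^ (j + 2) * (κ + 3) := Nat.mul_le_mul_left _ h1
          have h4 : 1 ≤ 2 ^ (j + 2) * (κ + 3) := Nat.mul_pos h2 (by omega)
          rw [show 2 ^ (j + 2) * (101000 * (κ + 3)) = 101000 * (2 ^ (j + 2) * (κ + 3)) by ring]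
          omega
      _ ≤ 20 + (N * (101000 * (κ + 3)) + 5 + 1) := by
          rw [← sum_mul]; gcongr
      _ ≤ _ := by
          rw [show N * (101000 * (κ + 3)) = 101000 * (N * (κ + 3)) by ring]
          have : 1 ≤ N * (κ + 3) := Nat.mul_pos (by omega) (by omega)
          omega
  · rintro σ' _ ⟨g1, g2, g3, g4, g5, g6, g7⟩
    refine ⟨g1, g2, g3, fun i hi => g7 i ?_⟩
    rw [hκ, pow_add] at hNm
    omega

/-! ### The doubling algorithm -/

theorem feasIdx_one {n : ℕ} {a : Fin (n + 1) → ℕ} {r : ℕ} :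
    FeasIdx a 1 r ↔ Feasible a (r + 1) := by
  constructor
  · rintro ⟨s, h, hs⟩
    rwa [show r + 1 = s by omega]
  · exact fun h => ⟨r + 1, by omega, h⟩

theorem feasIdx_zero {n : ℕ} {a : Fin (n + 1) → ℕ} {r : ℕ} (hr : r < maxItem a) :
    FeasIdx a 0 r ↔ r + 1 = maxItem a := by
  constructor
  · rintro ⟨s, h, hs⟩
    omega
  · exact fun h => ⟨0, by omega, feasible_zero a⟩

/-- The first vector, and those of the empty sum at the addresses in `16` and `17`. -/
def initVectors : Program :=
  .seq (block [.set 43 0]) (.seq (whileLoop (.var 3 - .var 43)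
    (block [.put (.var 43) (.read (.var 11 + .var 43 + 1)), .set 43 (.var 43 + 1)]))
    (block [.put (.var 16 + .var 3 - 1) 1, .put (.var 17 + .var 3 - 1) 1]))

/-- The vector of `I^(0)` has its single 1 at index `a_n - 1`, the place of the target 0. One copy
becomes the accumulator of the decision phase; the other remains the neutral summand for binary
digits 0. -/
theorem runs_initVectors {V n t N D : ℕ} {a : Fin (n + 1) → ℕ} {σ : State}
    (h : Setting V n t N D a σ)
    (hf : ∀ i ≤ maxItem a, IsBit (σ.mem (D + 2 * N + i)) (Feasible a i))
    (hz : ∀ i < 4 * N, σ.mem (D + 4 * N + i) = 0) :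
    Runs V initVectors σ (100 * N) (fun σ' => Setting V n t N D a σ' ∧
      (∀ r < maxItem a, IsBit (σ'.mem r) (FeasIdx a 1 r)) ∧
      (∀ r < maxItem a, IsBit (σ'.mem (D + 4 * N + r)) (FeasIdx a 0 r)) ∧
      (∀ r < maxItem a, IsBit (σ'.mem (D + 6 * N + r)) (FeasIdx a 0 r))) := by
  have hN := h.hN
  have hA := h.hA
  have hNm := h.hNm
  have hm := h.hm
  obtain ⟨-, -, hD⟩ := h.le_D
  set m := maxItem a with hmdef
  let Inv : ℕ → State → Prop := fun j σ' => (∀ k < 18, σ'.reg k = σ.reg k) ∧ σ'.reg 43 = j ∧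
    (∀ q, D ≤ q → σ'.mem q = σ.mem q) ∧ ∀ r < j, IsBit (σ'.mem r) (FeasIdx a 1 r)
  have hinit : Runs V (block [.set 43 0]) σ 10 (Inv 0) := by
    refine runs_block (by decide) (by decide) ?_ ⟨?_, ?_, ?_, ?_⟩
    · simp [blockOk, Cmd.value]; omega
    · exact fun k hk => reg_runBlock (by decide) σ hk
    · simp [runBlock, Cmd.run]
    · intro p _; rfl
    · intro i hi; omega
  refine (hinit.seq fun σ₀ _ h₀ => (runs_whileLoop_const (by decide) Inv m 50
    (70 * m + 20) h₀ ?_ ?_ ?_ fun _ _ h => h).seq (T₂ := 50) fun σ₁ _ h₁ => ?_).mono (by omega)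
    fun _ _ h => h
  · rintro j hj σ' _ ⟨g1, g2, g3, g4⟩
    have hl := h.toLayout.congr g1
    have hread : σ'.mem (D + 2 * N + j + 1) = σ.mem (D + 2 * N + (j + 1)) := g3 _ (by omega)
    have hbit := hf (j + 1) (by omega)
    have hle := hbit.1
    refine ⟨by simp [g2, hl.reg3]; omega, runs_block (by decide) (by decide) ?_ ⟨?_, ?_, ?_, ?_⟩⟩
    · simp [blockOk, Cmd.value, Cmd.run, g2, hl.reg11, hread]; omega
    · intro k hk
      rw [reg_runBlock (K := 18) (by decide) _ hk, g1 k hk]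
    · simp [runBlock, Cmd.run, g2]
    · intro q hq
      simp [runBlock, Cmd.run, g2]
      rw [Function.update_of_ne (by omega), g3 q hq]
    · intro r hr
      simp [runBlock, Cmd.run, g2, hl.reg11, hread, Function.update_apply]
      rcases Nat.lt_succ_iff_lt_or_eq.1 hr with hr | rfl
      · rw [if_neg (by omega)]; exact g4 r hr
      · rw [if_pos rfl]; exact hbit.of_iff feasIdx_one.symm
  · rintro σ' _ ⟨g1, g2, g3, g4⟩
    simp [g2, (h.toLayout.congr g1).reg3, ← hmdef]
  · have : (.var 3 - .var 43 : Expr).cost = 5 := rfl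
    rw [this]; omega
  · obtain ⟨g1, g2, g3, g4⟩ := h₁
    have hl := h.toLayout.congr g1
    set l : List Cmd := [.put (.var 16 + .var 3 - 1) 1, .put (.var 17 + .var 3 - 1) 1]
    have hreg : ∀ k < 18, (runBlock l σ₁).reg k = σ₁.reg k :=
      fun k hk => reg_runBlock (by decide) σ₁ hk
    have hmem : (runBlock l σ₁).mem = Function.update (Function.update σ₁.mem (D + 4 * N + m - 1) 1)
        (D + 6 * N + m - 1) 1 := by
      simp [l, runBlock, Cmd.run, hl.reg16, hl.reg17, hl.reg3, ← hmdef]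
    have hkeep : ∀ q, q < D + 4 * N ∨ D + 8 * N ≤ q → (runBlock l σ₁).mem q = σ₁.mem q := by
      intro q hq
      rw [hmem, Function.update_of_ne (by omega), Function.update_of_ne (by omega)]
    refine runs_block (by decide) (by decide) ?_ ⟨h.congr' (fun k hk => (hreg k hk).trans (g1 k hk))
      ?_ ?_, ?_, ?_, ?_⟩
    · simp [l, blockOk, Cmd.value]; omega
    · intro i hi
      rw [hkeep _ (by omega), g3 _ (by omega)]
    · intro q hq _
      rw [hkeep _ (by omega), g3 _ (by omega)]
    · intro r hr
      rw [hkeep _ (by omega)]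
      exact g4 r hr
    · intro r hr
      rw [hmem, Function.update_of_ne (by omega), Function.update_apply, g3 _ (by omega),
        hz r (by omega)]
      exact (isBit_ite _).of_iff ((feasIdx_zero hr).trans (by omega)).symm
    · intro r hr
      rw [hmem, Function.update_apply, Function.update_of_ne (by omega), g3 _ (by omega),
        show D + 6 * N + r = D + 4 * N + (2 * N + r) by ring, hz _ (by omega)]
      exact (isBit_ite _).of_iff ((feasIdx_zero hr).trans (by omega)).symm

/-- Register `22` becomes positive if the current vector is not full and does not reach `t`. -/
def testDone : Program :=
  .seq (block [.set 43 0, .set 22 0]) (.seq (whileLoop (.var 3 - .var 43)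
    (block [.set 22 (.var 22 + .read (.var 19 * .var 3 + .var 43)), .set 43 (.var 43 + 1)]))
    (block [.set 22 ((.var 3 - .var 22) * (.var 2 - .var 20 * .var 3))]))

theorem sum_bits {f : ℕ → ℕ} {P : ℕ → Prop} {m : ℕ} (h : ∀ r < m, IsBit (f r) (P r)) :
    ∑ r ∈ range m, f r ≤ m ∧ (m - ∑ r ∈ range m, f r = 0 ↔ ∀ r < m, P r) := by
  induction m with
  | zero => simp
  | succ m ih =>
    obtain ⟨h1, h2⟩ := ih fun r hr => h r (by omega)
    obtain ⟨h3, h4⟩ := h m (by omega)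
    rw [sum_range_succ]
    refine ⟨by omega, ?_⟩
    constructor
    · intro he r hr
      rcases Nat.lt_succ_iff_lt_or_eq.1 hr with hr | rfl
      · exact h2.1 (by omega) r hr
      · exact h4.1 (by omega)
    · intro hP
      have := h2.2 fun r hr => hP r (by omega)
      have := h4.2 (hP m (by omega))
      omega

/-- The truncated product `(m - count) * (t - p * m)` vanishes exactly if one of the two stopping
conditions holds. -/
theorem runs_testDone {V n t N D p q : ℕ} {a : Fin (n + 1) → ℕ} {σ : State} {P : ℕ → Prop}
    (h : Setting V n t N D a σ) (h19 : σ.reg 19 = q) (h20 : σ.reg 20 = p)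
    (hP : ∀ r < maxItem a, IsBit (σ.mem (q * maxItem a + r)) (P r)) :
    Runs V testDone σ (100 * N) (fun σ' => (∀ k < 36, k ≠ 22 → σ'.reg k = σ.reg k) ∧
      σ'.mem = σ.mem ∧ (σ'.reg 22 = 0 ↔ (∀ r < maxItem a, P r) ∨ t ≤ p * maxItem a)) := by
  have hN := h.hN
  have hA := h.hA
  have hNm := h.hNm
  have hm := h.hm
  obtain ⟨hD1, -, hD⟩ := h.le_D
  set m := maxItem a with hmdef
  have hsum := sum_bits hP
  have hpart : ∀ j ≤ m, ∑ r ∈ range j, σ.mem (q * m + r) ≤ m := fun j hj =>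
    (sum_bits fun r hr => hP r (lt_of_lt_of_le hr hj)).1.trans hj
  let Inv : ℕ → State → Prop := fun j σ' => (∀ k < 36, k ≠ 22 → σ'.reg k = σ.reg k) ∧
    σ'.mem = σ.mem ∧ σ'.reg 43 = j ∧ σ'.reg 22 = ∑ r ∈ range j, σ.mem (q * m + r)
  have hreg22 : ∀ {l : List Cmd}, (∀ σ' k, k < 36 → k ≠ 22 → (runBlock l σ').reg k = σ'.reg k) →
    ∀ σ', (∀ k < 36, k ≠ 22 → σ'.reg k = σ.reg k) → ∀ k < 36, k ≠ 22 →
      (runBlock l σ').reg k = σ.reg k := fun hl σ' h' k hk hk' => (hl σ' k hk hk').trans (h' k hk hk')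
  have hinit : Runs V (block [.set 43 0, .set 22 0]) σ 10 (Inv 0) := by
    refine runs_block (by decide) (by decide) ?_ ⟨?_, ?_, ?_, ?_⟩
    · simp [blockOk, Cmd.value]; omega
    · intro k hk hk'
      simp only [runBlock, Cmd.run]
      rw [Function.update_of_ne hk', Function.update_of_ne (by omega)]
    · rfl
    · simp [runBlock, Cmd.run]
    · simp [runBlock, Cmd.run]
  refine (hinit.seq fun σ₀ _ h₀ => (runs_whileLoop_const (by decide) Inv m 50
    (70 * m + 20) h₀ ?_ ?_ ?_ fun _ _ h => h).seq (T₂ := 50) fun σ₁ _ h₁ => ?_).mono (by omega)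
    fun _ _ h => h
  · rintro j hj σ' _ ⟨g1, g2, g3, g4⟩
    have e3 : σ'.reg 3 = m := by rw [g1 3 (by norm_num) (by norm_num), h.reg3]
    have e19 : σ'.reg 19 = q := by rw [g1 19 (by norm_num) (by norm_num), h19]
    have hs := hpart (j + 1) hj
    rw [sum_range_succ] at hs
    refine ⟨by simp [g3, e3]; omega, runs_block (by decide) (by decide) ?_ ⟨?_, ?_, ?_, ?_⟩⟩
    · simp [blockOk, Cmd.value, Cmd.run, g2, g3, g4, e3, e19]; omega
    · intro k hk hk'
      simp only [runBlock, Cmd.run]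
      rw [Function.update_of_ne (by omega), Function.update_of_ne hk', g1 k hk hk']
    · simp [runBlock, Cmd.run, g2]
    · simp [runBlock, Cmd.run, g3]
    · simp [runBlock, Cmd.run, g2, g3, g4, e3, e19, sum_range_succ]
  · rintro σ' _ ⟨g1, g2, g3, g4⟩
    simp [g3, g1 3 (by norm_num) (by norm_num), h.reg3, ← hmdef]
  · have : (.var 3 - .var 43 : Expr).cost = 5 := rfl
    rw [this]; omega
  · obtain ⟨g1, g2, g3, g4⟩ := h₁
    have e3 : σ₁.reg 3 = m := by rw [g1 3 (by norm_num) (by norm_num), h.reg3]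
    have e2 : σ₁.reg 2 = t := by rw [g1 2 (by norm_num) (by norm_num), h.reg2]
    have e20 : σ₁.reg 20 = p := by rw [g1 20 (by norm_num) (by norm_num), h20]
    refine runs_block (by decide) (by decide) ?_ ⟨?_, ?_, ?_⟩
    · simp [blockOk, Cmd.value, g4, e2, e3, e20]
      calc _ ≤ m * t := Nat.mul_le_mul (Nat.sub_le _ _) (Nat.sub_le _ _)
        _ ≤ (t + 2) * m := by rw [mul_comm]; exact Nat.mul_le_mul_right _ (by omega)
        _ < V := by omega
    · intro k hk hk'
      simp only [runBlock, Cmd.run]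
      rw [Function.update_of_ne hk', g1 k hk hk']
    · simp [runBlock, Cmd.run, g2]
    · simp only [runBlock, Cmd.run, Function.update_self]
      simp only [Expr.eval_mul, Expr.eval_sub, Expr.eval_var, g4, e2, e3, e20, Nat.mul_eq_zero, hsum.2]
      rw [Nat.sub_eq_zero_iff_le]

/-- The offset `m - 1` is the index shift of the recursion. The vector lengths `m`, `m`, `m + 1` add
up to less than `N`, so no wrap-around occurs. -/
def doublingArgs : List Cmd :=
  [.set 24 (.var 19 * .var 3), .set 25 (.var 3), .set 26 (.var 19 * .var 3), .set 27 (.var 3),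
   .set 28 (.var 10), .set 29 (.var 3 + 1), .set 30 (.var 3 - 1), .set 31 (.var 3),
   .set 32 (.var 19 * .var 3 + .var 3), .set 33 (.var 4), .set 34 1]

/-- The doubling loop: register `19` counts the rounds. -/
def doubling : Program :=
  .seq (block [.set 19 0, .set 20 1]) (.seq testDone (whileLoop (.var 22)
    (.seq (block doublingArgs) (.seq conv (.seq (block [.set 19 (.var 19 + 1), .set 20 (2 * .var 20)])
      testDone)))))

/-- The sums of two indices of feasible targets and an item are the indices of the next set. -/
theorem feasIdx_add_iff_conv {n : ℕ} {a : Fin (n + 1) → ℕ} (ha : IsItemList a) {i j r : ℕ}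
    (hr : r < maxItem a) :
    FeasIdx a (i + j) r ↔ ∃ u < maxItem a, ∃ v < maxItem a, ∃ w < maxItem a + 1,
      u + v + w = maxItem a - 1 + r ∧ FeasIdx a i u ∧ FeasIdx a j v ∧ w ∈ insert 0 (Set.range a) := by
  rw [feasIdx_add_iff ha i j r hr]
  constructor
  · rintro ⟨x, hx, y, hy, z, hz, e, h1, h2⟩
    refine ⟨x, hx, y, hy, z, ?_, by omega, h1, h2, hz⟩
    rcases hz with rfl | ⟨k, rfl⟩
    · omega
    · have := ha.le_maxItem k; omega
  · rintro ⟨x, hx, y, hy, z, _, e, h1, h2, hz⟩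
    exact ⟨x, hx, y, hy, z, hz, by omega, h1, h2⟩

/-- The loop test is the condition minimised in `doublingDepth`, so exactly `R` rounds are made.
Round `j` writes to `(j + 1) * m`, behind all earlier vectors, which therefore remain as the
required output. -/
theorem runs_doubling {V n t N D κ : ℕ} {a : Fin (n + 1) → ℕ} {σ : State} (ha : IsItemList a)
    (h : Setting V n t N D a σ) (hκ : N = 2 ^ κ)
    (hf : ∀ r < maxItem a, IsBit (σ.mem r) (FeasIdx a 1 r)) :
    Runs V doubling σ ((doublingDepth a t + 1) * (110000 * (N * (κ + 1)))) (fun σ' =>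
      Setting V n t N D a σ' ∧ (∀ q < D + 10 * N, D ≤ q → σ'.mem q = σ.mem q) ∧
      σ'.reg 19 = doublingDepth a t ∧ σ'.reg 20 = 2 ^ doublingDepth a t ∧
      ∀ i ≤ doublingDepth a t, ∀ r < maxItem a,
        IsBit (σ'.mem (i * maxItem a + r)) (FeasIdx a (2 ^ i) r)) := by
  have hN := h.hN
  have hA := h.hA
  have hNm := h.hNm
  have hm := h.hm
  obtain ⟨hD1, -, hD⟩ := h.le_D
  have hRt := doublingDepth_le ha t
  have hspec := doublingDepth_spec ha t
  rw [ncard_feasibleSet_eq_iff (Nat.one_le_two_pow)] at hspec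
  have hlt : ∀ j < doublingDepth a t,
      ¬ ((∀ r < maxItem a, FeasIdx a (2 ^ j) r) ∨ t ≤ 2 ^ j * maxItem a) := by
    intro j hj
    have := not_of_lt_doublingDepth hj
    rw [ncard_feasibleSet_eq_iff (Nat.one_le_two_pow)] at this
    rintro (h1 | h1)
    · exact this.1 h1
    · omega
  set R := doublingDepth a t with hR
  set m := maxItem a with hmdef
  let Pre : ℕ → State → Prop := fun j σ' => Setting V n t N D a σ' ∧
    (∀ q < D + 10 * N, D ≤ q → σ'.mem q = σ.mem q) ∧ σ'.reg 19 = j ∧ σ'.reg 20 = 2 ^ j ∧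
    ∀ i ≤ j, ∀ r < m, IsBit (σ'.mem (i * m + r)) (FeasIdx a (2 ^ i) r)
  let Inv : ℕ → State → Prop := fun j σ' => Pre j σ' ∧
    (σ'.reg 22 = 0 ↔ (∀ r < m, FeasIdx a (2 ^ j) r) ∨ t ≤ 2 ^ j * m)
  have htest : ∀ j σ', Pre j σ' → Runs V testDone σ' (100 * N) (Inv j) := by
    rintro j σ' ⟨g1, g2, g3, g4, g5⟩
    refine (runs_testDone g1 g3 g4 (g5 j le_rfl)).mono le_rfl ?_
    rintro σ'' _ ⟨h1, h2, h3⟩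
    refine ⟨⟨g1.congr' (fun k hk => h1 k (by omega) (by omega)) (fun i _ => by rw [h2])
      (fun q _ _ => by rw [h2]), ?_, ?_, ?_, ?_⟩, h3⟩
    · intro q hq hq'; rw [h2, g2 q hq hq']
    · rw [h1 19 (by norm_num) (by norm_num), g3]
    · rw [h1 20 (by norm_num) (by norm_num), g4]
    · intro i hi r hr; rw [h2]; exact g5 i hi r hr
  have hinit : Runs V (block [.set 19 0, .set 20 1]) σ 10 (Pre 0) := by
    have hreg : ∀ k < 18, (runBlock [.set 19 0, .set 20 1] σ).reg k = σ.reg k :=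
      fun k hk => reg_runBlock (by decide) σ hk
    refine runs_block (by decide) (by decide) ?_ ⟨h.congr' hreg (fun _ _ => rfl) (fun _ _ _ => rfl),
      fun _ _ _ => rfl, ?_, ?_, ?_⟩
    · simp [blockOk, Cmd.value]; omega
    · simp [runBlock, Cmd.run]
    · simp [runBlock, Cmd.run]
    · intro i hi r hr
      obtain rfl : i = 0 := by omega
      simpa [runBlock, Cmd.run] using hf r hr
  have hT : N ≤ N * (κ + 1) := Nat.le_mul_of_pos_right N (by omega)
  refine (hinit.seq fun σ₀ _ h₀ => (htest 0 σ₀ h₀).seq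
    (T₂ := R * (106000 * (N * (κ + 1))) + 3) fun σ₁ _ h₁ =>
    runs_whileLoop_const (by decide) Inv R
      (100 + (100000 * (N * (κ + 1)) + (20 + 100 * N))) (R * (106000 * (N * (κ + 1))) + 3) h₁
      ?_ ?_ ?_ fun _ _ h => h.1).mono ?_ fun _ _ h => h
  · rintro j hj σ' _ ⟨⟨g1, g2, g3, g4, g5⟩, g6⟩
    have hjm : (j + 1) * m + m ≤ D := by
      have : (j + 1) * m + m = (j + 2) * m := by ring
      rw [this]
      exact (Nat.mul_le_mul_right m (by omega)).trans hD1
    -- As long as the loop runs, `2^j` is below `t`; this keeps register 20 within the word bound.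
    have hpm : 2 ^ j * m < t := by
      by_contra hc
      exact hlt j hj (Or.inr (by omega))
    have hp : 2 ^ j ≤ 2 ^ j * m := Nat.le_mul_of_pos_right _ hm
    have hj1 : (j + 1) * m = j * m + m := by ring
    have hb : Runs V (block doublingArgs) σ' 100 (fun σ₁ => (∀ k < 24, σ₁.reg k = σ'.reg k) ∧
        σ₁.mem = σ'.mem ∧ σ₁.reg 24 = j * m ∧ σ₁.reg 25 = m ∧ σ₁.reg 26 = j * m ∧
        σ₁.reg 27 = m ∧ σ₁.reg 28 = D ∧ σ₁.reg 29 = m + 1 ∧ σ₁.reg 30 = m - 1 ∧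
        σ₁.reg 31 = m ∧ σ₁.reg 32 = j * m + m ∧ σ₁.reg 33 = N ∧ σ₁.reg 34 = 1) := by
      refine runs_block (by decide) (by decide) ?_ ⟨fun k hk => reg_runBlock (by decide) σ' hk, ?_⟩
      · simp [doublingArgs, blockOk, Cmd.value, Cmd.run, g1.reg3, g1.reg4, g1.reg10, g3, ← hmdef]; omega
      · simp [doublingArgs, runBlock, Cmd.run, g1.reg3, g1.reg4, g1.reg10, g3, ← hmdef]
    refine ⟨by simpa using fun hc => hlt j hj (g6.1 hc), hb.seq fun σ₁ _ h₁ => ?_⟩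
    obtain ⟨a1, a2, r24, r25, r26, r27, r28, r29, r30, r31, r32, r33, r34⟩ := h₁
    have hs₁ : Setting V n t N D a σ₁ := g1.congr' (fun k hk => a1 k (by omega))
      (fun i _ => by rw [a2]) (fun q _ _ => by rw [a2])
    refine (runs_conv_isBit hs₁.env r24 r25 r26 r27 r28 r29 r30 r31 r32 r33 r34
      (by ring) hκ (by omega) (by omega) (by omega)
      (fun i hi => by rw [a2]; exact g5 j le_rfl i hi) (fun i hi => by rw [a2]; exact g5 j le_rfl i hi)
      (fun i hi => hs₁.items i (by omega)) (by omega) (by omega) (by omega)).seq fun σ₂ _ h₂ => ?_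
    obtain ⟨b1, b2, b3, b4⟩ := h₂
    have e19 : σ₂.reg 19 = j := by rw [b1 19 (by norm_num), a1 19 (by norm_num), g3]
    have e20 : σ₂.reg 20 = 2 ^ j := by rw [b1 20 (by norm_num), a1 20 (by norm_num), g4]
    have hs₂ : Setting V n t N D a σ₂ := hs₁.congr (fun k hk => b1 k (by omega))
      (fun i hi => b2 _ (by omega) (by omega)) b3
    set l : List Cmd := [.set 19 (.var 19 + 1), .set 20 (2 * .var 20)]
    have hreg : ∀ k < 18, (runBlock l σ₂).reg k = σ₂.reg k :=
      fun k hk => reg_runBlock (by decide) σ₂ hk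
    have hmem : (runBlock l σ₂).mem = σ₂.mem := rfl
    have hjpV : j + 1 < V ∧ 2 * 2 ^ j < V := ⟨by omega, by omega⟩
    have hl : Runs V (block l) σ₂ 20 (Pre (j + 1)) := by
      refine runs_block (by decide) (by decide) ?_ ⟨hs₂.congr' hreg (fun i hi => by rw [hmem])
        (fun q _ _ => by rw [hmem]), ?_, ?_, ?_, ?_⟩
      · simpa [l, blockOk, Cmd.value, Cmd.run, e19, e20] using hjpV
      · intro q hq hq'
        rw [hmem, b2 q hq (by omega), a2, g2 q hq hq']
      · simp [l, runBlock, Cmd.run, e19]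
      · simp [l, runBlock, Cmd.run, e20, pow_succ]; ring
      · intro i hi r hr
        rw [hmem]
        rcases Nat.lt_or_eq_of_le hi with hi | rfl
        · have him : i * m ≤ j * m := Nat.mul_le_mul_right m (by omega)
          have hlt' : i * m + r < j * m + m := by omega
          rw [b2 _ (by omega) (by omega), a2]
          exact g5 i (by omega) r hr
        · rw [hj1]
          refine (b4 r hr).of_iff ?_
          rw [pow_succ, mul_two, feasIdx_add_iff_conv ha hr]
    exact hl.seq fun σ₃ _ h₃ => htest (j + 1) σ₃ h₃
  · rintro σ' _ ⟨_, g6⟩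
    simpa using g6.2 hspec
  · have : (Expr.var 22).cost = 2 := rfl
    rw [this]
    have : 100 + (100000 * (N * (κ + 1)) + (20 + 100 * N)) + 2 + 1 ≤ 106000 * (N * (κ + 1)) := by
      omega
    have := Nat.mul_le_mul_left R this
    omega
  · have : (R + 1) * (110000 * (N * (κ + 1))) =
      R * (106000 * (N * (κ + 1))) + R * (4000 * (N * (κ + 1))) + 110000 * (N * (κ + 1)) := by ring
    omega

/-! ### The decision -/

/-- The address in register 26 is chosen by arithmetic: the vector of `A^(2^j)` for a digit 1, that
of `I^(0)` for a digit 0. -/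
def selectArgs : List Cmd :=
  [.set 23 (.var 21 % 2), .set 21 (.var 21 / 2), .set 24 (.var 16), .set 25 (.var 3),
   .set 26 (.var 23 * (.var 18 * .var 3) + (1 - .var 23) * .var 17), .set 27 (.var 3),
   .set 28 (.var 10), .set 29 (.var 3 + 1), .set 30 (.var 3 - 1), .set 31 (.var 3),
   .set 32 (.var 16), .set 33 (.var 4), .set 34 1]

/-- Add up the intervals `I^(2^i)` for the binary digits `i` of the index of the interval of `t`. -/
def combine : Program :=
  .seq (block [.set 18 0, .set 21 ((.var 2 + .var 3 - 1) / .var 3)])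
    (whileLoop (.var 19 + 1 - .var 18)
      (.seq (block selectArgs) (.seq conv (block [.set 18 (.var 18 + 1)]))))

/-- With `K` the index of the interval of `t`, the accumulator after `j` rounds describes `I^(K %
2^j)`. The next digit adds `2^j` or 0 to this index, and both cases are the same convolution. -/
theorem runs_combine {V n t N D κ R : ℕ} {a : Fin (n + 1) → ℕ} {σ : State} (ha : IsItemList a)
    (h : Setting V n t N D a σ) (hκ : N = 2 ^ κ) (h19 : σ.reg 19 = R) (hR : R ≤ t)
    (hs : ∀ i ≤ R, ∀ r < maxItem a, IsBit (σ.mem (i * maxItem a + r)) (FeasIdx a (2 ^ i) r))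
    (hC : ∀ r < maxItem a, IsBit (σ.mem (D + 4 * N + r)) (FeasIdx a 0 r))
    (hE : ∀ r < maxItem a, IsBit (σ.mem (D + 6 * N + r)) (FeasIdx a 0 r)) :
    Runs V combine σ ((R + 1) * (110000 * (N * (κ + 1)))) (fun σ' =>
      Setting V n t N D a σ' ∧ (∀ q < D, σ'.mem q = σ.mem q) ∧ σ'.reg 20 = σ.reg 20 ∧
      ∀ r < maxItem a, IsBit (σ'.mem (D + 4 * N + r))
        (FeasIdx a ((t + maxItem a - 1) / maxItem a % 2 ^ (R + 1)) r)) := by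
  have hN := h.hN
  have hA := h.hA
  have hNm := h.hNm
  have hm := h.hm
  obtain ⟨hD1, -, hD⟩ := h.le_D
  set m := maxItem a with hmdef
  set K := (t + m - 1) / m with hK
  have hKV : K ≤ t + m := (Nat.div_le_self _ _).trans (by omega)
  let Inv : ℕ → State → Prop := fun j σ' => Setting V n t N D a σ' ∧
    (∀ q < D, σ'.mem q = σ.mem q) ∧ (∀ q, D + 6 * N ≤ q → q < D + 8 * N → σ'.mem q = σ.mem q) ∧
    σ'.reg 20 = σ.reg 20 ∧ σ'.reg 19 = R ∧ σ'.reg 18 = j ∧ σ'.reg 21 = K / 2 ^ j ∧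
    ∀ r < m, IsBit (σ'.mem (D + 4 * N + r)) (FeasIdx a (K % 2 ^ j) r)
  have hinit : Runs V (block [.set 18 0, .set 21 ((.var 2 + .var 3 - 1) / .var 3)]) σ 20 (Inv 0) := by
    set l : List Cmd := [.set 18 0, .set 21 ((.var 2 + .var 3 - 1) / .var 3)]
    have hreg : ∀ k < 18, (runBlock l σ).reg k = σ.reg k :=
      fun k hk => reg_runBlock (by decide) σ hk
    refine runs_block (by decide) (by decide) ?_ ⟨h.congr' hreg (fun _ _ => rfl) (fun _ _ _ => rfl),
      fun _ _ => rfl, fun _ _ _ => rfl, ?_, ?_, ?_, ?_, ?_⟩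
    · simp [l, blockOk, Cmd.value, Cmd.run, h.reg2, h.reg3, ← hmdef, ← hK]; omega
    · simp [l, runBlock, Cmd.run]
    · simp [l, runBlock, Cmd.run, h19]
    · simp [l, runBlock, Cmd.run]
    · simp [l, runBlock, Cmd.run, h.reg2, h.reg3, ← hmdef, ← hK]
    · intro r hr
      rw [pow_zero, Nat.mod_one]
      exact hC r hr
  have hT : N ≤ N * (κ + 1) := Nat.le_mul_of_pos_right N (by omega)
  refine (hinit.seq fun σ₀ _ h₀ => runs_whileLoop_const (by decide) Inv (R + 1)
    (150 + (100000 * (N * (κ + 1)) + 20)) ((R + 1) * (105000 * (N * (κ + 1))) + 10) h₀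
    ?_ ?_ ?_ fun σ' _ hI => ⟨hI.1, hI.2.1, hI.2.2.2.1, hI.2.2.2.2.2.2.2⟩).mono ?_ fun _ _ h => h
  · rintro j hj σ' _ ⟨g1, g2, g3, g4, g5, g6, g7, g8⟩
    have hjm : j * m + 2 * m ≤ D := by
      have : j * m + 2 * m = (j + 2) * m := by ring
      rw [this]
      exact (Nat.mul_le_mul_right m (by omega)).trans hD1
    set b := K / 2 ^ j % 2 with hb
    have hb2 : b = 0 ∨ b = 1 := by omega
    have hdiv : K / 2 ^ j / 2 ≤ K := (Nat.div_le_self _ _).trans (Nat.div_le_self _ _)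
    obtain ⟨src, hsrc, hsrcA, hsrcB⟩ : ∃ src, b * (j * m) + (1 - b) * (D + 6 * N) = src ∧
        src + m ≤ D + 8 * N ∧ ∀ r < m, IsBit (σ'.mem (src + r)) (FeasIdx a (2 ^ j * b) r) := by
      refine ⟨_, rfl, ?_, ?_⟩
      · rcases hb2 with hb2 | hb2 <;> rw [hb2] <;> omega
      · intro r hr
        rcases hb2 with hb2 | hb2 <;> rw [hb2]
        · simp only [zero_mul, zero_add, Nat.sub_zero, one_mul, mul_zero]
          rw [g3 _ (by omega) (by omega)]
          exact hE r hr
        · simp only [one_mul, Nat.sub_self, zero_mul, add_zero, mul_one]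
          rw [g2 _ (by omega)]
          exact hs j (by omega) r hr
    have hb : Runs V (block selectArgs) σ' 150 (fun σ₁ => (∀ k < 21, σ₁.reg k = σ'.reg k) ∧
        σ₁.mem = σ'.mem ∧ σ₁.reg 21 = K / 2 ^ j / 2 ∧ σ₁.reg 24 = D + 4 * N ∧ σ₁.reg 25 = m ∧
        σ₁.reg 26 = src ∧ σ₁.reg 27 = m ∧ σ₁.reg 28 = D ∧ σ₁.reg 29 = m + 1 ∧ σ₁.reg 30 = m - 1 ∧
        σ₁.reg 31 = m ∧ σ₁.reg 32 = D + 4 * N ∧ σ₁.reg 33 = N ∧ σ₁.reg 34 = 1) := by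
      refine runs_block (by decide) (by decide) ?_ ⟨fun k hk => reg_runBlock (by decide) σ' hk, ?_⟩
      · simp [selectArgs, blockOk, Cmd.value, Cmd.run, g1.reg3, g1.reg4, g1.reg10, g1.reg16,
          g1.reg17, g6, g7, ← hmdef, ← hb, hsrc]
        omega
      · simp [selectArgs, runBlock, Cmd.run, g1.reg3, g1.reg4, g1.reg10, g1.reg16,
          g1.reg17, g6, g7, ← hmdef, ← hb, hsrc]
    refine ⟨by simp [g5, g6]; omega, hb.seq fun σ₁ _ h₁ => ?_⟩
    obtain ⟨a1, a2, r21, r24, r25, r26, r27, r28, r29, r30, r31, r32, r33, r34⟩ := h₁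
    have hs₁ : Setting V n t N D a σ₁ := g1.congr' (fun k hk => a1 k (by omega))
      (fun i _ => by rw [a2]) (fun q _ _ => by rw [a2])
    refine (runs_conv_isBit hs₁.env r24 r25 r26 r27 r28 r29 r30 r31 r32 r33 r34
      (by ring) hκ (by omega) (by omega) (by omega)
      (fun i hi => by rw [a2]; exact g8 i hi) (fun i hi => by rw [a2]; exact hsrcB i hi)
      (fun i hi => hs₁.items i (by omega)) (by omega) (by omega) (by omega)).seq fun σ₂ _ h₂ => ?_
    obtain ⟨b1, b2, b3, b4⟩ := h₂
    have hs₂ : Setting V n t N D a σ₂ := hs₁.congr (fun k hk => b1 k (by omega))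
      (fun i hi => b2 _ (by omega) (by omega)) b3
    have e18 : σ₂.reg 18 = j := by rw [b1 18 (by norm_num), a1 18 (by norm_num), g6]
    set l : List Cmd := [.set 18 (.var 18 + 1)]
    have hreg : ∀ k < 18, (runBlock l σ₂).reg k = σ₂.reg k :=
      fun k hk => reg_runBlock (by decide) σ₂ hk
    have hreg' : ∀ k, k ≠ 18 → (runBlock l σ₂).reg k = σ₂.reg k :=
      fun k hk => by simp [l, runBlock, Cmd.run, Function.update_of_ne hk]
    have hmem : (runBlock l σ₂).mem = σ₂.mem := rfl
    refine runs_block (by decide) (by decide) ?_ ⟨hs₂.congr' hreg (fun i hi => by rw [hmem])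
        (fun q _ _ => by rw [hmem]), ?_, ?_, ?_, ?_, ?_, ?_, ?_⟩
    · simp [l, blockOk, Cmd.value, e18]; omega
    · intro q hq
      rw [hmem, b2 q (by omega) (by omega), a2, g2 q hq]
    · intro q hq hq'
      rw [hmem, b2 q (by omega) (by omega), a2, g3 q hq hq']
    · rw [hreg' 20 (by norm_num), b1 20 (by norm_num), a1 20 (by norm_num), g4]
    · rw [hreg' 19 (by norm_num), b1 19 (by norm_num), a1 19 (by norm_num), g5]
    · simp [l, runBlock, Cmd.run, e18]
    · rw [hreg' 21 (by norm_num), b1 21 (by norm_num), r21, Nat.div_div_eq_div_mul, pow_succ]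
    · intro r hr
      rw [hmem]
      refine (b4 r hr).of_iff ?_
      rw [Nat.mod_pow_succ, feasIdx_add_iff_conv ha hr]
  · rintro σ' _ ⟨g1, g2, g3, g4, g5, g6, g7, g8⟩
    simp [g5, g6]
  · have : (.var 19 + 1 - .var 18 : Expr).cost = 7 := rfl
    rw [this]
    have : 150 + (100000 * (N * (κ + 1)) + 20) + 7 + 1 ≤ 105000 * (N * (κ + 1)) := by
      omega
    have := Nat.mul_le_mul_left (R + 1) this
    omega
  · have : (R + 1) * (110000 * (N * (κ + 1))) =
      (R + 1) * (105000 * (N * (κ + 1))) + R * (5000 * (N * (κ + 1))) + 5000 * (N * (κ + 1)) := by ring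
    omega

/-- The sum is positive if `t` lies beyond the last interval, which is then full, or if the computed
bit of `t` is 1. -/
def answer : Program :=
  block [.set 0 (1 - (1 - ((.var 2 - .var 20 * .var 3) +
    .read (.var 16 + (.var 2 + .var 3 - 1) % .var 3))))]

/-- The algorithm for Unbounded SubsetSum. -/
def decideSubsetSum : Program :=
  .seq layout (.seq markItems (.seq twiddles (.seq smallTargets (.seq initVectors
    (.seq doubling (.seq combine answer))))))

/-- For `t ≤ 2^R * a_n` the interval index is at most `2^R`, so `R + 1` binary digits determine it
and the remainder changes nothing. The target 0 falls under index 0. -/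
theorem feasible_iff_feasIdx {n : ℕ} {a : Fin (n + 1) → ℕ} (ha : IsItemList a) {t R : ℕ}
    (hR : doublingDepth a t = R) :
    Feasible a t ↔ 2 ^ R * maxItem a < t ∨
      FeasIdx a ((t + maxItem a - 1) / maxItem a % 2 ^ (R + 1)) ((t + maxItem a - 1) % maxItem a) := by
  have hm := ha.maxItem_pos
  have hspec := doublingDepth_spec ha t
  rw [hR, ncard_feasibleSet_eq_iff (Nat.one_le_two_pow)] at hspec
  by_cases ht : 2 ^ R * maxItem a < t
  · refine iff_of_true ?_ (Or.inl ht)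
    refine feasible_of_full ha (hspec.resolve_right (by omega)) (by omega)
  · have hK : (t + maxItem a - 1) / maxItem a ≤ 2 ^ R := by
      refine Nat.lt_succ_iff.1 ((Nat.div_lt_iff_lt_mul hm).2 ?_)
      rw [Nat.succ_mul]; omega
    have hlt : (t + maxItem a - 1) / maxItem a < 2 ^ (R + 1) := by
      have : 0 < 2 ^ R := Nat.pow_pos (by norm_num)
      rw [pow_succ]; omega
    rw [Nat.mod_eq_of_lt hlt, or_iff_right ht]
    have hdm := Nat.div_add_mod' (t + maxItem a - 1) (maxItem a)
    constructor
    · exact fun h => ⟨t, by omega, h⟩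
    · rintro ⟨s, hs, h⟩
      rwa [show t = s by omega]

theorem runs_decideSubsetSum {V n t N κ : ℕ} {a : Fin (n + 1) → ℕ} (ha : IsItemList a)
    (hκ : κ = Nat.clog 2 (maxItem a + 1)) (hN : N = 2 ^ (κ + 2)) (hV : 2 * N ^ 40 < V)
    (hA : (t + 3) * (maxItem a + 3) + 16 * N < V) :
    Runs V decideSubsetSum (initState a t) ((doublingDepth a t + 1) * (1000000 * (N * (κ + 3))))
      (fun σ' => Decides a t σ' ∧ StoresFeasibleSets a t σ') := by
  have hm := ha.maxItem_pos
  have hn := ha.length_le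
  set D := (t + 3) * (maxItem a + 3) with hD
  have h2 : (initState a t).mem (n + 2) = maxItem a := by
    simp [initState, inputMem, maxItem, Fin.last]
  have hκN : κ + 2 < N := hN ▸ Nat.lt_two_pow_self
  have hNκ : N ≤ N * (κ + 3) := Nat.le_mul_of_pos_right N (by omega)
  -- The quadratic logarithmic cost of the cosine is absorbed by `N log N`.
  have hκκ : (κ + 1) * (κ + 1) ≤ N * (κ + 3) := Nat.mul_le_mul (by omega) (by omega)
  have hκ3 : κ + 3 ≤ N * (κ + 3) := Nat.le_mul_of_pos_left _ (by omega)
  refine ((runs_layout (t := t) hm hn rfl rfl h2 (congrArg (· + 2) hκ) hN hV hA).seq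
    fun σ₁ _ h₁ => (runs_markItems h₁.1 h₁.2).seq
    (T₂ := 7000 * (N * (κ + 3)) + 200000 * (N * (κ + 3)) + 100 * N +
      (doublingDepth a t + 1) * (110000 * (N * (κ + 3))) * 2 + 100) fun σ₂ _ h₂ => ?_).mono ?_
    fun _ _ h => h
  · obtain ⟨h₁, -⟩ := h₁
    obtain ⟨a1, a2⟩ := h₂
    have hNm := h₁.hNm
    have hl₂ := h₁.congr a1
    refine ((runs_twiddles hl₂ hN).seq (T₂ := 200000 * (N * (κ + 3)) + 100 * N +
      (doublingDepth a t + 1) * (110000 * (N * (κ + 3))) * 2 + 100) fun σ₃ _ h₃ => ?_).mono ?_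
      fun _ _ h => h
    swap
    · have : 4000 * (κ + 1) * (κ + 1) = 4000 * ((κ + 1) * (κ + 1)) := by ring
      omega
    obtain ⟨b1, b2, b3⟩ := h₃
    have hs₃ : Setting V n t N D a σ₃ := ⟨hl₂.congr b1, b3, fun i hi => by
      rw [b2 _ (by omega), a2]
      classical exact isBit_ite _⟩
    refine ((runs_smallTargets hs₃ hN).seq (T₂ := 100 * N +
      (doublingDepth a t + 1) * (110000 * (N * (κ + 3))) * 2 + 100) fun σ₄ _ h₄ => ?_).mono
      (by omega) fun _ _ h => h
    obtain ⟨c1, c2, c3, c4⟩ := h₄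
    -- The marks at `D + a_i` end before `D + 4 * N`, and the later phases so far have written
    -- elsewhere.
    have hzero : ∀ i < 4 * N, σ₄.mem (D + 4 * N + i) = 0 := by
      intro i hi
      rw [c2 _ (by omega) (by omega), b2 _ (by omega), add_assoc, a2, if_neg]
      rintro (h0 | ⟨k, hk⟩)
      · omega
      · have := ha.le_maxItem k
        omega
    refine ((runs_initVectors c3 c4 hzero).seq (T₂ :=
      (doublingDepth a t + 1) * (110000 * (N * (κ + 3))) * 2 + 100) fun σ₅ _ h₅ => ?_).mono
      (by omega) fun _ _ h => h
    obtain ⟨d1, d2, d3, d4⟩ := h₅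
    have hA := d1.hA
    refine ((runs_doubling ha d1 hN d2).seq (T₂ :=
      (doublingDepth a t + 1) * (110000 * (N * (κ + 3))) + 100) fun σ₆ _ h₆ => ?_).mono
      (by rw [mul_two, show κ + 2 + 1 = κ + 3 from rfl]; omega) fun _ _ h => h
    obtain ⟨e1, e2, e3, e4, e5⟩ := h₆
    refine (runs_combine ha e1 hN e3 (doublingDepth_le ha t) e5
      (fun r hr => by rw [e2 _ (by omega) (by omega)]; exact d3 r hr)
      (fun r hr => by rw [e2 _ (by omega) (by omega)]; exact d4 r hr)).seq fun σ₇ _ h₇ => ?_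
    obtain ⟨f1, f2, f3, f4⟩ := h₇
    have hf := f4 _ (Nat.mod_lt (t + maxItem a - 1) hm)
    have hval : (runBlock [.set 0 (1 - (1 - ((.var 2 - .var 20 * .var 3) +
        .read (.var 16 + (.var 2 + .var 3 - 1) % .var 3))))] σ₇).reg 0 =
        1 - (1 - ((t - 2 ^ doublingDepth a t * maxItem a) +
          σ₇.mem (D + 4 * N + (t + maxItem a - 1) % maxItem a))) := by
      simp [runBlock, Cmd.run, f1.reg2, f1.reg3, f1.reg16, f3, e4]
    have hiff := feasible_iff_feasIdx ha (t := t) rfl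
    obtain ⟨hf1, hf2⟩ := hf
    refine runs_block (by decide) (by decide) ?_ ⟨⟨?_, ?_⟩, ?_⟩
    · simp [blockOk, Cmd.value]; omega
    · intro hfeas
      rw [hval]
      rcases hiff.1 hfeas with h | h
      · omega
      · have := hf2.2 h; omega
    · intro hfeas
      rw [hval]
      have h := mt hiff.2 hfeas
      push Not at h
      have := mt hf2.1 h.2
      omega
    · intro i hi r hr
      have hmem : ∀ q, (runBlock [.set 0 (1 - (1 - ((.var 2 - .var 20 * .var 3) +
        .read (.var 16 + (.var 2 + .var 3 - 1) % .var 3))))] σ₇).mem q = σ₇.mem q := fun _ => rfl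
      have hlt : i * maxItem a + r < D := by
        obtain ⟨hD1, -, -⟩ := f1.le_D
        have hit := hi.trans (doublingDepth_le ha t)
        have := Nat.mul_le_mul_right (maxItem a) (show i + 1 ≤ t + 2 by omega)
        rw [add_mul] at this
        omega
      rw [hmem, f2 _ hlt, mem_feasibleSet_iff Nat.one_le_two_pow hr]
      obtain ⟨h1, h2⟩ := e5 i hi r hr
      refine ⟨h2.2, fun h => ?_⟩
      have := mt h2.1 h
      omega
  · have : (doublingDepth a t + 1) * (1000000 * (N * (κ + 3))) =
      (doublingDepth a t + 1) * (110000 * (N * (κ + 3))) * 2 +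
      (doublingDepth a t) * (780000 * (N * (κ + 3))) + 780000 * (N * (κ + 3)) := by ring
    omega

/-! ### Word length and the final time bound. -/

theorem transformLength_le {m κ N : ℕ} (hm : 0 < m) (hκ : κ = Nat.clog 2 (m + 1))
    (hN : N = 2 ^ (κ + 2)) : N ≤ 8 * m := by
  have h1 : 2 ^ (κ - 1) < m + 1 := by
    rw [hκ]; exact Nat.pow_pred_clog_lt_self (by norm_num) (by omega)
  have h2 : 0 < κ := hκ ▸ Nat.clog_pos (by norm_num) (by omega)
  rw [hN, show κ + 2 = κ - 1 + 3 by omega, pow_add]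
  omega

theorem clog_add_three_le {m κ : ℕ} (hm : 0 < m) (hκ : κ = Nat.clog 2 (m + 1)) :
    (κ : ℝ) + 3 ≤ 5 / Real.log 2 * Real.log (1 + m) := by
  have h1 : 2 ^ (κ + 2) ≤ 8 * m := transformLength_le hm hκ rfl
  have hlog2 : 0 < Real.log 2 := Real.log_pos (by norm_num)
  have hm' : (1 : ℝ) ≤ m := by exact_mod_cast hm
  have h2 : (2 : ℝ) ^ κ ≤ 2 * (1 + m) := by
    have : 2 ^ κ ≤ 2 * (1 + m) := by rw [pow_add] at h1; omega
    exact_mod_cast this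
  have h3 := Real.log_le_log (by positivity) h2
  rw [Real.log_pow, Real.log_mul (by norm_num) (by positivity)] at h3
  have h4 : Real.log 2 ≤ Real.log (1 + m) := Real.log_le_log (by norm_num) (by linarith)
  rw [div_mul_eq_mul_div, le_div_iff₀ hlog2]
  nlinarith

/-- As `X = m + t + 2 ≥ 3`, one has `N ≤ 8 * m ≤ X ^ 3`, and `2 * N ^ 40 ≤ X ^ 121`; the exponent
250 is merely generous. -/
theorem bounds_lt_pow {m t N : ℕ} (hm : 0 < m) (hN : N ≤ 8 * m) :
    2 * N ^ 40 < (m + t + 2) ^ 250 ∧ (t + 3) * (m + 3) + 16 * N < (m + t + 2) ^ 250 ∧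
      1000 ≤ (m + t + 2) ^ 250 ∧ m + t + 2 < (m + t + 2) ^ 250 := by
  obtain ⟨X, hX⟩ : ∃ X, X = m + t + 2 := ⟨_, rfl⟩
  rw [← hX]
  have hX3 : 3 ≤ X := by omega
  have hX2 : 3 ^ 2 ≤ X ^ 2 := Nat.pow_le_pow_left hX3 2
  have hNX : N ≤ X ^ 3 := by
    calc N ≤ 8 * m := hN
      _ ≤ X ^ 2 * X := Nat.mul_le_mul (by omega) (by omega)
      _ = X ^ 3 := by ring
  have hpow : ∀ i, i < 250 → X ^ i < X ^ 250 := fun i hi => Nat.pow_lt_pow_right (by omega) hi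
  refine ⟨?_, ?_, ?_, ?_⟩
  · calc 2 * N ^ 40 ≤ X * (X ^ 3) ^ 40 := Nat.mul_le_mul (by omega) (Nat.pow_le_pow_left hNX 40)
      _ = X ^ 121 := by ring
      _ < X ^ 250 := hpow _ (by norm_num)
  · have h6 : X ^ 3 * 27 ≤ X ^ 3 * X ^ 3 := Nat.mul_le_mul_left _ (Nat.pow_le_pow_left hX3 3)
    calc (t + 3) * (m + 3) + 16 * N ≤ (2 * X) * (2 * X) + 16 * X ^ 3 := by gcongr <;> omega
      _ = 4 * X ^ 2 + 16 * X ^ 3 := by ring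
      _ ≤ 4 * X ^ 3 + 16 * X ^ 3 := by gcongr <;> omega
      _ ≤ X ^ 3 * X ^ 3 := by omega
      _ = X ^ 6 := by ring
      _ < X ^ 250 := hpow _ (by norm_num)
  · calc 1000 ≤ 3 ^ 10 := by norm_num
      _ ≤ X ^ 10 := Nat.pow_le_pow_left hX3 10
      _ ≤ X ^ 250 := (hpow _ (by norm_num)).le
  · simpa using hpow 1 (by norm_num)

theorem bdd_initState {n t V : ℕ} {a : Fin (n + 1) → ℕ} (ha : IsItemList a)
    (hV : maxItem a + t + 2 < V) : Bdd V (initState a t) := by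
  refine ⟨fun k => by simp [initState]; omega, fun i => ?_⟩
  have := ha.length_le
  rcases i with _ | _ | i
  · simp [initState, inputMem]; omega
  · simp [initState, inputMem]; omega
  · simp only [initState, inputMem]
    split_ifs with h
    · have := ha.le_maxItem ⟨i, h⟩; omega
    · omega

theorem time_le {T R N κ c : ℕ} {m b l l' d : ℝ} (hT : T ≤ (R + 1) * (c * (N * (κ + 3))))
    (hR : (R : ℝ) + 1 ≤ b * l') (hN : (N : ℝ) ≤ 8 * m) (hκ : (κ : ℝ) + 3 ≤ d * l) :
    (T : ℝ) ≤ b * (c * (8 * d)) * (m * l * l') := by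
  have hT' : (T : ℝ) ≤ (R + 1) * (c * (N * (κ + 3))) := by exact_mod_cast hT
  have h1 : (N : ℝ) * (κ + 3) ≤ 8 * m * (d * l) :=
    mul_le_mul hN hκ (by positivity) (le_trans (by positivity) hN)
  have h2 := mul_le_mul_of_nonneg_left h1 (Nat.cast_nonneg (α := ℝ) c)
  refine hT'.trans ((mul_le_mul hR h2 (by positivity) (le_trans (by positivity) hR)).trans_eq ?_)
  ring

theorem exists_program : ∃ (p : Program) (c : ℕ) (C : ℝ),
    ∀ (n : ℕ) (a : Fin (n + 1) → ℕ) (t : ℕ), IsItemList a → ∃ (T : ℕ) (s : State),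
      Exec ((maxItem a + t + 2) ^ c) p (initState a t) T s ∧ Decides a t s ∧
      StoresFeasibleSets a t s ∧ (T : ℝ) ≤ C * targetTime a t := by
  -- `V = (a_n + t + 2) ^ 250` bounds stored values and words are below `V ^ 40`. The time constant
  -- multiplies `3 / log 2` for the number of rounds, 8 for `N ≤ 8 * a_n`, `5 / log 2` for `κ + 3`,
  -- and the step count per unit.
  refine ⟨decideSubsetSum, 250 * 40, 3 / Real.log 2 * ((1000000 : ℕ) * (8 * (5 / Real.log 2))),
    fun n a t ha => ?_⟩
  have hm := ha.maxItem_pos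
  obtain ⟨κ, hκ⟩ : ∃ κ, κ = Nat.clog 2 (maxItem a + 1) := ⟨_, rfl⟩
  obtain ⟨N, hN⟩ : ∃ N, N = 2 ^ (κ + 2) := ⟨_, rfl⟩
  have hNm := transformLength_le hm hκ hN
  have hbounds := bounds_lt_pow (t := t) hm hNm
  obtain ⟨V, hV⟩ : ∃ V, V = (maxItem a + t + 2) ^ 250 := ⟨_, rfl⟩
  rw [← hV] at hbounds
  obtain ⟨h1, h2, h3, h4⟩ := hbounds
  obtain ⟨T, hT, s, σ, hexec, hagree, -, hdec, hsets⟩ :=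
    runs_decideSubsetSum ha hκ hN h1 h2 h3 (bdd_initState ha h4) _ ⟨fun _ _ => rfl, rfl⟩
  refine ⟨T, s, by rw [pow_mul, ← hV]; exact hexec, ?_, ?_, ?_⟩
  · unfold Decides; rw [hagree.1 0 (by norm_num)]; exact hdec
  · unfold StoresFeasibleSets; rw [hagree.2]; exact hsets
  · have hR := doublingDepth_succ_le_log ha t
    have hlog := clog_add_three_le hm hκ
    have hNm' : (N : ℝ) ≤ 8 * maxItem a := by exact_mod_cast hNm
    exact time_le hT hR hNm' hlog

end UnboundedSubsetSum

theorem mainTheorem5 :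
    -- one program solves the problem within the time bound, on words of logarithmic length
    (∃ (p : UnboundedSubsetSum.Program) (c : ℕ) (C : ℝ),
      ∀ (n : ℕ) (a : Fin (n + 1) → ℕ) (t : ℕ), UnboundedSubsetSum.IsItemList a →
        ∃ (T : ℕ) (s : UnboundedSubsetSum.State),
          UnboundedSubsetSum.Exec ((UnboundedSubsetSum.maxItem a + t + 2) ^ c) p
            (UnboundedSubsetSum.initState a t) T s ∧
          UnboundedSubsetSum.Decides a t s ∧
          UnboundedSubsetSum.StoresFeasibleSets a t s ∧
          (T : ℝ) ≤ C * UnboundedSubsetSum.targetTime a t) ∧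
    -- the time bound in terms of the number of items
    (∃ C : ℝ, ∀ (n : ℕ) (a : Fin (n + 1) → ℕ) (t : ℕ), UnboundedSubsetSum.IsItemList a →
      UnboundedSubsetSum.targetTime a t ≤ C * UnboundedSubsetSum.itemTime a) ∧
    -- the recursion for the feasibility sets
    (∀ (n : ℕ) (a : Fin (n + 1) → ℕ), UnboundedSubsetSum.IsItemList a →
      ∀ i j : ℕ, 1 ≤ i → 1 ≤ j →
        UnboundedSubsetSum.feasibleSet a (i + j) =
          (UnboundedSubsetSum.feasibleSet a i + UnboundedSubsetSum.feasibleSet a j +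
            insert 0 (Set.range a)) ∩ UnboundedSubsetSum.interval a (i + j)) :=
  ⟨UnboundedSubsetSum.exists_program, UnboundedSubsetSum.exists_targetTime_le,
    fun _ _ ha _ _ hi hj => UnboundedSubsetSum.feasibleSet_add ha hi hj⟩
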